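/- **Setting.** Let $\mathbb{F}=\mathbb{Q}(q^{1/4},t^{1/4})$ with $q,t$ independent, $\gamma^{1/2}$, $x^\pm(z)=\sum_{n\in\mathbb Z}x^\pm_nz^{-n}$, $\psi^\pm(z)=\sum_{n\ge0}\psi^\pm_{\pm n}z^{\mp n}$ the Drinfeld currents of the quantum algebra $\mathcal U$ of type $W_{1+\infty}$ (Ding–Iohara–Miki algebra), with the coproduct $\Delta(\gamma^{\pm1/2})=\gamma^{\pm1/2}\otimes\gamma^{\pm1/2}$, $\Delta(x^+(z))=x^+(z)\otimes1+\psi^-(\gamma_{(1)}^{1/2}z)\otimes x^+(\gamma_{(1)}z)$, $\Delta(x^-(z))=x^-(\gamma_{(2)}z)\otimes\psi^+(\gamma_{(2)}^{1/2}z)+1\otimes x^-(z)$, $\Delta(\psi^\pm(z))=\psi^\pm(\gamma_{(2)}^{\pm1/2}z)\otimes\psi^\pm(\gamma_{(1)}^{\mp1/2}z)$, where $\gamma^{1/2}_{(1)}=\gamma^{1/2}\otimes1$, $\gamma^{1/2}_{(2)}=1\otimes\gamma^{1/2}$. Let $\mathcal F$ be the space of symmetric functions (polynomials in the power sums $p_n$),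 with the Macdonald scalar product $\langle p_\lambda,p_\mu\rangle_{q,t}=\delta_{\lambda\mu}z_\lambda\prod_i\frac{1-q^{\lambda_i}}{1-t^{\lambda_i}}$, the Macdonald functions $P_\lambda$, and the operators $a_{-n}=p_n$, $a_n=n\frac{1-q^n}{1-t^n}\frac{\partial}{\partial p_n}$ ($n>0$). The module $\mathcal F_u^{(1,N)}$ ($N\in\mathbb Z$) is $\mathcal F$ with $\gamma^{1/2}=(t/q)^{1/4}$, $x^+(z)=uz^{-N}q^{-N/2}t^{N/2}\eta(z)$, $x^-(z)=u^{-1}z^{N}q^{N/2}t^{-N/2}\xi(z)$, $\psi^\pm(z)=q^{\pm N/2}t^{\mp N/2}\varphi^\pm(z)$, where $$\eta(z)=e^{\sum_{n\ge1}\frac{1-t^{-n}}{n}a_{-n}z^n}e^{-\sum_{n\ge1}\frac{1-t^n}{n}a_nz^{-n}},\quad \xi(z)=e^{-\sum_{n\ge1}\frac{1-t^{-n}}{n}q^{-n/2}t^{n/2}a_{-n}z^n}e^{\sum_{n\ge1}\frac{1-t^n}{n}q^{-n/2}t^{n/2}a_nz^{-n}},$$ $$\varphi^+(z)=e^{-\sum_{n\ge1}\frac{1-t^n}{n}(1-t^nq^{-n})q^{n/4}t^{-n/4}a_nz^{-n}},\quad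 \varphi^-(z)=e^{\sum_{n\ge1}\frac{1-t^{-n}}{n}(1-t^nq^{-n})q^{n/4}t^{-n/4}a_{-n}z^{n}}.$$ The module $\mathcal F_u^{(0,1)}$ is $\mathcal F$ with $\gamma^{1/2}=1$ and, with $\delta(z)=\sum_{n\in\mathbb Z}z^n$, $x^+(z)P_\lambda=\sum_{i=1}^{\ell(\lambda)+1}A^+_{\lambda,i}\,\delta(q^{\lambda_i}t^{-i+1}u/z)P_{\lambda+\mathbf 1_i}$, $x^-(z)P_\lambda=q^{1/2}t^{-1/2}\sum_{i=1}^{\ell(\lambda)}A^-_{\lambda,i}\,\delta(q^{\lambda_i-1}t^{-i+1}u/z)P_{\lambda-\mathbf 1_i}$, $\psi^+(z)P_\lambda=q^{1/2}t^{-1/2}B^+_\lambda(u/z)P_\lambda$, $\psi^-(z)P_\lambda=q^{-1/2}t^{1/2}B^-_\lambda(z/u)P_\lambda$, where $$A^+_{\lambda,i}=(1-t)\prod_{j=1}^{i-1}\frac{(1-q^{\lambda_i-\lambda_j}t^{-i+j+1})(1-q^{\lambda_i-\lambda_j+1}t^{-i+j-1})}{(1-q^{\lambda_i-\lambda_j}t^{-i+j})(1-q^{\lambda_i-\lambda_j+1}t^{-i+j})},$$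 $$A^-_{\lambda,i}=(1-t^{-1})\frac{1-q^{\lambda_{i+1}-\lambda_i}}{1-q^{\lambda_{i+1}-\lambda_i+1}t^{-1}}\prod_{j\ge i+1}\frac{(1-q^{\lambda_j-\lambda_i+1}t^{-j+i-1})(1-q^{\lambda_{j+1}-\lambda_i}t^{-j+i})}{(1-q^{\lambda_{j+1}-\lambda_i+1}t^{-j+i-1})(1-q^{\lambda_j-\lambda_i}t^{-j+i})},$$ $$B^+_\lambda(z)=\frac{1-q^{\lambda_1-1}tz}{1-q^{\lambda_1}z}\prod_{i\ge1}\frac{(1-q^{\lambda_i}t^{-i}z)(1-q^{\lambda_{i+1}-1}t^{-i+1}z)}{(1-q^{\lambda_{i+1}}t^{-i}z)(1-q^{\lambda_i-1}t^{-i+1}z)},$$ and $B^-_\lambda(z)$ is obtained from $B^+_\lambda(z)$ by replacing $q,t$ with $q^{-1},t^{-1}$. Let $\Phi\left[{(1,N+1),w\atop(0,1),v;(1,N),u}\right]:\mathcal F^{(0,1)}_v\otimes\mathcal F^{(1,N)}_u\to\mathcal F^{(1,N+1)}_w$ and $\Phi^*\left[{(1,N),v;(0,1),u\atop(1,N+1),w}\right]:\mathcal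 F^{(1,N+1)}_w\to\mathcal F^{(1,N)}_v\otimes\mathcal F^{(0,1)}_u$ (with values in the completions) denote the trivalent intertwining operators, i.e. the linear maps with $a\Phi=\Phi\Delta(a)$, $\Delta(a)\Phi^*=\Phi^*a$ for all $a\in\mathcal U$, normalized so that the coefficient of $1$ in $\Phi(P_\emptyset\otimes1)$ and the coefficient of $1\otimes P_\emptyset$ in $\Phi^*(1)$ are $1$ (here $w=-vu$). Let $u,v,w_k,x_k,y_k$ ($1\le k\le N_c$) be indeterminates. All compositions below are expanded in the directions $v/u$, $w_k/x_k$, $w_k/y_k$, $x_k/w_{k+1}$, $y_k/w_{k+1}$: the exponents of the indeterminates lie in a linearly ordered abelian group in which these ratios have positive exponents, and all sums are formal sums in the field of Hahn series over $\mathbb F$ (sums of summable families). Put $$u_i=u\prod_{k=1}^{i-1}x_k/w_k,\qquad v_i=v\prod_{k=1}^{i-1}w_k/y_k\qquad(1\le i\le N_c+1).$$ For each $k$ let the six point operator $\mathcal F^{(0,1)}_{-x_k}\otimes\mathcal F^{(1,0)}_{u_k}\otimes\mathcal F^{(1,0)}_{v_k}\to\mathcal F^{(1,0)}_{u_{k+1}}\otimes\mathcal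 F^{(1,0)}_{v_{k+1}}\otimes\mathcal F^{(0,1)}_{-y_k}$ be the composition of $\mathrm{id}\otimes\Phi^*\otimes\mathrm{id}$, $\mathrm{id}\otimes\mathrm{id}\otimes\Phi$ and $\Phi\otimes\Phi^*$, $$\mathcal F^{(0,1)}_{-x_k}\otimes\mathcal F^{(1,0)}_{u_k}\otimes\mathcal F^{(1,0)}_{v_k}\to\mathcal F^{(0,1)}_{-x_k}\otimes\mathcal F^{(1,-1)}_{u_k/w_k}\otimes\mathcal F^{(0,1)}_{-w_k}\otimes\mathcal F^{(1,0)}_{v_k}\to\mathcal F^{(0,1)}_{-x_k}\otimes\mathcal F^{(1,-1)}_{u_k/w_k}\otimes\mathcal F^{(1,1)}_{v_kw_k}\to\mathcal F^{(1,0)}_{u_{k+1}}\otimes\mathcal F^{(1,0)}_{v_{k+1}}\otimes\mathcal F^{(0,1)}_{-y_k},$$ and let the four point operator $\mathcal T_k:\mathcal F^{(1,0)}_{u_k}\otimes\mathcal F^{(1,0)}_{v_k}\to\mathcal F^{(1,0)}_{u_{k+1}}\otimes\mathcal F^{(1,0)}_{v_{k+1}}$ be its restriction: insert $P_\emptyset$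 in the factor $\mathcal F^{(0,1)}_{-x_k}$ and apply $\langle P_\emptyset,\bullet\rangle_{q,t}$ to the factor $\mathcal F^{(0,1)}_{-y_k}$. **Proposition.** Set $\mathbf e_i=-w_i$, $\mathbf e'_i=-q^{1/2}t^{-1/2}y_i$, $\mathbf e''_i=-q^{-1/2}t^{1/2}x_i$, $\Lambda^{2N_c}=(q^{1/2}t^{-1/2})^{-N_c}\frac vu\prod_{i=1}^{N_c}\frac{w_i}{y_i}$, $$\mathcal G(z)=\exp\Big(-\sum_{n>0}\frac1n\frac{z^n}{(1-q^n)(1-t^{-n})}\Big),\qquad N_{\lambda,\mu}(z)=\prod_{(i,j)\in\lambda}(1-zq^{-\mu_i+j-1}t^{-\lambda'_j+i})\prod_{(k,l)\in\mu}(1-zq^{\lambda_k-l}t^{\mu'_l-k+1}).$$ Then the six point operators, the vacuum matrix element below and the sum on the right are well defined (all the sums over intermediate states and over partitions are formally summable), and $$\langle P_\emptyset\otimes P_\emptyset|\,\mathcal T_{N_c}\cdots\mathcal T_1\,|P_\emptyset\otimes P_\emptyset\rangle=\prod_{k=1}^{N_c}\frac1{\mathcal G(\mathbf e_k/\mathbf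 e''_k)\,\mathcal G(qt^{-1}\mathbf e_k/\mathbf e'_k)}\prod_{1\le i<j\le N_c}\frac{\mathcal G(\mathbf e_i/\mathbf e_j)\,\mathcal G(qt^{-1}\mathbf e_i/\mathbf e_j)\,\mathcal G(qt^{-1}\mathbf e''_i/\mathbf e''_j)\,\mathcal G(\mathbf e'_i/\mathbf e'_j)}{\mathcal G(\mathbf e_i/\mathbf e''_j)\,\mathcal G(qt^{-1}\mathbf e''_i/\mathbf e_j)\,\mathcal G(qt^{-1}\mathbf e_i/\mathbf e'_j)\,\mathcal G(\mathbf e'_i/\mathbf e_j)}$$ $$\times\sum_{\lambda^{(1)},\dots,\lambda^{(N_c)}}\ \prod_{k=1}^{N_c}\Lambda^{2N_c|\lambda^{(k)}|}\prod_{1\le i,j\le N_c}\frac{N_{\emptyset,\lambda^{(j)}}(\mathbf e'_i/\mathbf e_j)\,N_{\lambda^{(i)},\emptyset}(\mathbf e_i/\mathbf e''_j)}{N_{\lambda^{(i)},\lambda^{(j)}}(\mathbf e_i/\mathbf e_j)},$$ the sum being over all $N_c$-tuples of partitions. -/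

import Mathlib

noncomputable section

namespace TopVertex

/-! ## The base field and the parameters `q`, `t` -/

/-- The field `ℚ(q^{1/4}, t^{1/4})` of rational functions in two independent indeterminates. -/
abbrev BaseField : Type := FractionRing (MvPolynomial (Fin 2) ℚ)

/-- `q^{1/4}`, in any field extension of the base field. -/
def qRoot (L : Type*) [Field L] [Algebra BaseField L] : L :=
  algebraMap BaseField L (algebraMap (MvPolynomial (Fin 2) ℚ) BaseField (MvPolynomial.X 0))

/-- `t^{1/4}`, in any field extension of the base field. -/
def tRoot (L : Type*) [Field L] [Algebra BaseField L] : L :=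
  algebraMap BaseField L (algebraMap (MvPolynomial (Fin 2) ℚ) BaseField (MvPolynomial.X 1))

/-- The parameter `q`. -/
def qq (L : Type*) [Field L] [Algebra BaseField L] : L := qRoot L ^ 4

/-- The parameter `t`. -/
def tt (L : Type*) [Field L] [Algebra BaseField L] : L := tRoot L ^ 4

/-- `q^{1/4} t^{-1/4}`. -/
def qtQuarter (L : Type*) [Field L] [Algebra BaseField L] : L := qRoot L / tRoot L

/-- `q^{1/2} t^{-1/2}`. -/
def qtHalf (L : Type*) [Field L] [Algebra BaseField L] : L := qtQuarter L ^ 2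

/-! ## Modules of the quantum algebra, given by the matrices of the generating currents

A vector space with a distinguished basis indexed by `I` is described by its matrices:
for an operator `O`, the number `O i' i` is the coefficient of the basis vector `i'` in the image
of the basis vector `i`.  Arbitrary matrices `J → I → L` are the linear maps from the space spanned
by the basis `I` to the completion (the full product) of the space spanned by the basis `J`. -/

/-- The matrices of the generators `γ^{1/2}` (a scalar), `x⁺ₙ`, `x⁻ₙ` (`n ∈ ℤ`), `ψ⁺ₙ` and `ψ⁻₋ₙ`
(`n ∈ ℕ`), where `x^±(z) = ∑ x^±ₙ z^{-n}` and `ψ^±(z) = ∑_{n ≥ 0} ψ^±_{±n} z^{∓n}`. -/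
structure CurrentAction (L : Type*) (I : Type*) where
  /-- the scalar by which `γ^{1/2}` acts -/
  gam : L
  /-- `xp n` is the matrix of `x⁺ₙ` -/
  xp : ℤ → I → I → L
  /-- `xm n` is the matrix of `x⁻ₙ` -/
  xm : ℤ → I → I → L
  /-- `psip n` is the matrix of `ψ⁺ₙ` -/
  psip : ℕ → I → I → L
  /-- `psim n` is the matrix of `ψ⁻₋ₙ` -/
  psim : ℕ → I → I → L

/-- Entries of the identity matrix. -/
def kron (L : Type*) [Field L] {I : Type*} (i j : I) : L :=
  open Classical in if i = j then 1 else 0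

/-- Product of two matrices (used only where every entry is a finite sum). -/
def matMul {L : Type*} [Field L] {I J K : Type*} (A : I → J → L) (B : J → K → L) (i : I) (k : K) :
    L :=
  ∑ᶠ j, A i j * B j k

/-- The action on a tensor product through the coproduct
`Δ(γ^{1/2}) = γ^{1/2} ⊗ γ^{1/2}`,
`Δ(x⁺(z)) = x⁺(z) ⊗ 1 + ψ⁻(γ₁^{1/2} z) ⊗ x⁺(γ₁ z)`,
`Δ(x⁻(z)) = x⁻(γ₂ z) ⊗ ψ⁺(γ₂^{1/2} z) + 1 ⊗ x⁻(z)`,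
`Δ(ψ^±(z)) = ψ^±(γ₂^{±1/2} z) ⊗ ψ^±(γ₁^{∓1/2} z)`,
written on the modes, i.e. on the coefficients of the powers of `z`. -/
def tensor {L : Type*} [Field L] {I J : Type*} (A : CurrentAction L I) (B : CurrentAction L J) :
    CurrentAction L (I × J) where
  gam := A.gam * B.gam
  xp n o i := A.xp n o.1 i.1 * kron L o.2 i.2 +
    ∑ᶠ k : ℕ, A.gam ^ ((k : ℤ) - 2 * (n + k)) * A.psim k o.1 i.1 * B.xp (n + k) o.2 i.2
  xm n o i := (∑ᶠ k : ℕ, B.gam ^ (-2 * (n - k) - (k : ℤ)) * A.xm (n - k) o.1 i.1 *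
      B.psip k o.2 i.2) + kron L o.1 i.1 * B.xm n o.2 i.2
  psip n o i := ∑ k ∈ Finset.HasAntidiagonal.antidiagonal n, B.gam ^ (-(k.1 : ℤ)) * A.gam ^ (k.2 : ℤ) *
    A.psip k.1 o.1 i.1 * B.psip k.2 o.2 i.2
  psim n o i := ∑ k ∈ Finset.HasAntidiagonal.antidiagonal n, B.gam ^ (-(k.1 : ℤ)) * A.gam ^ (k.2 : ℤ) *
    A.psim k.1 o.1 i.1 * B.psim k.2 o.2 i.2

/-- `T` commutes with the action of all the generators, hence of the whole algebra. -/
def Intertwines {L : Type*} [Field L] {I J : Type*} (A : CurrentAction L I)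
    (B : CurrentAction L J) (T : J → I → L) : Prop :=
  (∀ j i, B.gam * T j i = T j i * A.gam) ∧
  (∀ n : ℤ, matMul (B.xp n) T = matMul T (A.xp n)) ∧
  (∀ n : ℤ, matMul (B.xm n) T = matMul T (A.xm n)) ∧
  (∀ n : ℕ, matMul (B.psip n) T = matMul T (A.psip n)) ∧
  (∀ n : ℕ, matMul (B.psim n) T = matMul T (A.psim n))

/-! ## The horizontal modules of level `(1, N)` -/

/-- Labels of the basis `p^m = ∏ₙ pₙ^{mₙ}` of the Fock space, i.e. of the symmetric functions,
which are the polynomials in the power sums `p₁, p₂, …`. The label `0` is the vacuum. -/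
abbrev FockIdx : Type := ℕ+ →₀ ℕ

/-- The Heisenberg generator `a₋ₙ`: multiplication by `pₙ`. -/
def aNeg (L : Type*) [Field L] (n : ℕ+) : Module.End L (MvPolynomial ℕ+ L) :=
  LinearMap.mulLeft L (MvPolynomial.X n)

/-- The Heisenberg generator `aₙ = n (1 - qⁿ)/(1 - tⁿ) ∂/∂pₙ`. -/
def aPos (L : Type*) [Field L] [Algebra BaseField L] (n : ℕ+) :
    Module.End L (MvPolynomial ℕ+ L) :=
  (((n : ℕ) : L) * ((1 - qq L ^ (n : ℕ)) / (1 - tt L ^ (n : ℕ)))) •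
    (MvPolynomial.pderiv n).toLinearMap

/-- The power series `∑_{n ≥ 1} bₙ zⁿ`. -/
def currentSeries {A : Type*} [Ring A] (b : ℕ+ → A) : PowerSeries A :=
  PowerSeries.mk fun n => if h : 0 < n then b ⟨n, h⟩ else 0

/-- The coefficient of `z^k` in `exp(∑_{n ≥ 1} bₙ zⁿ)`; the powers `j > k` of the series in the
exponent do not contribute to it. -/
def expCoeff (L : Type*) [Field L] {A : Type*} [Ring A] [Algebra L A] (b : ℕ+ → A) (k : ℕ) : A :=
  ∑ j ∈ Finset.range (k + 1), ((j.factorial : L)⁻¹) • PowerSeries.coeff k (currentSeries b ^ j)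

/-- The matrix of the coefficient of `z^{-n}` in
`exp(∑_{j ≥ 1} bⱼ a₋ⱼ z^j) exp(∑_{j ≥ 1} cⱼ aⱼ z^{-j})`. -/
def vertexMode {L : Type*} [Field L] [Algebra BaseField L] (b c : ℕ+ → L) (n : ℤ)
    (o i : FockIdx) : L :=
  ∑ᶠ k : ℕ × ℕ, if (k.2 : ℤ) - (k.1 : ℤ) = n then
    MvPolynomial.coeff o
      (expCoeff L (fun j => b j • aNeg L j) k.1
        (expCoeff L (fun j => c j • aPos L j) k.2 (MvPolynomial.monomial i 1)))
  else 0

/-- The modes of `η(z)`. -/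
def etaMode {L : Type*} [Field L] [Algebra BaseField L] : ℤ → FockIdx → FockIdx → L :=
  vertexMode
    (fun n => (1 - (tt L)⁻¹ ^ (n : ℕ)) / ((n : ℕ) : L))
    (fun n => -((1 - tt L ^ (n : ℕ)) / ((n : ℕ) : L)))

/-- The modes of `ξ(z)`. -/
def xiMode {L : Type*} [Field L] [Algebra BaseField L] : ℤ → FockIdx → FockIdx → L :=
  vertexMode
    (fun n => -((1 - (tt L)⁻¹ ^ (n : ℕ)) / ((n : ℕ) : L) * (qtHalf L)⁻¹ ^ (n : ℕ)))
    (fun n => (1 - tt L ^ (n : ℕ)) / ((n : ℕ) : L) * (qtHalf L)⁻¹ ^ (n : ℕ))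

/-- The modes of `φ⁺(z)`. -/
def phiPlusMode {L : Type*} [Field L] [Algebra BaseField L] : ℤ → FockIdx → FockIdx → L :=
  vertexMode
    (fun _ => 0)
    (fun n => -((1 - tt L ^ (n : ℕ)) / ((n : ℕ) : L) * (1 - (tt L / qq L) ^ (n : ℕ)) *
      qtQuarter L ^ (n : ℕ)))

/-- The modes of `φ⁻(z)`. -/
def phiMinusMode {L : Type*} [Field L] [Algebra BaseField L] : ℤ → FockIdx → FockIdx → L :=
  vertexMode
    (fun n => (1 - (tt L)⁻¹ ^ (n : ℕ)) / ((n : ℕ) : L) * (1 - (tt L / qq L) ^ (n : ℕ)) *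
      qtQuarter L ^ (n : ℕ))
    (fun _ => 0)

/-- The Fock module of level `(1, N)` with spectral parameter `u`:
`γ^{1/2} = (t/q)^{1/4}`, `x⁺(z) = u z^{-N} q^{-N/2} t^{N/2} η(z)`,
`x⁻(z) = u⁻¹ z^N q^{N/2} t^{-N/2} ξ(z)`, `ψ⁺(z) = q^{N/2} t^{-N/2} φ⁺(z)`,
`ψ⁻(z) = q^{-N/2} t^{N/2} φ⁻(z)`. -/
def horizontal {L : Type*} [Field L] [Algebra BaseField L] (N : ℤ) (u : L) :
    CurrentAction L FockIdx where
  gam := (qtQuarter L)⁻¹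
  xp n o i := u * qtHalf L ^ (-N) * etaMode (n - N) o i
  xm n o i := u⁻¹ * qtHalf L ^ N * xiMode (n + N) o i
  psip n o i := qtHalf L ^ N * phiPlusMode (n : ℤ) o i
  psim n o i := qtHalf L ^ (-N) * phiMinusMode (-(n : ℤ)) o i

/-! ## The vertical module of level `(0, 1)`

Partitions are Young diagrams; rows and columns are numbered from `0`, so that
`la.rowLen i` is `λ_{i+1}`, `la.colLen j` is `λ'_{j+1}`, and `la.colLen 0` is the length `ℓ(λ)`. -/

/-- `mu = la + 1ᵢ`: the partition `mu` arises from `la` by adding one box to the row `i`. -/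
def IsAddBox (la : YoungDiagram) (i : ℕ) (mu : YoungDiagram) : Prop :=
  ∀ k, mu.rowLen k = la.rowLen k + if k = i then 1 else 0

/-- `A⁺_{λ,i+1}`. -/
def Aplus {L : Type*} [Field L] [Algebra BaseField L] (la : YoungDiagram) (i : ℕ) : L :=
  (1 - tt L) * ∏ j ∈ Finset.range i,
    ((1 - qq L ^ ((la.rowLen i : ℤ) - la.rowLen j) * tt L ^ ((j : ℤ) - i + 1)) *
      (1 - qq L ^ ((la.rowLen i : ℤ) - la.rowLen j + 1) * tt L ^ ((j : ℤ) - i - 1))) /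
    ((1 - qq L ^ ((la.rowLen i : ℤ) - la.rowLen j) * tt L ^ ((j : ℤ) - i)) *
      (1 - qq L ^ ((la.rowLen i : ℤ) - la.rowLen j + 1) * tt L ^ ((j : ℤ) - i)))

/-- `A⁻_{λ,i+1}`. The factors of the infinite product beyond the length of `λ` are equal to `1`. -/
def Aminus {L : Type*} [Field L] [Algebra BaseField L] (la : YoungDiagram) (i : ℕ) : L :=
  (1 - (tt L)⁻¹) *
    ((1 - qq L ^ ((la.rowLen (i + 1) : ℤ) - la.rowLen i)) /
      (1 - qq L ^ ((la.rowLen (i + 1) : ℤ) - la.rowLen i + 1) * (tt L)⁻¹)) *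
    ∏ j ∈ Finset.Ico (i + 1) (la.colLen 0),
      ((1 - qq L ^ ((la.rowLen j : ℤ) - la.rowLen i + 1) * tt L ^ ((i : ℤ) - j - 1)) *
        (1 - qq L ^ ((la.rowLen (j + 1) : ℤ) - la.rowLen i) * tt L ^ ((i : ℤ) - j))) /
      ((1 - qq L ^ ((la.rowLen (j + 1) : ℤ) - la.rowLen i + 1) * tt L ^ ((i : ℤ) - j - 1)) *
        (1 - qq L ^ ((la.rowLen j : ℤ) - la.rowLen i) * tt L ^ ((i : ℤ) - j)))

/-- The power series `1 - c z`. -/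
def oneSub {L : Type*} [Field L] (c : L) : PowerSeries L :=
  1 - PowerSeries.C c * PowerSeries.X

/-- `B⁺_λ(z)`. The factors of the infinite product beyond the length of `λ` are equal to `1`. -/
def Bplus {L : Type*} [Field L] [Algebra BaseField L] (la : YoungDiagram) : PowerSeries L :=
  oneSub (qq L ^ ((la.rowLen 0 : ℤ) - 1) * tt L) * (oneSub (qq L ^ (la.rowLen 0 : ℤ)))⁻¹ *
    ∏ i ∈ Finset.range (la.colLen 0),
      (oneSub (qq L ^ (la.rowLen i : ℤ) * tt L ^ (-(i : ℤ) - 1)) *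
        oneSub (qq L ^ ((la.rowLen (i + 1) : ℤ) - 1) * tt L ^ (-(i : ℤ)))) *
      (oneSub (qq L ^ (la.rowLen (i + 1) : ℤ) * tt L ^ (-(i : ℤ) - 1)) *
        oneSub (qq L ^ ((la.rowLen i : ℤ) - 1) * tt L ^ (-(i : ℤ))))⁻¹

/-- `B⁻_λ(z)`. The factors of the infinite product beyond the length of `λ` are equal to `1`. -/
def Bminus {L : Type*} [Field L] [Algebra BaseField L] (la : YoungDiagram) : PowerSeries L :=
  oneSub (qq L ^ (-(la.rowLen 0 : ℤ) + 1) * (tt L)⁻¹) * (oneSub (qq L ^ (-(la.rowLen 0 : ℤ))))⁻¹ *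
    ∏ i ∈ Finset.range (la.colLen 0),
      (oneSub (qq L ^ (-(la.rowLen i : ℤ)) * tt L ^ ((i : ℤ) + 1)) *
        oneSub (qq L ^ (-(la.rowLen (i + 1) : ℤ) + 1) * tt L ^ (i : ℤ))) *
      (oneSub (qq L ^ (-(la.rowLen (i + 1) : ℤ)) * tt L ^ ((i : ℤ) + 1)) *
        oneSub (qq L ^ (-(la.rowLen i : ℤ) + 1) * tt L ^ (i : ℤ)))⁻¹

/-- The Fock module of level `(0, 1)` with spectral parameter `u`, in the basis of the Macdonald
functions `P_λ`, on which it is defined: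
`γ^{1/2} P_λ = P_λ`,
`x⁺(z) P_λ = ∑ᵢ A⁺_{λ,i} δ(q^{λᵢ} t^{-i+1} u/z) P_{λ+1ᵢ}`,
`x⁻(z) P_λ = q^{1/2} t^{-1/2} ∑ᵢ A⁻_{λ,i} δ(q^{λᵢ-1} t^{-i+1} u/z) P_{λ-1ᵢ}`,
`ψ⁺(z) P_λ = q^{1/2} t^{-1/2} B⁺_λ(u/z) P_λ`, `ψ⁻(z) P_λ = q^{-1/2} t^{1/2} B⁻_λ(z/u) P_λ`,
where `δ(z) = ∑_{n ∈ ℤ} zⁿ`. -/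
def vertical {L : Type*} [Field L] [Algebra BaseField L] (u : L) :
    CurrentAction L YoungDiagram where
  gam := 1
  xp n o la := ∑ i ∈ Finset.range (la.colLen 0 + 1), open Classical in
    if IsAddBox la i o then
      Aplus la i * (qq L ^ (la.rowLen i : ℤ) * tt L ^ (-(i : ℤ)) * u) ^ n else 0
  xm n o la := qtHalf L * ∑ i ∈ Finset.range (la.colLen 0), open Classical in
    if IsAddBox o i la then
      Aminus la i * (qq L ^ ((la.rowLen i : ℤ) - 1) * tt L ^ (-(i : ℤ)) * u) ^ n else 0
  psip n o la := kron L o la * (qtHalf L * PowerSeries.coeff n (Bplus la : PowerSeries L) * u ^ n)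
  psim n o la := kron L o la *
    ((qtHalf L)⁻¹ * PowerSeries.coeff n (Bminus la : PowerSeries L) * u⁻¹ ^ n)

/-! ## The trivalent intertwining operators -/

/-- `T` is the normalized intertwining operator
`Φ : F^{(0,1)}_v ⊗ F^{(1,N)}_u → F^{(1,N+1)}_w`, `a Φ = Φ Δ(a)`, `Φ_∅(1) = 1 + ⋯`;
`T m (λ, n)` is the coefficient of `p^m` in `Φ_λ(p^n) = Φ(P_λ ⊗ p^n)`. -/
def IsPhi {L : Type*} [Field L] [Algebra BaseField L] (N : ℤ) (v u w : L)
    (T : FockIdx → YoungDiagram × FockIdx → L) : Prop :=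
  Intertwines (tensor (vertical v) (horizontal N u)) (horizontal (N + 1) w) T ∧ T 0 (⊥, 0) = 1

/-- `T` is the normalized intertwining operator
`Φ* : F^{(1,N+1)}_w → F^{(1,N)}_v ⊗ F^{(0,1)}_u`, `Δ(a) Φ* = Φ* a`, `Φ*_∅(1) = 1 + ⋯`;
`T (m, λ) n` is the coefficient of `p^m ⊗ P_λ` in `Φ*(p^n)`, that is, `⟨P_λ, P_λ⟩⁻¹` times the
coefficient of `p^m` in `Φ*_λ(p^n)`, the components `Φ*_λ` being taken along
`Q_λ = P_λ / ⟨P_λ, P_λ⟩`. For `λ = ∅` there is no difference, as `P_∅ = Q_∅ = 1`. -/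
def IsPhiStar {L : Type*} [Field L] [Algebra BaseField L] (N : ℤ) (v u w : L)
    (T : FockIdx × YoungDiagram → FockIdx → L) : Prop :=
  Intertwines (horizontal (N + 1) w) (tensor (horizontal N v) (vertical u)) T ∧ T (0, ⊥) 0 = 1

/-! ## Compositions

The matrix elements of a composition are infinite sums over the states on the internal edges.
They are summed in a field of Hahn series, i.e. of formal series in the spectral parameters. -/

/-- The family `f` of Hahn series is (formally) summable, and its sum is `s`. -/
def HasHahnSum {Γ : Type*} [PartialOrder Γ] {K : Type*} [AddCommMonoid K] {ι : Type*}
    (f : ι → HahnSeries Γ K) (s : HahnSeries Γ K) : Prop :=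
  ∃ F : HahnSeries.SummableFamily Γ K ι, ⇑F = f ∧ F.hsum = s

/-- The summands of the matrix element of the six point operator
`F^{(0,1)} ⊗ F^{(1,0)} ⊗ F^{(1,0)} → F^{(1,0)} ⊗ F^{(1,0)} ⊗ F^{(0,1)}`, which is the composition
`(Φ₂ ⊗ Φ₂*) ∘ (id ⊗ id ⊗ Φ₁) ∘ (id ⊗ Φ₁* ⊗ id)`, from `P_λ ⊗ p^a ⊗ p^b` to `p^{a'} ⊗ p^{b'} ⊗ P_ν`.
The summation is over the states `(c, μ, d)` on the three internal edges:
`λ, a, b ↦ λ, c, μ, b ↦ λ, c, d ↦ a', b', ν`. -/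
def sixPointTerm {L : Type*} [Field L]
    (S₁ : FockIdx × YoungDiagram → FockIdx → L) (P₁ : FockIdx → YoungDiagram × FockIdx → L)
    (P₂ : FockIdx → YoungDiagram × FockIdx → L) (S₂ : FockIdx × YoungDiagram → FockIdx → L)
    (o : FockIdx × FockIdx × YoungDiagram) (i : YoungDiagram × FockIdx × FockIdx)
    (s : FockIdx × YoungDiagram × FockIdx) : L :=
  (P₂ o.1 (i.1, s.1) * S₂ (o.2.1, o.2.2) s.2.2) * P₁ s.2.2 (s.2.1, i.2.2) *
    S₁ (s.1, s.2.1) i.2.1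

/-- The restriction of a six point operator to a four point operator
`F^{(1,0)} ⊗ F^{(1,0)} → F^{(1,0)} ⊗ F^{(1,0)}`: the first argument is `P_∅`, and
`⟨P_∅, •⟩` is applied to the last factor of the value. As the `P_λ` are orthogonal and
`⟨P_∅, P_∅⟩ = 1`, the latter takes the coefficient of `P_∅`. -/
def fourPoint {L : Type*}
    (S : FockIdx × FockIdx × YoungDiagram → YoungDiagram × FockIdx × FockIdx → L)
    (o i : FockIdx × FockIdx) : L :=
  S (o.1, o.2, ⊥) (⊥, i.1, i.2)

/-- The sequences of intermediate states of a chain of `N` operators on the tensor product of two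
Fock spaces, which start and end at the vacuum. -/
abbrev VacuumPath (N : ℕ) : Type :=
  {p : Fin (N + 1) → FockIdx × FockIdx // p 0 = (0, 0) ∧ p (Fin.last N) = (0, 0)}

/-- The summands of the vacuum matrix element of the composition `T_{N-1} ∘ ⋯ ∘ T_0`. -/
def chainTerm {L : Type*} [Field L] {N : ℕ}
    (T : Fin N → FockIdx × FockIdx → FockIdx × FockIdx → L) (p : VacuumPath N) : L :=
  ∏ k : Fin N, T k (p.1 k.succ) (p.1 k.castSucc)

/-- `a ∏_{i < k} bᵢ/cᵢ`, for the sequences of spectral parameters `u_k` and `v_k`. -/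
def paramSeq {L : Type*} [Field L] {N : ℕ} (a : L) (b c : Fin N → L) (k : Fin N) : L :=
  a * ∏ i ∈ Finset.Iio k, b i / c i

/-! ## The Nekrasov partition function -/

/-- `N_{λ,μ}(u) = ∏_{(i,j) ∈ λ} (1 - u q^{-μᵢ+j-1} t^{-λ'ⱼ+i})
∏_{(k,l) ∈ μ} (1 - u q^{λ_k-l} t^{μ'_l-k+1})` (the cells of Young diagrams are numbered from
`(0, 0)` here). -/
def nekN {L : Type*} [Field L] [Algebra BaseField L] (la mu : YoungDiagram) (u : L) : L :=
  (∏ s ∈ la.cells,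
    (1 - u * qq L ^ (-(mu.rowLen s.1 : ℤ) + s.2) * tt L ^ (-(la.colLen s.2 : ℤ) + s.1 + 1))) *
  ∏ s ∈ mu.cells,
    (1 - u * qq L ^ ((la.rowLen s.1 : ℤ) - s.2 - 1) * tt L ^ ((mu.colLen s.2 : ℤ) - s.1))

/-- `𝒢(z) = exp(-∑_{n > 0} (1/n) zⁿ / ((1 - qⁿ)(1 - t^{-n})))` as a formal power series. -/
def calG : PowerSeries BaseField :=
  PowerSeries.mk (expCoeff BaseField fun n : ℕ+ =>
    -(1 / (((n : ℕ) : BaseField) *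
      ((1 - qq BaseField ^ (n : ℕ)) * (1 - (tt BaseField)⁻¹ ^ (n : ℕ))))))

/-- `𝒢(z)` for a Hahn series `z` of positive order. -/
def evalG {Γ : Type*} [AddCommGroup Γ] [LinearOrder Γ] [IsOrderedAddMonoid Γ]
    (z : HahnSeries Γ BaseField) : HahnSeries Γ BaseField :=
  PowerSeries.heval z calG

/-- The perturbative factor. -/
def perturbativeFactor {Γ : Type*} [AddCommGroup Γ] [LinearOrder Γ] [IsOrderedAddMonoid Γ] {N : ℕ}
    (e e' e'' : Fin N → HahnSeries Γ BaseField) : HahnSeries Γ BaseField :=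
  let κ : HahnSeries Γ BaseField :=
    qq (HahnSeries Γ BaseField) * (tt (HahnSeries Γ BaseField))⁻¹
  (∏ k, 1 / (evalG (e k / e'' k) * evalG (κ * (e k / e' k)))) *
  ∏ i, ∏ j ∈ Finset.Ioi i,
    (evalG (e i / e j) * evalG (κ * (e i / e j)) *
      evalG (κ * (e'' i / e'' j)) * evalG (e' i / e' j)) /
    (evalG (e i / e'' j) * evalG (κ * (e'' i / e j)) *
      evalG (κ * (e i / e' j)) * evalG (e' i / e j))

/-- The summands of the instanton part of the partition function with `2N` fundamental matters;
`Lam2N` stands for `Λ^{2N}`. -/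
def nekrasovTerm {L : Type*} [Field L] [Algebra BaseField L] {N : ℕ}
    (e e' e'' : Fin N → L) (Lam2N : L) (la : Fin N → YoungDiagram) : L :=
  (∏ k, Lam2N ^ (la k).card) *
  ∏ i, ∏ j, (nekN ⊥ (la j) (e' i / e j) * nekN (la i) ⊥ (e i / e'' j)) /
    nekN (la i) (la j) (e i / e j)

end TopVertex

end

/-!
The relations between a trivalent intertwining operator and `ψ^±(z)` say that the modes of the
Heisenberg algebra commute with the components `Φ_λ` and `Φ*_λ` up to constants, because `P_λ` is a
joint eigenvector. Hence each component is a vertex operator, an exponential of creators times an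
exponential of annihilators times its vacuum entry (`IsPhi.isVertexOp`, `IsPhiStar.isVertexOp`). Its
coefficients are power sums of `Y_λ = 1 - (1 - q) (1 - t⁻¹) ∑ q^j t^{-i}`, the sum being over the
cells of `λ`.

The relations with `x^±(z)`, taken between the vacua, compare a sum of `δ`-functions at the boxes
that may be added to `λ` with the coefficients of a rational function with simple poles there. The
residues give recursions for the vacuum entries (`IsPhi.vacuum_recursion`,
`IsPhiStar.vacuum_recursion`). Adding boxes to the last row only, one finds that the product of the
vacuum entries of `Φ_λ` and `Φ*_λ` is a monomial divided by `N_{λλ}(1)` (`vacuum_mul_vacuum`).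

A vertex operator maps a coherent state to a multiple of a coherent state, where the multiple is the
exponential of a contraction. The contractions of the components are `± (1/n) zⁿ Y_λ Y_μ^* /
((1 - qⁿ) (1 - t⁻ⁿ))`, and the combinatorial identity `sum_nek_weights` for the arm and leg
lengths shows that their exponentials are `𝒢(z) / N_{λμ}(z)` or the inverse.

All matrix entries are monomials in the indeterminates, with exponents that are differences of
potentials of the intermediate states plus positive multiples of the positive exponents of the
expansion ratios (`IsGradedChain`). Only finitely many intermediate states share the same multiples,
so the sum over all the intermediate states is summable, and it may be grouped in two ways: the sum
over the states inside each six point operator first gives the matrix element of `𝒯_{N_c} ⋯ 𝒯_1`,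
and the sum with the partitions fixed is evaluated through coherent states.

This leaves a sum over partitions of products of vacuum entries and contractions. The reflection
`N_{λμ}(z) ↔ N_{μλ}(q t⁻¹ z⁻¹)` (`nekN_flip`) turns each summand into the perturbative factor times
the summand of the instanton partition function. The monomials from the reflections and from the
vacuum entries combine to the powers of `Λ^{2N_c}` (`prod_contractions_eq`,
`instantonParameter_eq`).
-/

noncomputable section

namespace TopVertex

/-! ### Exponentials of currents -/

section ExpCoeff

open Finset PowerSeries

lemma coeff_currentSeries_zero {A : Type*} [Ring A] (b : ℕ+ → A) :
    coeff 0 (currentSeries b) = 0 := by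
  simp [currentSeries]

lemma coeff_currentSeries_pnat {A : Type*} [Ring A] (b : ℕ+ → A) (n : ℕ+) :
    coeff (n : ℕ) (currentSeries b) = b n := by
  rw [currentSeries, coeff_mk, dif_pos n.pos]
  rfl

lemma commute_coeff_currentSeries {A : Type*} [Ring A] {b : ℕ+ → A}
    (hb : ∀ m n, Commute (b m) (b n)) (k l : ℕ) :
    Commute (coeff k (currentSeries b)) (coeff l (currentSeries b)) := by
  simp only [currentSeries, coeff_mk]
  split_ifs
  exacts [hb _ _, Commute.zero_right _, Commute.zero_left _, Commute.zero_left _]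

/-- The derivative of a power: `θ Sʲ⁺¹ = (j + 1) θ(S) Sʲ` with `θ = X d/dX`, for a series `S` whose
coefficients commute. -/
lemma coeff_pow_succ_mul {A : Type*} [Ring A] {S : PowerSeries A}
    (hS : ∀ k l, Commute (coeff k S) (coeff l S)) (j n : ℕ) :
    (n : A) * coeff n (S ^ (j + 1)) =
      (j + 1 : A) * ∑ x ∈ antidiagonal n, (x.1 : A) * (coeff x.1 S * coeff x.2 (S ^ j)) := by
  induction j generalizing n with
  | zero =>
    simp only [zero_add, pow_one, pow_zero, Nat.cast_zero, one_mul]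
    rw [Finset.sum_eq_single (n, 0)]
    · simp
    · rintro ⟨a, c⟩ h hne
      have hc : c ≠ 0 := by
        rintro rfl
        simp at h
        exact hne (by simp [h])
      simp [coeff_one, hc]
    · simp
  | succ j ih =>
    have hsum : coeff n (S ^ (j + 1 + 1)) =
        ∑ x ∈ antidiagonal n, coeff x.1 S * coeff x.2 (S ^ (j + 1)) := by
      rw [pow_succ' S (j + 1), coeff_mul]
    have key : ∑ x ∈ antidiagonal n, (x.2 : A) * (coeff x.1 S * coeff x.2 (S ^ (j + 1))) =
        (j + 1 : A) * ∑ x ∈ antidiagonal n, (x.1 : A) * (coeff x.1 S * coeff x.2 (S ^ (j + 1))) := by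
      have h1 : ∀ x ∈ antidiagonal n, (x.2 : A) * (coeff x.1 S * coeff x.2 (S ^ (j + 1))) =
          ∑ y ∈ antidiagonal x.2, (j + 1 : A) *
            ((y.1 : A) * (coeff x.1 S * (coeff y.1 S * coeff y.2 (S ^ j)))) := by
        intro x _
        rw [← mul_assoc, (Nat.cast_commute x.2 _).eq, mul_assoc, ih, mul_sum, mul_sum]
        refine sum_congr rfl fun y _ => ?_
        have c1 : Commute (coeff x.1 S) ((j : A) + 1) := by
          exact_mod_cast (Nat.commute_cast (coeff x.1 S) (j + 1))
        rw [← mul_assoc, c1.eq, mul_assoc, ← mul_assoc (coeff x.1 S),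
          ((Nat.commute_cast (coeff x.1 S) y.1)).eq, mul_assoc]
      have h2 : ∀ x ∈ antidiagonal n,
          (x.1 : A) * (coeff x.1 S * coeff x.2 (S ^ (j + 1))) =
          ∑ y ∈ antidiagonal x.2,
            (x.1 : A) * (coeff x.1 S * (coeff y.1 S * coeff y.2 (S ^ j))) := by
        intro x _
        rw [pow_succ' S j, coeff_mul, mul_sum, mul_sum]
      rw [sum_congr rfl h1, sum_congr rfl h2, mul_sum]
      simp_rw [mul_sum]
      rw [sum_sigma', sum_sigma']
      refine sum_nbij' (fun z => ⟨(z.2.1, z.1.1 + z.2.2), (z.1.1, z.2.2)⟩)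
        (fun z => ⟨(z.2.1, z.1.1 + z.2.2), (z.1.1, z.2.2)⟩) ?_ ?_ ?_ ?_ ?_
      · rintro ⟨⟨a, c⟩, ⟨d, e⟩⟩ h
        simp at h ⊢
        omega
      · rintro ⟨⟨a, c⟩, ⟨d, e⟩⟩ h
        simp at h ⊢
        omega
      · rintro ⟨⟨a, c⟩, ⟨d, e⟩⟩ h
        simp at h ⊢
        omega
      · rintro ⟨⟨a, c⟩, ⟨d, e⟩⟩ h
        simp at h ⊢
        omega
      · rintro ⟨⟨a, c⟩, ⟨d, e⟩⟩ h
        simp only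
        rw [← mul_assoc (coeff a S), (hS a d).eq, mul_assoc]
    have hsplit : (n : A) * coeff n (S ^ (j + 1 + 1)) =
        ∑ x ∈ antidiagonal n, (x.1 : A) * (coeff x.1 S * coeff x.2 (S ^ (j + 1))) +
        ∑ x ∈ antidiagonal n, (x.2 : A) * (coeff x.1 S * coeff x.2 (S ^ (j + 1))) := by
      rw [hsum, mul_sum, ← sum_add_distrib]
      refine sum_congr rfl fun x hx => ?_
      rw [← add_mul, ← Nat.cast_add, mem_antidiagonal.mp hx]
    rw [hsplit, key, Nat.cast_succ, add_mul ((j : A) + 1) 1, one_mul, add_comm]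

lemma coeff_pow_eq_zero {A : Type*} [Ring A] {S : PowerSeries A} (hS : coeff 0 S = 0)
    {j m : ℕ} (h : m < j) : coeff m (S ^ j) = 0 := by
  induction j generalizing m with
  | zero => omega
  | succ j ih =>
    rw [pow_succ', coeff_mul]
    refine sum_eq_zero fun x hx => ?_
    rcases Nat.eq_zero_or_pos x.1 with h0 | h0
    · rw [h0, hS, zero_mul]
    · have := mem_antidiagonal.mp hx
      rw [ih (by omega), mul_zero]

variable {L : Type*} [Field L] {A : Type*} [Ring A] [Algebra L A]

lemma expCoeff_zero (b : ℕ+ → A) : expCoeff L b 0 = 1 := by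
  simp [expCoeff]

/-- `θ exp(S) = θ(S) exp(S)` on coefficients, where `θ = X d/dX`. -/
lemma expCoeff_recursion [CharZero L] {b : ℕ+ → A} (hb : ∀ m n, Commute (b m) (b n)) (n : ℕ) :
    (n : L) • expCoeff L b n = ∑ x ∈ antidiagonal n,
      (x.1 : L) • (coeff x.1 (currentSeries b) * expCoeff L b x.2) := by
  have h0 := coeff_currentSeries_zero b
  have hS := commute_coeff_currentSeries hb
  set S := currentSeries b
  -- the sum over the powers may be extended
  have ext : ∀ m, m ≤ n → expCoeff L b m =
      ∑ j ∈ range (n + 1), ((j.factorial : L)⁻¹) • coeff m (S ^ j) := by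
    intro m hm
    rw [expCoeff]
    refine sum_subset (range_subset_range.mpr (by omega)) fun j _ hj => ?_
    rw [mem_range, not_lt] at hj
    rw [coeff_pow_eq_zero h0 (by omega), smul_zero]
  have castmul : ∀ (k : ℕ) (a : A), (k : A) * a = (k : L) • a := by
    intro k a
    rw [Algebra.smul_def, map_natCast]
  calc (n : L) • expCoeff L b n
      = ∑ j ∈ range (n + 2), ((j.factorial : L)⁻¹) • ((n : L) • coeff n (S ^ j)) := by
        rw [expCoeff, sum_range_succ _ (n + 1), coeff_pow_eq_zero h0 (Nat.lt_succ_self n), smul_zero,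
          smul_zero, add_zero, smul_sum]
        exact sum_congr rfl fun j _ => smul_comm _ _ _
    _ = ∑ j ∈ range (n + 1), ((j.factorial : L)⁻¹) •
          ∑ x ∈ antidiagonal n, (x.1 : L) • (coeff x.1 S * coeff x.2 (S ^ j)) := by
        rw [sum_range_succ']
        have : (n : L) • coeff n (S ^ 0) = 0 := by
          rcases Nat.eq_zero_or_pos n with rfl | hn
          · simp
          · simp [coeff_one, hn.ne']
        rw [this, smul_zero, add_zero]
        refine sum_congr rfl fun j _ => ?_
        rw [← castmul n, coeff_pow_succ_mul hS]
        have : ((j : A) + 1) = ((j + 1 : ℕ) : A) := by push_cast; rfl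
        rw [this, castmul, smul_smul]
        congr 1
        · rw [Nat.factorial_succ]
          have : ((j + 1 : ℕ) : L) ≠ 0 := Nat.cast_ne_zero.mpr (Nat.succ_ne_zero j)
          push_cast at this ⊢
          field_simp
        · exact sum_congr rfl fun x _ => castmul _ _
    _ = _ := by
        simp_rw [smul_sum]
        rw [sum_comm]
        refine sum_congr rfl fun x hx => ?_
        rw [ext x.2 (by have := mem_antidiagonal.mp hx; omega), mul_sum, smul_sum]
        refine sum_congr rfl fun j _ => ?_
        rw [mul_smul_comm, smul_comm]

/-- The recursion `n fₙ = ∑ₖ k bₖ f_{n-k}` determines a sequence from its value at `0`. -/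
lemma eq_of_exp_recursion [CharZero L] {M : Type*} [AddCommGroup M] [Module L M]
    (D : ℕ → M → M) {f g : ℕ → M} (h0 : f 0 = g 0)
    (hf : ∀ n : ℕ, (n : L) • f n = ∑ x ∈ antidiagonal n, (x.1 : L) • D x.1 (f x.2))
    (hg : ∀ n : ℕ, (n : L) • g n = ∑ x ∈ antidiagonal n, (x.1 : L) • D x.1 (g x.2)) (n : ℕ) :
    f n = g n := by
  induction n using Nat.strong_induction_on with
  | _ n ih =>
    rcases Nat.eq_zero_or_pos n with rfl | hn
    · exact h0
    have hn' : (n : L) ≠ 0 := Nat.cast_ne_zero.mpr hn.ne'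
    have : (n : L) • f n = (n : L) • g n := by
      rw [hf, hg]
      refine sum_congr rfl fun x hx => ?_
      have := mem_antidiagonal.mp hx
      rcases Nat.eq_zero_or_pos x.1 with h | h
      · simp [h]
      · rw [ih x.2 (by omega)]
    exact smul_right_injective M hn' this

/-- `exp(∑ₙ aₙ zⁿ)` as a formal power series. -/
def expSeries (L : Type*) [Field L] (a : ℕ+ → L) : PowerSeries L :=
  PowerSeries.mk (expCoeff L a)

lemma coeff_zero_expSeries (a : ℕ+ → L) : coeff 0 (expSeries L a) = 1 := by
  simp only [expSeries, coeff_mk, expCoeff_zero]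

/-- The Euler operator `X d/dX` on power series. -/
def euler (f : PowerSeries L) : PowerSeries L := PowerSeries.mk fun n => (n : L) * coeff n f

lemma euler_mul (f g : PowerSeries L) : euler (f * g) = euler f * g + f * euler g := by
  ext n
  simp only [euler, coeff_mk, map_add, coeff_mul, mul_sum]
  rw [← sum_add_distrib]
  refine sum_congr rfl fun x hx => ?_
  rw [← mem_antidiagonal.mp hx]
  push_cast
  ring

variable [CharZero L]

lemma coeff_expSeries_recursion (a : ℕ+ → L) (n : ℕ) :
    (n : L) • coeff n (expSeries L a) = ∑ x ∈ antidiagonal n,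
      (x.1 : L) • (coeff x.1 (currentSeries a) * coeff x.2 (expSeries L a)) := by
  simpa [expSeries] using expCoeff_recursion (L := L) (fun m n => Commute.all (a m) (a n)) n

lemma eq_expSeries {a : ℕ+ → L} {f : PowerSeries L} (h0 : coeff 0 f = 1)
    (h : ∀ n : ℕ, (n : L) • coeff n f = ∑ x ∈ antidiagonal n,
      (x.1 : L) • (coeff x.1 (currentSeries a) * coeff x.2 f)) : f = expSeries L a := by
  ext n
  refine eq_of_exp_recursion (L := L) (fun k y => coeff k (currentSeries a) * y)
    (f := fun n => coeff n f) (g := fun n => coeff n (expSeries L a)) ?_ h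
    (coeff_expSeries_recursion a) n
  simp [h0, expSeries, expCoeff_zero]

lemma expSeries_zero : expSeries L (fun _ => (0 : L)) = 1 := by
  refine (eq_expSeries (by simp) fun n => ?_).symm
  have : currentSeries (fun _ : ℕ+ => (0 : L)) = 0 := by
    ext n; simp [currentSeries]
  rw [this]
  rcases Nat.eq_zero_or_pos n with rfl | hn <;> simp_all [coeff_one]

lemma eq_expSeries_of_euler {a : ℕ+ → L} {f : PowerSeries L} (h0 : coeff 0 f = 1)
    (h : euler f = euler (currentSeries a) * f) : f = expSeries L a := by
  refine eq_expSeries h0 fun n => ?_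
  have := congrArg (coeff n) h
  simpa [euler, coeff_mul, mul_assoc] using this

lemma euler_expSeries (a : ℕ+ → L) :
    euler (expSeries L a) = euler (currentSeries a) * expSeries L a := by
  ext n
  have := coeff_expSeries_recursion a n
  simpa [euler, coeff_mul, mul_assoc] using this

lemma expSeries_add (a b : ℕ+ → L) :
    expSeries L (fun n => a n + b n) = expSeries L a * expSeries L b := by
  refine (eq_expSeries_of_euler ?_ ?_).symm
  · rw [coeff_mul]
    simp [coeff_zero_expSeries]
  · have : currentSeries (fun n => a n + b n) = currentSeries a + currentSeries b := by
      ext n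
      simp only [currentSeries, coeff_mk, map_add]
      split_ifs <;> simp
    rw [euler_mul, euler_expSeries, euler_expSeries, this]
    have : euler (currentSeries a + currentSeries b) =
        euler (currentSeries a) + euler (currentSeries b) := by
      ext n; simp [euler, mul_add]
    rw [this]
    ring

lemma expSeries_sum {ι : Type*} (s : Finset ι) (a : ι → ℕ+ → L) :
    expSeries L (fun n => ∑ i ∈ s, a i n) = ∏ i ∈ s, expSeries L (a i) := by
  classical
  induction s using Finset.induction_on with
  | empty => simpa using expSeries_zero
  | insert i s hi ih =>
    rw [prod_insert hi, ← ih, ← expSeries_add]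
    congr 1
    funext n
    rw [sum_insert hi]

lemma expSeries_neg_mul (a : ℕ+ → L) : expSeries L (fun n => -a n) * expSeries L a = 1 := by
  rw [← expSeries_add, ← expSeries_zero]
  simp

lemma expSeries_neg_pow_div (c : L) :
    expSeries L (fun n => -(c ^ (n : ℕ) / (n : ℕ))) = oneSub c := by
  refine (eq_expSeries_of_euler ?_ ?_).symm
  · simp [oneSub]
  · have h1 : euler (currentSeries fun n : ℕ+ => -(c ^ (n : ℕ) / ((n : ℕ) : L))) =
        1 - PowerSeries.mk fun n => c ^ n := by
      ext n
      simp only [euler, currentSeries, coeff_mk, map_sub, coeff_one]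
      rcases Nat.eq_zero_or_pos n with rfl | hn
      · simp
      · have : (n : L) ≠ 0 := Nat.cast_ne_zero.mpr hn.ne'
        simp [hn, hn.ne']
        field_simp
    have h2 : (PowerSeries.mk fun n => c ^ n) * oneSub c = 1 := by
      ext n
      rcases n with _ | n
      · simp [oneSub]
      · simp [oneSub, mul_sub, ← mul_assoc, coeff_succ_mul_X, coeff_one, pow_succ]
    have h3 : euler (oneSub c) = oneSub c - 1 := by
      ext n
      rcases n with _ | n
      · simp [oneSub, euler]
      · rcases n with _ | n <;>
        simp [oneSub, euler, coeff_one, coeff_C, coeff_X]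
    rw [h1, sub_mul, h2, h3, one_mul]

lemma expSeries_pow_div (c : L) :
    expSeries L (fun n => c ^ (n : ℕ) / (n : ℕ)) = (oneSub c)⁻¹ := by
  have h := expSeries_neg_mul (fun n : ℕ+ => c ^ (n : ℕ) / ((n : ℕ) : L))
  rw [expSeries_neg_pow_div] at h
  rw [PowerSeries.eq_inv_iff_mul_eq_one (by simp [oneSub]), mul_comm]
  exact h

end ExpCoeff

/-! ### Commutation relations read off from exponentials -/

section Shift

open Finset

variable {L : Type*} [Field L] [CharZero L]

/-- If `exp(ℓ(z)) T = exp(β(z)) exp(r(z)) T` for currents `ℓ(z)`, `r(z)` of operators that commute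
with each other, then `ℓₙ T = rₙ T + βₙ T`: the logarithm of the relation. Here `X` and `Y` are the
coefficients of `exp(ℓ(z)) T` and `exp(r(z)) T`, and `B` those of `exp(β(z))`. -/
lemma shift_of_exp_relation {M : Type*} [AddCommGroup M] [Module L M]
    (Lop Rop : ℕ → Module.End L M) (T : M) (X Y : ℕ → M) (B β : ℕ → L)
    (hX0 : X 0 = T) (hY0 : Y 0 = T)
    (hX : ∀ n : ℕ, (n : L) • X n = ∑ x ∈ antidiagonal n, (x.1 : L) • Lop x.1 (X x.2))
    (hY : ∀ n : ℕ, (n : L) • Y n = ∑ x ∈ antidiagonal n, (x.1 : L) • Rop x.1 (Y x.2))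
    (hB : ∀ n : ℕ, (n : L) • B n = ∑ x ∈ antidiagonal n, (x.1 : L) • (β x.1 * B x.2))
    (hXY : ∀ n, X n = ∑ x ∈ antidiagonal n, B x.1 • Y x.2)
    (hLR : ∀ k l m, Lop k (Rop l m) = Rop l (Lop k m))
    (hRR : ∀ k l m, Rop k (Rop l m) = Rop l (Rop k m)) :
    ∀ n, 0 < n → Lop n T = Rop n T + β n • T := by
  have cast_ne : ∀ n : ℕ, 0 < n → (n : L) ≠ 0 := fun n hn => Nat.cast_ne_zero.mpr hn.ne'
  have aux : ∀ k, Lop k T = Rop k T + β k • T → ∀ j, Lop k (Y j) = Rop k (Y j) + β k • Y j := by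
    intro k hk j
    induction j using Nat.strong_induction_on with
    | _ j ih =>
      rcases Nat.eq_zero_or_pos j with rfl | hj
      · rw [hY0, hk]
      refine smul_right_injective M (cast_ne j hj) ?_
      change (j : L) • Lop k (Y j) = (j : L) • (Rop k (Y j) + β k • Y j)
      rw [smul_add, smul_comm (j : L) (β k), ← map_smul (Lop k), ← map_smul (Rop k), hY, map_sum,
        map_sum, smul_sum, ← sum_add_distrib]
      refine sum_congr rfl fun x hx => ?_
      rw [map_smul, map_smul, hLR, smul_comm (β k), ← smul_add]
      rcases Nat.eq_zero_or_pos x.1 with h | h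
      · simp [h]
      · rw [ih x.2 (by have := mem_antidiagonal.mp hx; omega), map_add, map_smul, hRR]
  have auxX : ∀ k, Lop k T = Rop k T + β k • T → ∀ j, Lop k (X j) = Rop k (X j) + β k • X j := by
    intro k hk j
    rw [hXY, map_sum, map_sum, smul_sum, ← sum_add_distrib]
    refine sum_congr rfl fun x _ => ?_
    rw [map_smul, map_smul, aux k hk, smul_add, smul_comm (β k)]
  have main : ∀ n : ℕ, (n : L) • X n =
      ∑ x ∈ antidiagonal n, (x.1 : L) • (Rop x.1 (X x.2) + β x.1 • X x.2) := by
    intro n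
    have h1 : (n : L) • X n = ∑ x ∈ antidiagonal n, ((x.1 : L) • B x.1) • Y x.2 +
        ∑ x ∈ antidiagonal n, B x.1 • ((x.2 : L) • Y x.2) := by
      rw [hXY, smul_sum, ← sum_add_distrib]
      refine sum_congr rfl fun x hx => ?_
      rw [← mem_antidiagonal.mp hx]
      push_cast
      rw [smul_comm (B x.1), smul_assoc, ← add_smul]
    simp_rw [hB, hY] at h1
    rw [h1]
    simp_rw [hXY, map_sum, smul_add, sum_add_distrib, smul_sum, sum_smul]
    rw [add_comm]
    congr 1
    · rw [sum_sigma', sum_sigma']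
      refine sum_nbij' (fun z => ⟨(z.2.1, z.1.1 + z.2.2), (z.1.1, z.2.2)⟩)
        (fun z => ⟨(z.2.1, z.1.1 + z.2.2), (z.1.1, z.2.2)⟩) ?_ ?_ ?_ ?_ ?_ <;>
      rintro ⟨⟨a, c⟩, ⟨d, e⟩⟩ h
      on_goal 5 => simp only [map_smul]; rw [smul_comm]
      all_goals
        simp at h ⊢
        omega
    · rw [sum_sigma', sum_sigma']
      refine sum_nbij' (fun z => ⟨(z.2.1, z.2.2 + z.1.2), (z.2.2, z.1.2)⟩)
        (fun z => ⟨(z.1.1 + z.2.1, z.2.2), (z.1.1, z.2.1)⟩) ?_ ?_ ?_ ?_ ?_ <;>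
      rintro ⟨⟨a, c⟩, ⟨d, e⟩⟩ h
      on_goal 5 => simp only [smul_smul, smul_eq_mul]
      all_goals
        simp at h ⊢
        omega
  intro n
  induction n using Nat.strong_induction_on with
  | _ n ih =>
    intro hn
    have h := hX n
    rw [main n] at h
    have hmem : (n, 0) ∈ antidiagonal n := by simp
    rw [← add_sum_erase _ _ hmem, ← add_sum_erase _ _ hmem, hX0] at h
    have hrest : ∑ x ∈ (antidiagonal n).erase (n, 0), (x.1 : L) • Lop x.1 (X x.2) =
        ∑ x ∈ (antidiagonal n).erase (n, 0), (x.1 : L) • (Rop x.1 (X x.2) + β x.1 • X x.2) := by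
      refine sum_congr rfl fun x hx => ?_
      obtain ⟨hne, hx⟩ := mem_erase.mp hx
      have hs := mem_antidiagonal.mp hx
      rcases Nat.eq_zero_or_pos x.1 with h0 | h0
      · simp [h0]
      · have : x.1 < n := by
          rcases Nat.eq_zero_or_pos x.2 with h2 | h2
          · exact absurd (Prod.ext (by simp; omega) h2) hne
          · omega
        rw [auxX x.1 (ih x.1 this h0)]
    rw [hrest, add_left_inj] at h
    exact (smul_right_injective M (cast_ne n hn) h).symm

end Shift

/-! ### Matrices of operators on the Fock space -/

section FockMatrix

open Finset MvPolynomial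

variable {L : Type*} [Field L]

/-- The matrix of an operator on the Fock space in the basis of the monomials `p^m`. -/
def opMatrix (f : Module.End L (MvPolynomial ℕ+ L)) (o i : FockIdx) : L :=
  coeff o (f (monomial i 1))

/-- The rows of the matrix of `f` have finitely many nonzero entries. -/
def RowFinite (f : Module.End L (MvPolynomial ℕ+ L)) : Prop :=
  ∀ o, {i | opMatrix f o i ≠ 0}.Finite

lemma opMatrix_one : opMatrix (1 : Module.End L (MvPolynomial ℕ+ L)) = kron L := by
  funext o i
  classical
  simp only [opMatrix, Module.End.one_apply, coeff_monomial, kron]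
  by_cases h : i = o
  · rw [if_pos h, if_pos h.symm]
  · rw [if_neg h, if_neg fun h' => h h'.symm]

lemma rowFinite_one : RowFinite (1 : Module.End L (MvPolynomial ℕ+ L)) := by
  intro o
  refine (Set.finite_singleton o).subset fun i hi => ?_
  by_contra h
  refine hi ?_
  rw [opMatrix_one, kron, if_neg fun h' => h h'.symm]

lemma RowFinite.sum {ι : Type*} {s : Finset ι} {f : ι → Module.End L (MvPolynomial ℕ+ L)}
    (h : ∀ x ∈ s, RowFinite (f x)) : RowFinite (∑ x ∈ s, f x) := by
  intro o
  refine (s.finite_toSet.biUnion fun x hx => h x hx o).subset fun i hi => ?_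
  by_contra hn
  refine hi ?_
  simp only [Set.mem_iUnion, not_exists] at hn
  simp only [opMatrix, LinearMap.sum_apply, coeff_sum]
  refine Finset.sum_eq_zero fun x hx => ?_
  exact not_not.mp (hn x hx)

lemma RowFinite.smul {f : Module.End L (MvPolynomial ℕ+ L)} (h : RowFinite f) (c : L) :
    RowFinite (c • f) := by
  intro o
  refine (h o).subset fun i hi h' => hi ?_
  simp only [opMatrix, LinearMap.smul_apply, coeff_smul] at h' ⊢
  rw [h', smul_zero]

variable {J : Type*}

lemma matMul_kron_left {I : Type*} (T : I → J → L) : matMul (kron L) T = T := by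
  funext o i
  rw [matMul, finsum_eq_single _ o]
  · simp [kron]
  · intro x hx
    simp [kron, hx.symm]

lemma matMul_kron_right {I : Type*} (T : J → I → L) : matMul T (kron L) = T := by
  funext o i
  rw [matMul, finsum_eq_single _ i]
  · simp [kron]
  · intro x hx
    simp [kron, hx]

lemma finite_support_left {f : Module.End L (MvPolynomial ℕ+ L)} (h : RowFinite f)
    (T : FockIdx → J → L) (o : FockIdx) (i : J) :
    (Function.support fun m => opMatrix f o m * T m i).Finite :=
  (h o).subset fun m hm h' => hm (by simp [h'])

lemma finite_support_right (f : Module.End L (MvPolynomial ℕ+ L))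
    (T : J → FockIdx → L) (o : J) (i : FockIdx) :
    (Function.support fun m => T o m * opMatrix f m i).Finite := by
  refine (f (monomial i 1)).support.finite_toSet.subset fun m hm => ?_
  rw [Finset.mem_coe, mem_support_iff]
  exact fun h' => hm (by simp [opMatrix, h'])

lemma matMul_opMatrix_sum {ι : Type*} (s : Finset ι) (f : ι → Module.End L (MvPolynomial ℕ+ L))
    (h : ∀ x ∈ s, RowFinite (f x)) (T : FockIdx → J → L) :
    matMul (opMatrix (∑ x ∈ s, f x)) T = ∑ x ∈ s, matMul (opMatrix (f x)) T := by
  funext o i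
  simp only [matMul, Finset.sum_apply]
  rw [← finsum_sum_comm _ _ fun x hx => finite_support_left (h x hx) T o i]
  refine finsum_congr fun m => ?_
  simp [opMatrix, coeff_sum, Finset.sum_mul]

lemma matMul_opMatrix_smul (c : L) (f : Module.End L (MvPolynomial ℕ+ L)) (T : FockIdx → J → L) :
    matMul (opMatrix (c • f)) T = c • matMul (opMatrix f) T := by
  funext o i
  simp only [matMul, Pi.smul_apply, smul_eq_mul]
  rw [mul_finsum]
  exact finsum_congr fun m => by simp [opMatrix, mul_assoc]

lemma matMul_sum_opMatrix {ι : Type*} (s : Finset ι) (f : ι → Module.End L (MvPolynomial ℕ+ L))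
    (T : J → FockIdx → L) :
    matMul T (opMatrix (∑ x ∈ s, f x)) = ∑ x ∈ s, matMul T (opMatrix (f x)) := by
  funext o i
  simp only [matMul, Finset.sum_apply]
  rw [← finsum_sum_comm _ _ fun x _ => finite_support_right (f x) T o i]
  refine finsum_congr fun m => ?_
  simp [opMatrix, coeff_sum, Finset.mul_sum]

lemma matMul_smul_opMatrix (c : L) (f : Module.End L (MvPolynomial ℕ+ L)) (T : J → FockIdx → L) :
    matMul T (opMatrix (c • f)) = c • matMul T (opMatrix f) := by
  funext o i
  simp only [matMul, Pi.smul_apply, smul_eq_mul]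
  rw [mul_finsum]
  exact finsum_congr fun m => by simp [opMatrix]; ring

/-- The operator `∂/∂pₙ`. -/
def dOp (L : Type*) [Field L] (n : ℕ+) : Module.End L (MvPolynomial ℕ+ L) :=
  (pderiv n).toLinearMap

/-- Left multiplication of matrices by `∂/∂pₙ`. -/
def lAnn (L : Type*) [Field L] (J : Type*) (n : ℕ+) : Module.End L (FockIdx → J → L) where
  toFun T o i := (o n + 1 : L) * T (o + Finsupp.single n 1) i
  map_add' S T := by funext o i; simp [mul_add]
  map_smul' c T := by funext o i; simp; ring

/-- Right multiplication of matrices by `∂/∂pₙ`. -/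
def rAnn (L : Type*) [Field L] (J : Type*) (n : ℕ+) : Module.End L (J → FockIdx → L) where
  toFun T o i := (i n : L) * T o (i - Finsupp.single n 1)
  map_add' S T := by funext o i; simp [mul_add]
  map_smul' c T := by funext o i; simp; ring

/-- Left multiplication of matrices by the operator of multiplication by `pₙ`. -/
def lCre (L : Type*) [Field L] (J : Type*) (n : ℕ+) : Module.End L (FockIdx → J → L) where
  toFun T o i := if o n = 0 then 0 else T (o - Finsupp.single n 1) i
  map_add' S T := by funext o i; simp only [Pi.add_apply]; split_ifs <;> simp
  map_smul' c T := by funext o i; simp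

/-- Right multiplication of matrices by the operator of multiplication by `pₙ`. -/
def rCre (L : Type*) [Field L] (J : Type*) (n : ℕ+) : Module.End L (J → FockIdx → L) where
  toFun T o i := T o (i + Finsupp.single n 1)
  map_add' _ _ := rfl
  map_smul' _ _ := rfl

lemma opMatrix_dOp_mul (n : ℕ+) (f : Module.End L (MvPolynomial ℕ+ L)) (o i : FockIdx) :
    opMatrix (dOp L n * f) o i = (o n + 1 : L) * opMatrix f (o + Finsupp.single n 1) i := by
  simp [opMatrix, dOp, coeff_pderiv, mul_comm]

lemma opMatrix_aNeg_mul (n : ℕ+) (f : Module.End L (MvPolynomial ℕ+ L)) (o i : FockIdx) :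
    opMatrix (aNeg L n * f) o i =
      if o n = 0 then 0 else opMatrix f (o - Finsupp.single n 1) i := by
  simp only [opMatrix, aNeg, Module.End.mul_apply, LinearMap.mulLeft_apply, coeff_X_mul',
    Finsupp.mem_support_iff]
  split_ifs <;> simp_all

lemma mul_dOp_monomial (n : ℕ+) (f : Module.End L (MvPolynomial ℕ+ L)) (i : FockIdx) :
    (f * dOp L n) (monomial i 1) = (i n : L) • f (monomial (i - Finsupp.single n 1) 1) := by
  rw [Module.End.mul_apply, dOp]
  change f (pderiv n (monomial i 1)) = _
  rw [pderiv_monomial, ← map_smul, smul_monomial]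
  simp

lemma mul_aNeg_monomial (n : ℕ+) (f : Module.End L (MvPolynomial ℕ+ L)) (i : FockIdx) :
    (f * aNeg L n) (monomial i 1) = f (monomial (i + Finsupp.single n 1) 1) := by
  rw [Module.End.mul_apply, aNeg, LinearMap.mulLeft_apply, X, monomial_mul, one_mul, add_comm]

/-- `Dl` is the left multiplication by the operator `D` on the matrices with rows in `J`. -/
def IsLeftMul (D : Module.End L (MvPolynomial ℕ+ L)) (Dl : Module.End L (FockIdx → J → L)) : Prop :=
  ∀ f T, RowFinite f → RowFinite (D * f) ∧
    matMul (opMatrix (D * f)) T = Dl (matMul (opMatrix f) T)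

/-- `Dr` is the right multiplication by the operator `D`. -/
def IsRightMul (D : Module.End L (MvPolynomial ℕ+ L)) (Dr : Module.End L (J → FockIdx → L)) : Prop :=
  ∀ f T, matMul T (opMatrix (f * D)) = Dr (matMul T (opMatrix f))

lemma isLeftMul_dOp (n : ℕ+) : IsLeftMul (dOp L n) (lAnn L J n) := by
  intro f T hf
  constructor
  · intro o
    refine (hf (o + Finsupp.single n 1)).subset fun i hi h' => hi ?_
    rw [opMatrix_dOp_mul, h', mul_zero]
  · funext o i
    simp only [matMul, lAnn, LinearMap.coe_mk, AddHom.coe_mk, opMatrix_dOp_mul]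
    rw [mul_finsum]
    exact finsum_congr fun m => by ring

lemma isLeftMul_aNeg (n : ℕ+) : IsLeftMul (aNeg L n) (lCre L J n) := by
  intro f T hf
  constructor
  · intro o
    refine (hf (o - Finsupp.single n 1)).subset fun i hi h' => hi ?_
    rw [opMatrix_aNeg_mul, h', ite_self]
  · funext o i
    simp only [matMul, lCre, LinearMap.coe_mk, AddHom.coe_mk, opMatrix_aNeg_mul]
    split_ifs <;> simp

lemma isRightMul_dOp (n : ℕ+) : IsRightMul (dOp L n) (rAnn L J n) := by
  intro f T
  funext o i
  simp only [matMul, rAnn, LinearMap.coe_mk, AddHom.coe_mk, opMatrix, mul_dOp_monomial, coeff_smul]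
  rw [mul_finsum]
  exact finsum_congr fun m => by simp; ring

lemma isRightMul_aNeg (n : ℕ+) : IsRightMul (aNeg L n) (rCre L J n) := by
  intro f T
  funext o i
  simp only [matMul, rCre, LinearMap.coe_mk, AddHom.coe_mk, opMatrix, mul_aNeg_monomial]

lemma IsLeftMul.smul {D : Module.End L (MvPolynomial ℕ+ L)} {Dl : Module.End L (FockIdx → J → L)}
    (h : IsLeftMul D Dl) (c : L) : IsLeftMul (c • D) (c • Dl) := by
  intro f T hf
  rw [smul_mul_assoc, matMul_opMatrix_smul, (h f T hf).2]
  exact ⟨(h f T hf).1.smul c, rfl⟩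

lemma IsRightMul.smul {D : Module.End L (MvPolynomial ℕ+ L)} {Dr : Module.End L (J → FockIdx → L)}
    (h : IsRightMul D Dr) (c : L) : IsRightMul (c • D) (c • Dr) := by
  intro f T
  rw [mul_smul_comm, matMul_smul_opMatrix, h f T]
  rfl

lemma commute_smul_dOp (c : ℕ+ → L) (m n : ℕ+) : Commute (c m • dOp L m) (c n • dOp L n) := by
  refine (Commute.smul_left (Commute.smul_right ?_ _) _)
  refine LinearMap.ext fun f => ?_
  change pderiv m (pderiv n f) = pderiv n (pderiv m f)
  ext o
  simp only [coeff_pderiv, Finsupp.add_apply]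
  rw [add_right_comm]
  by_cases h : m = n
  · subst h; rfl
  · simp [h, Ne.symm h]
    ring

lemma commute_smul_aNeg (c : ℕ+ → L) (m n : ℕ+) : Commute (c m • aNeg L m) (c n • aNeg L n) := by
  refine (Commute.smul_left (Commute.smul_right ?_ _) _)
  refine LinearMap.ext fun f => ?_
  simp only [aNeg, Module.End.mul_apply, LinearMap.mulLeft_apply]
  ring

lemma isLeftMul_coeff {D : ℕ+ → Module.End L (MvPolynomial ℕ+ L)}
    {Dl : ℕ+ → Module.End L (FockIdx → J → L)} (h : ∀ n, IsLeftMul (D n) (Dl n)) (k : ℕ) :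
    IsLeftMul (PowerSeries.coeff k (currentSeries D)) (PowerSeries.coeff k (currentSeries Dl)) := by
  simp only [currentSeries, PowerSeries.coeff_mk]
  split_ifs with hk
  · exact h _
  · intro f T _
    refine ⟨fun o => by simp [opMatrix], ?_⟩
    funext o i
    simp [matMul, opMatrix]

lemma isRightMul_coeff {D : ℕ+ → Module.End L (MvPolynomial ℕ+ L)}
    {Dr : ℕ+ → Module.End L (J → FockIdx → L)} (h : ∀ n, IsRightMul (D n) (Dr n)) (k : ℕ) :
    IsRightMul (PowerSeries.coeff k (currentSeries D)) (PowerSeries.coeff k (currentSeries Dr)) := by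
  simp only [currentSeries, PowerSeries.coeff_mk]
  split_ifs with hk
  · exact h _
  · intro f T
    funext o i
    simp [matMul, opMatrix]

variable [CharZero L]

lemma rowFinite_expCoeff {D : ℕ+ → Module.End L (MvPolynomial ℕ+ L)}
    {Dl : ℕ+ → Module.End L (FockIdx → J → L)} (hD : ∀ m n, Commute (D m) (D n))
    (h : ∀ n, IsLeftMul (D n) (Dl n)) (n : ℕ) : RowFinite (expCoeff L D n) := by
  induction n using Nat.strong_induction_on with
  | _ n ih =>
    rcases Nat.eq_zero_or_pos n with rfl | hn
    · rw [expCoeff_zero]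
      exact rowFinite_one
    have hn' : (n : L) ≠ 0 := Nat.cast_ne_zero.mpr hn.ne'
    have := expCoeff_recursion (L := L) hD n
    rw [← inv_smul_smul₀ hn' (expCoeff L D n), this]
    refine RowFinite.smul (RowFinite.sum fun x hx => ?_) _
    rcases Nat.eq_zero_or_pos x.1 with h0 | h0
    · rw [h0]
      intro o
      simp [opMatrix]
    · exact ((isLeftMul_coeff h x.1 _ 0
        (ih x.2 (by have := mem_antidiagonal.mp hx; omega))).1).smul _

lemma matMul_expCoeff_left_recursion {D : ℕ+ → Module.End L (MvPolynomial ℕ+ L)}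
    {Dl : ℕ+ → Module.End L (FockIdx → J → L)} (hD : ∀ m n, Commute (D m) (D n))
    (h : ∀ n, IsLeftMul (D n) (Dl n)) (T : FockIdx → J → L) (n : ℕ) :
    (n : L) • matMul (opMatrix (expCoeff L D n)) T = ∑ x ∈ antidiagonal n,
      (x.1 : L) • PowerSeries.coeff x.1 (currentSeries Dl)
        (matMul (opMatrix (expCoeff L D x.2)) T) := by
  have hrow : ∀ k l, RowFinite (PowerSeries.coeff k (currentSeries D) * expCoeff L D l) :=
    fun k l => (isLeftMul_coeff h k _ 0 (rowFinite_expCoeff hD h l)).1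
  rw [← matMul_opMatrix_smul, expCoeff_recursion hD,
    matMul_opMatrix_sum _ _ fun x _ => (hrow _ _).smul _]
  refine sum_congr rfl fun x _ => ?_
  rw [matMul_opMatrix_smul, (isLeftMul_coeff h _ _ T (rowFinite_expCoeff hD h _)).2]

lemma commute_expCoeff {D : ℕ+ → Module.End L (MvPolynomial ℕ+ L)}
    (hD : ∀ m n, Commute (D m) (D n)) (k n : ℕ) :
    Commute (PowerSeries.coeff k (currentSeries D)) (expCoeff L D n) := by
  induction n using Nat.strong_induction_on with
  | _ n ih =>
    rcases Nat.eq_zero_or_pos n with rfl | hn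
    · rw [expCoeff_zero]
      exact Commute.one_right _
    have hn' : (n : L) ≠ 0 := Nat.cast_ne_zero.mpr hn.ne'
    have := expCoeff_recursion (L := L) hD n
    rw [← inv_smul_smul₀ hn' (expCoeff L D n), this]
    refine Commute.smul_right (Commute.sum_right _ _ _ fun x hx => ?_) _
    rcases Nat.eq_zero_or_pos x.1 with h0 | h0
    · rw [h0]
      simp
    · exact Commute.smul_right ((commute_coeff_currentSeries hD _ _).mul_right
        (ih x.2 (by have := mem_antidiagonal.mp hx; omega))) _

lemma matMul_expCoeff_right_recursion {D : ℕ+ → Module.End L (MvPolynomial ℕ+ L)}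
    {Dr : ℕ+ → Module.End L (J → FockIdx → L)} (hD : ∀ m n, Commute (D m) (D n))
    (h : ∀ n, IsRightMul (D n) (Dr n)) (T : J → FockIdx → L) (n : ℕ) :
    (n : L) • matMul T (opMatrix (expCoeff L D n)) = ∑ x ∈ antidiagonal n,
      (x.1 : L) • PowerSeries.coeff x.1 (currentSeries Dr)
        (matMul T (opMatrix (expCoeff L D x.2))) := by
  rw [← matMul_smul_opMatrix, expCoeff_recursion hD, matMul_sum_opMatrix]
  refine sum_congr rfl fun x _ => ?_
  rw [matMul_smul_opMatrix, (commute_expCoeff hD _ _).eq, isRightMul_coeff h]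

end FockMatrix

/-! ### Independence of `q` and `t` -/

section Parameters

variable (L : Type*) [Field L] [Algebra BaseField L]

lemma qRoot_ne_zero : qRoot L ≠ 0 := by
  simp [qRoot]

lemma tRoot_ne_zero : tRoot L ≠ 0 := by
  simp [tRoot]

lemma qq_ne_zero : qq L ≠ 0 := pow_ne_zero _ (qRoot_ne_zero L)

lemma tt_ne_zero : tt L ≠ 0 := pow_ne_zero _ (tRoot_ne_zero L)

lemma qtQuarter_ne_zero : qtQuarter L ≠ 0 := div_ne_zero (qRoot_ne_zero L) (tRoot_ne_zero L)

lemma qtHalf_ne_zero : qtHalf L ≠ 0 := pow_ne_zero _ (qtQuarter_ne_zero L)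

lemma qtHalf_sq : qtHalf L ^ 2 = qq L / tt L := by
  rw [qtHalf, qtQuarter, qq, tt, ← pow_mul, div_pow]

lemma qtQuarter_pow_four : qtQuarter L ^ 4 = qq L / tt L := by
  rw [← qtHalf_sq, qtHalf, ← pow_mul]

lemma root_pow_injective {a b c d : ℕ}
    (h : qRoot L ^ a * tRoot L ^ b = qRoot L ^ c * tRoot L ^ d) : a = c ∧ b = d := by
  simp only [qRoot, tRoot, ← map_pow, ← map_mul] at h
  have h1 := IsFractionRing.injective (MvPolynomial (Fin 2) ℚ) BaseField
    ((algebraMap BaseField L).injective h)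
  simp only [MvPolynomial.X_pow_eq_monomial, MvPolynomial.monomial_mul, mul_one] at h1
  have h2 := MvPolynomial.monomial_left_injective (R := ℚ) one_ne_zero h1
  have e0 := DFunLike.congr_fun h2 0
  have e1 := DFunLike.congr_fun h2 1
  simp at e0 e1
  exact ⟨e0, e1⟩

variable {L} in
lemma zpow_qq_tt_eq_one {a b : ℤ} (h : qq L ^ a * tt L ^ b = 1) : a = 0 ∧ b = 0 := by
  have key : qRoot L ^ (4 * a.toNat) * tRoot L ^ (4 * b.toNat) =
      qRoot L ^ (4 * (-a).toNat) * tRoot L ^ (4 * (-b).toNat) := by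
    have hq := qq_ne_zero L
    have ht := tt_ne_zero L
    simp only [pow_mul]
    change qq L ^ _ * tt L ^ _ = qq L ^ _ * tt L ^ _
    have ha : a = (a.toNat : ℤ) - ((-a).toNat : ℤ) := by omega
    have hb : b = (b.toNat : ℤ) - ((-b).toNat : ℤ) := by omega
    rw [ha, hb, zpow_sub₀ hq, zpow_sub₀ ht] at h
    simp only [zpow_natCast] at h
    field_simp at h
    exact h
  have := root_pow_injective L key
  omega

variable {L} in
lemma one_sub_zpow_ne_zero {a b : ℤ} (h : a ≠ 0 ∨ b ≠ 0) : 1 - qq L ^ a * tt L ^ b ≠ 0 := by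
  intro h0
  have := zpow_qq_tt_eq_one (sub_eq_zero.mp h0).symm
  omega

lemma one_sub_qq_pow_ne_zero {n : ℕ} (hn : 0 < n) : 1 - qq L ^ n ≠ 0 := by
  simpa using one_sub_zpow_ne_zero (L := L) (a := n) (b := 0) (by omega)

lemma one_sub_tt_pow_ne_zero {n : ℕ} (hn : 0 < n) : 1 - tt L ^ n ≠ 0 := by
  simpa using one_sub_zpow_ne_zero (L := L) (a := 0) (b := n) (by omega)

lemma one_sub_tt_inv_pow_ne_zero {n : ℕ} (hn : 0 < n) : 1 - (tt L)⁻¹ ^ n ≠ 0 := by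
  simpa using one_sub_zpow_ne_zero (L := L) (a := 0) (b := -n) (by omega)

lemma one_sub_tt_div_qq_pow_ne_zero {n : ℕ} (hn : 0 < n) : 1 - (tt L / qq L) ^ n ≠ 0 := by
  have := one_sub_zpow_ne_zero (L := L) (a := -n) (b := n) (by omega)
  rwa [zpow_neg, zpow_natCast, zpow_natCast, mul_comm, ← div_eq_mul_inv, ← div_pow] at this

end Parameters

/-! ### The eigenvalues of `ψ^±(z)` on the Macdonald functions -/

section Eigenvalues

open Finset PowerSeries

variable {L : Type*} [Field L]

/-- `q^{λ_i} t^{-i}`, where the rows are numbered from `0`. -/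
def rowVar (q t : L) (la : YoungDiagram) (i : ℕ) : L := q ^ la.rowLen i * t⁻¹ ^ i

/-- `Y_λ(qⁿ, tⁿ)`, where `Y_λ = ∑_{i ≤ ℓ} q^{λ_i} t^{-i} - t⁻¹ ∑_{i < ℓ} q^{λ_i} t^{-i}`
for `ℓ = ℓ(λ)`, the rows being numbered from `0`. -/
def rowChar (q t : L) (la : YoungDiagram) (n : ℕ) : L :=
  ∑ i ∈ range (la.colLen 0 + 1), rowVar q t la i ^ n -
    t⁻¹ ^ n * ∑ i ∈ range (la.colLen 0), rowVar q t la i ^ n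

variable [CharZero L]

/-- The product over the rows in the eigenvalue of `ψ^±(z)`, as an exponential. With
`κ = t / q` and `τ = t⁻¹` its coefficients are `(1 - κⁿ) / n` times `Y_λ(qⁿ, tⁿ)`. -/
lemma prod_oneSub_eq_expSeries (x : ℕ → L) (κ τ : L) (l : ℕ) :
    oneSub (κ * x 0) * (oneSub (x 0))⁻¹ *
      ∏ i ∈ range l, (oneSub (τ * x i) * oneSub (κ * x (i + 1))) *
        (oneSub (x (i + 1)) * oneSub (τ * κ * x i))⁻¹ =
    expSeries L fun n => (1 - κ ^ (n : ℕ)) / (n : ℕ) *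
      (∑ i ∈ range (l + 1), x i ^ (n : ℕ) - τ ^ (n : ℕ) * ∑ i ∈ range l, x i ^ (n : ℕ)) := by
  induction l with
  | zero =>
    rw [← expSeries_pow_div, ← expSeries_neg_pow_div]
    simp only [range_zero, prod_empty, mul_one, ← expSeries_add]
    congr 1
    funext n
    simp
    ring
  | succ l ih =>
    rw [prod_range_succ, ← mul_assoc, ih, PowerSeries.mul_inv_rev]
    simp only [← expSeries_pow_div]
    simp only [← expSeries_neg_pow_div, ← expSeries_add]
    congr 1
    funext n
    rw [sum_range_succ _ (l + 1), sum_range_succ _ l]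
    ring

variable [Algebra BaseField L]

lemma Bplus_eq_expSeries (la : YoungDiagram) : Bplus la = expSeries L fun n =>
    (1 - (tt L / qq L) ^ (n : ℕ)) / (n : ℕ) * rowChar (qq L) (tt L) la n := by
  have hq := qq_ne_zero L
  have ht := tt_ne_zero L
  rw [Bplus]
  simp only [rowChar]
  rw [← prod_oneSub_eq_expSeries (rowVar (qq L) (tt L) la) (tt L / qq L) (tt L)⁻¹]
  congr 1
  · congr 2 <;> simp [rowVar, zpow_sub₀ hq]
    field_simp
  · refine prod_congr rfl fun i _ => ?_
    congr 1
    · congr 2 <;> simp [rowVar, zpow_sub₀ hq, zpow_sub₀ ht, zpow_neg, pow_succ] <;> field_simp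
    · congr 3 <;> simp [rowVar, zpow_sub₀ hq, zpow_sub₀ ht, zpow_neg, pow_succ] <;> field_simp
      simp

lemma Bminus_eq_expSeries (la : YoungDiagram) : Bminus la = expSeries L fun n =>
    (1 - (qq L / tt L) ^ (n : ℕ)) / (n : ℕ) * rowChar (qq L)⁻¹ (tt L)⁻¹ la n := by
  have hq := qq_ne_zero L
  have ht := tt_ne_zero L
  rw [Bminus]
  simp only [rowChar]
  rw [← prod_oneSub_eq_expSeries (rowVar (qq L)⁻¹ (tt L)⁻¹ la) (qq L / tt L) (tt L)⁻¹⁻¹]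
  congr 1
  · congr 2 <;> simp [rowVar, zpow_add₀ hq, zpow_neg]
    field_simp
  · refine prod_congr rfl fun i _ => ?_
    congr 1
    · congr 2 <;> simp [rowVar, zpow_add₀ hq, zpow_add₀ ht, zpow_neg, pow_succ] <;> field_simp
    · congr 3 <;> simp [rowVar, zpow_add₀ hq, zpow_add₀ ht, zpow_neg, pow_succ] <;> field_simp

end Eigenvalues

/-! ### Vertex operators -/

section VertexOp

open Finset MvPolynomial

variable {L : Type*} [Field L]

/-- `T` is the matrix of `τ exp(∑ₙ bₙ pₙ) exp(∑ₙ cₙ ∂/∂pₙ)`, characterized by its entry at the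
vacuum and the commutators with `pₙ` (at the vacuum) and `∂/∂pₙ`. -/
structure IsVertexOp (b c : ℕ+ → L) (τ : L) (T : FockIdx → FockIdx → L) : Prop where
  vac : T 0 0 = τ
  row : ∀ i n, T 0 (i + Finsupp.single n 1) = c n * T 0 i
  col : ∀ o i n, (o n + 1 : L) * T (o + Finsupp.single n 1) i =
    (i n : L) * T o (i - Finsupp.single n 1) + b n * T o i

lemma commute_coeff_of_commute {A : Type*} [Ring A] {b c : ℕ+ → A}
    (h : ∀ m n, Commute (b m) (c n)) (k l : ℕ) :
    Commute (PowerSeries.coeff k (currentSeries b)) (PowerSeries.coeff l (currentSeries c)) := by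
  simp only [currentSeries, PowerSeries.coeff_mk]
  split_ifs
  exacts [h _ _, Commute.zero_right _, Commute.zero_left _, Commute.zero_left _]

lemma commute_smul {M : Type*} [AddCommGroup M] [Module L M] {f g : Module.End L M}
    (h : Commute f g) (a b : L) : Commute (a • f) (b • g) :=
  Commute.smul_left (Commute.smul_right h _) _

lemma commute_lAnn_rAnn (m n : ℕ+) : Commute (lAnn L FockIdx m) (rAnn L FockIdx n) := by
  refine LinearMap.ext fun T => ?_
  funext o i
  simp [lAnn, rAnn]
  ring

lemma commute_lAnn_lAnn (m n : ℕ+) : Commute (lAnn L FockIdx m) (lAnn L FockIdx n) := by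
  refine LinearMap.ext fun T => ?_
  funext o i
  simp only [lAnn, Module.End.mul_apply, LinearMap.coe_mk, AddHom.coe_mk]
  by_cases h : m = n
  · rw [h]
  · rw [add_right_comm]
    simp [h, Ne.symm h]
    ring

lemma commute_rAnn_rAnn (m n : ℕ+) : Commute (rAnn L FockIdx m) (rAnn L FockIdx n) := by
  refine LinearMap.ext fun T => ?_
  funext o i
  simp only [rAnn, Module.End.mul_apply, LinearMap.coe_mk, AddHom.coe_mk]
  by_cases h : m = n
  · rw [h]
  · rw [tsub_right_comm]
    simp [h, Ne.symm h]
    ring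

lemma commute_lCre_rCre (m n : ℕ+) : Commute (lCre L FockIdx m) (rCre L FockIdx n) := by
  refine LinearMap.ext fun T => ?_
  funext o i
  simp [lCre, rCre]

lemma commute_lCre_lCre (m n : ℕ+) : Commute (lCre L FockIdx m) (lCre L FockIdx n) := by
  refine LinearMap.ext fun T => ?_
  funext o i
  simp only [lCre, Module.End.mul_apply, LinearMap.coe_mk, AddHom.coe_mk]
  by_cases h : m = n
  · rw [h]
  · rw [tsub_right_comm]
    simp [h, Ne.symm h]
    split_ifs <;> rfl

lemma commute_rCre_rCre (m n : ℕ+) : Commute (rCre L FockIdx m) (rCre L FockIdx n) := by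
  refine LinearMap.ext fun T => ?_
  funext o i
  simp [rCre, add_right_comm]

variable [CharZero L]

/-- If `exp(D(z)) T = exp(β(sz)) T exp(D(z))` as series in `z`, then the modes of `D` commute with
`T` up to the constants `βₙ sⁿ`. -/
lemma shift_of_intertwining {D : ℕ+ → Module.End L (MvPolynomial ℕ+ L)}
    {Dl Dr : ℕ+ → Module.End L (FockIdx → FockIdx → L)}
    (hD : ∀ m n, Commute (D m) (D n)) (hl : ∀ n, IsLeftMul (D n) (Dl n))
    (hr : ∀ n, IsRightMul (D n) (Dr n)) (hlr : ∀ m n, Commute (Dl m) (Dr n))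
    (hrr : ∀ m n, Commute (Dr m) (Dr n)) (β : ℕ+ → L) (s : L) (T : FockIdx → FockIdx → L)
    (h : ∀ n, matMul (opMatrix (expCoeff L D n)) T = ∑ x ∈ antidiagonal n,
      (PowerSeries.coeff x.1 (expSeries L β) * s ^ x.1) • matMul T (opMatrix (expCoeff L D x.2)))
    (n : ℕ+) : Dl n T = Dr n T + (β n * s ^ (n : ℕ)) • T := by
  have := shift_of_exp_relation (L := L)
    (fun k => PowerSeries.coeff k (currentSeries Dl))
    (fun k => PowerSeries.coeff k (currentSeries Dr)) T
    (fun n => matMul (opMatrix (expCoeff L D n)) T) (fun n => matMul T (opMatrix (expCoeff L D n)))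
    (fun k => PowerSeries.coeff k (expSeries L β) * s ^ k)
    (fun k => PowerSeries.coeff k (currentSeries β) * s ^ k)
    (by rw [expCoeff_zero, opMatrix_one, matMul_kron_left])
    (by rw [expCoeff_zero, opMatrix_one, matMul_kron_right])
    (matMul_expCoeff_left_recursion hD hl T) (matMul_expCoeff_right_recursion hD hr T)
    (fun n => by
      have h := coeff_expSeries_recursion β n
      simp only [smul_eq_mul] at h ⊢
      rw [← mul_assoc, h, sum_mul]
      refine sum_congr rfl fun x hx => ?_
      rw [← mem_antidiagonal.mp hx, pow_add]
      ring) h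
    (fun k l m => LinearMap.congr_fun (commute_coeff_of_commute hlr k l).eq m)
    (fun k l m => LinearMap.congr_fun (commute_coeff_of_commute hrr k l).eq m) n n.pos
  simpa only [coeff_currentSeries_pnat] using this

/-- `shift_of_intertwining` with the two sides exchanged. -/
lemma shift_of_intertwining' {D : ℕ+ → Module.End L (MvPolynomial ℕ+ L)}
    {Dl Dr : ℕ+ → Module.End L (FockIdx → FockIdx → L)}
    (hD : ∀ m n, Commute (D m) (D n)) (hl : ∀ n, IsLeftMul (D n) (Dl n))
    (hr : ∀ n, IsRightMul (D n) (Dr n)) (hlr : ∀ m n, Commute (Dl m) (Dr n))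
    (hll : ∀ m n, Commute (Dl m) (Dl n)) (β : ℕ+ → L) (s : L) (T : FockIdx → FockIdx → L)
    (h : ∀ n, matMul T (opMatrix (expCoeff L D n)) = ∑ x ∈ antidiagonal n,
      (PowerSeries.coeff x.1 (expSeries L β) * s ^ x.1) • matMul (opMatrix (expCoeff L D x.2)) T)
    (n : ℕ+) : Dr n T = Dl n T + (β n * s ^ (n : ℕ)) • T := by
  have := shift_of_exp_relation (L := L)
    (fun k => PowerSeries.coeff k (currentSeries Dr))
    (fun k => PowerSeries.coeff k (currentSeries Dl)) T
    (fun n => matMul T (opMatrix (expCoeff L D n)))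
    (fun n => matMul (opMatrix (expCoeff L D n)) T)
    (fun k => PowerSeries.coeff k (expSeries L β) * s ^ k)
    (fun k => PowerSeries.coeff k (currentSeries β) * s ^ k)
    (by rw [expCoeff_zero, opMatrix_one, matMul_kron_right])
    (by rw [expCoeff_zero, opMatrix_one, matMul_kron_left])
    (matMul_expCoeff_right_recursion hD hr T) (matMul_expCoeff_left_recursion hD hl T)
    (fun n => by
      have h := coeff_expSeries_recursion β n
      simp only [smul_eq_mul] at h ⊢
      rw [← mul_assoc, h, sum_mul]
      refine sum_congr rfl fun x hx => ?_
      rw [← mem_antidiagonal.mp hx, pow_add]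
      ring) h
    (fun k l m => (LinearMap.congr_fun (commute_coeff_of_commute hlr l k).eq m).symm)
    (fun k l m => LinearMap.congr_fun (commute_coeff_of_commute hll k l).eq m) n n.pos
  simpa only [coeff_currentSeries_pnat] using this

end VertexOp

/-! ### The modes of the vertex operators -/

section Modes

open Finset MvPolynomial

variable {L : Type*} [Field L]

lemma coeff_zero_expCoeff_aNeg [CharZero L] (b : ℕ+ → L) {k : ℕ} (hk : 0 < k)
    (g : MvPolynomial ℕ+ L) : coeff 0 (expCoeff L (fun j => b j • aNeg L j) k g) = 0 := by
  have hk' : (k : L) ≠ 0 := Nat.cast_ne_zero.mpr hk.ne'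
  have h := congrArg (fun f => coeff 0 (f g))
    (expCoeff_recursion (L := L) (b := fun j => b j • aNeg L j) (commute_smul_aNeg b) k)
  simp only [LinearMap.smul_apply, coeff_smul, LinearMap.sum_apply, coeff_sum] at h
  refine (smul_eq_zero.mp (h.trans (sum_eq_zero fun x _ => ?_))).resolve_left hk'
  rcases Nat.eq_zero_or_pos x.1 with h0 | h0
  · simp [h0]
  · obtain ⟨n, hn⟩ : ∃ n : ℕ+, (n : ℕ) = x.1 := ⟨⟨x.1, h0⟩, rfl⟩
    rw [← hn, coeff_currentSeries_pnat]
    simp [aNeg, ← constantCoeff_eq]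

lemma expCoeff_dOp_one [CharZero L] (c : ℕ+ → L) {k : ℕ} (hk : 0 < k) :
    expCoeff L (fun j => c j • dOp L j) k (monomial 0 1) = 0 := by
  have hk' : (k : L) ≠ 0 := Nat.cast_ne_zero.mpr hk.ne'
  have h := congrArg (fun f => f (monomial 0 1))
    (expCoeff_recursion (L := L) (b := fun j => c j • dOp L j) (commute_smul_dOp c) k)
  simp only [LinearMap.smul_apply, LinearMap.sum_apply] at h
  refine (smul_eq_zero.mp (h.trans (sum_eq_zero fun x _ => ?_))).resolve_left hk'
  rw [(commute_expCoeff (commute_smul_dOp c) _ _).eq]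
  simp only [currentSeries, PowerSeries.coeff_mk]
  split_ifs <;> simp [dOp]

lemma expCoeff_const_zero [CharZero L] {A : Type*} [Ring A] [Algebra L A] {k : ℕ} (hk : 0 < k) :
    expCoeff L (fun _ => (0 : A)) k = 0 := by
  have hk' : (k : L) ≠ 0 := Nat.cast_ne_zero.mpr hk.ne'
  have h := expCoeff_recursion (L := L) (b := fun _ : ℕ+ => (0 : A)) (fun _ _ => Commute.refl _) k
  rw [sum_eq_zero fun x _ => by simp [currentSeries]] at h
  exact (smul_eq_zero.mp h).resolve_left hk'

variable [Algebra BaseField L]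

/-- The factor `n (1 - qⁿ)/(1 - tⁿ)` in `aₙ`. -/
def heisNorm (L : Type*) [Field L] [Algebra BaseField L] (n : ℕ+) : L :=
  ((n : ℕ) : L) * ((1 - qq L ^ (n : ℕ)) / (1 - tt L ^ (n : ℕ)))

lemma smul_aPos (c : ℕ+ → L) :
    (fun j => c j • aPos L j) = fun j => (c j * heisNorm L j) • dOp L j := by
  funext j
  rw [aPos, dOp, smul_smul, heisNorm]

variable [CharZero L]

lemma vertexMode_zero_row (b c : ℕ+ → L) (n : ℕ) (i : FockIdx) : vertexMode b c (n : ℤ) 0 i =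
    opMatrix (expCoeff L (fun j => (c j * heisNorm L j) • dOp L j) n) 0 i := by
  rw [vertexMode, finsum_eq_single _ (0, n)]
  · simp [expCoeff_zero, opMatrix, smul_aPos]
  · rintro ⟨k, l⟩ hne
    dsimp only
    split_ifs with h
    · refine coeff_zero_expCoeff_aNeg b (Nat.pos_of_ne_zero ?_) _
      rintro rfl
      exact hne (by simp at h; simp [h])
    · rfl

lemma vertexMode_zero_row_neg (b c : ℕ+ → L) {n : ℤ} (hn : n < 0) (i : FockIdx) :
    vertexMode b c n 0 i = 0 := by
  rw [vertexMode]
  refine finsum_eq_zero_of_forall_eq_zero fun k => ?_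
  split_ifs with h
  · exact coeff_zero_expCoeff_aNeg b (by omega) _
  · rfl

lemma vertexMode_zero_col (b c : ℕ+ → L) (n : ℕ) (o : FockIdx) : vertexMode b c (-(n : ℤ)) o 0 =
    opMatrix (expCoeff L (fun j => b j • aNeg L j) n) o 0 := by
  rw [vertexMode, finsum_eq_single _ (n, 0)]
  · simp [expCoeff_zero, opMatrix]
  · rintro ⟨k, l⟩ hne
    dsimp only
    split_ifs with h
    · have : 0 < l := by
        refine Nat.pos_of_ne_zero ?_
        rintro rfl
        exact hne (by simp at h; simp [h])
      rw [smul_aPos, expCoeff_dOp_one _ this, map_zero, coeff_zero]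
    · rfl

lemma vertexMode_zero_col_pos (b c : ℕ+ → L) {n : ℤ} (hn : 0 < n) (o : FockIdx) :
    vertexMode b c n o 0 = 0 := by
  rw [vertexMode]
  refine finsum_eq_zero_of_forall_eq_zero fun k => ?_
  split_ifs with h
  · rw [smul_aPos, expCoeff_dOp_one _ (by omega), map_zero, coeff_zero]
  · rfl

lemma vertexMode_zero_left (c : ℕ+ → L) (n : ℕ) : vertexMode (fun _ => 0) c (n : ℤ) =
    opMatrix (expCoeff L (fun j => (c j * heisNorm L j) • dOp L j) n) := by
  funext o i
  rw [vertexMode, finsum_eq_single _ (0, n)]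
  · simp [expCoeff_zero, opMatrix, smul_aPos]
  · rintro ⟨k, l⟩ hne
    dsimp only
    split_ifs with h
    · have : 0 < k := by
        refine Nat.pos_of_ne_zero ?_
        rintro rfl
        exact hne (by simp at h; simp [h])
      simp only [zero_smul]
      rw [expCoeff_const_zero this]
      simp
    · rfl

lemma vertexMode_zero_right (b : ℕ+ → L) (n : ℕ) : vertexMode b (fun _ => 0) (-(n : ℤ)) =
    opMatrix (expCoeff L (fun j => b j • aNeg L j) n) := by
  funext o i
  rw [vertexMode, finsum_eq_single _ (n, 0)]
  · simp [expCoeff_zero, opMatrix]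
  · rintro ⟨k, l⟩ hne
    dsimp only
    split_ifs with h
    · have : 0 < l := by
        refine Nat.pos_of_ne_zero ?_
        rintro rfl
        exact hne (by simp at h; simp [h])
      simp only [zero_smul]
      rw [expCoeff_const_zero this]
      simp
    · rfl

end Modes

/-! ### The components of the intertwining operators are vertex operators -/

section Components

open Finset MvPolynomial

variable {L : Type*} [Field L]

lemma finsum_prod_eq_left {I J M : Type*} [AddCommMonoid M] (j : J) (g : I × J → M)
    (h : ∀ x, x.2 ≠ j → g x = 0) : ∑ᶠ x, g x = ∑ᶠ i, g (i, j) := by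
  have hinj : Function.Injective fun i : I => (i, j) := fun a b h => (Prod.ext_iff.mp h).1
  classical
  rw [← finsum_mem_range (f := g) hinj]
  refine finsum_congr fun x => ?_
  by_cases hx : x ∈ Set.range fun i : I => (i, j)
  · rw [finsum_eq_if, if_pos hx]
  · rw [finsum_eq_if, if_neg hx]
    refine h x fun h' => hx ⟨x.1, ?_⟩
    exact Prod.ext rfl h'.symm

lemma finsum_prod_eq_right {I J M : Type*} [AddCommMonoid M] (i : I) (g : I × J → M)
    (h : ∀ x, x.1 ≠ i → g x = 0) : ∑ᶠ x, g x = ∑ᶠ j, g (i, j) := by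
  rw [← finsum_comp_equiv (Equiv.prodComm J I)]
  exact finsum_prod_eq_left i (fun x : J × I => g x.swap) fun x hx => h _ hx

/-- The relation of `Φ` with a current which acts on the vertical module by the eigenvalues
`eig`. -/
lemma slice_left {f : ℕ → Module.End L (MvPolynomial ℕ+ L)}
    {T : FockIdx → YoungDiagram × FockIdx → L}
    {n : ℕ} {g g' : L} {eig : ℕ → YoungDiagram → L} {Bm : FockIdx → FockIdx → L}
    {Am : YoungDiagram × FockIdx → YoungDiagram × FockIdx → L}
    (hB : ∀ o i, Bm o i = g * opMatrix (f n) o i)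
    (hA : ∀ o i, Am o i = ∑ k ∈ antidiagonal n, kron L o.1 i.1 * eig k.1 i.1 *
      (g' * opMatrix (f k.2) o.2 i.2))
    (h : matMul Bm T = matMul T Am) (la : YoungDiagram) :
    g • matMul (opMatrix (f n)) (fun o i => T o (la, i)) =
      ∑ x ∈ antidiagonal n, (eig x.1 la * g') •
        matMul (fun o i => T o (la, i)) (opMatrix (f x.2)) := by
  funext o i
  have h1 := congrFun (congrFun h o) (la, i)
  simp only [matMul, hB, hA] at h1
  rw [finsum_prod_eq_right la _ fun x hx => by simp [kron, hx]] at h1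
  simp only [Pi.smul_apply, Finset.sum_apply, smul_eq_mul, matMul]
  rw [mul_finsum]
  simp only [← mul_assoc] at h1 ⊢
  rw [h1]
  simp_rw [mul_finsum]
  rw [← finsum_sum_comm]
  · refine finsum_congr fun m => ?_
    rw [mul_sum]
    refine sum_congr rfl fun x _ => ?_
    simp [kron]
    ring
  · intro x _
    refine (finite_support_right (f x.2) (fun o i => T o (la, i)) o i).subset fun m hm h' => hm ?_
    simp only at h' ⊢
    rw [h', mul_zero]

/-- The relation of `Φ*` with a current which acts on the vertical module by the eigenvalues
`eig`. -/
lemma slice_right {f : ℕ → Module.End L (MvPolynomial ℕ+ L)} (hf : ∀ n, RowFinite (f n))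
    {T : FockIdx × YoungDiagram → FockIdx → L}
    {n : ℕ} {g g' : L} {eig : ℕ → YoungDiagram → L} {Am : FockIdx → FockIdx → L}
    {Bm : FockIdx × YoungDiagram → FockIdx × YoungDiagram → L}
    (hA : ∀ o i, Am o i = g * opMatrix (f n) o i)
    (hB : ∀ o i, Bm o i = ∑ k ∈ antidiagonal n, kron L o.2 i.2 * eig k.1 i.2 *
      (g' * opMatrix (f k.2) o.1 i.1))
    (h : matMul Bm T = matMul T Am) (la : YoungDiagram) :
    g • matMul (fun o i => T (o, la) i) (opMatrix (f n)) =
      ∑ x ∈ antidiagonal n, (eig x.1 la * g') •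
        matMul (opMatrix (f x.2)) (fun o i => T (o, la) i) := by
  funext o i
  have h1 := congrFun (congrFun h (o, la)) i
  simp only [matMul, hB, hA] at h1
  rw [finsum_prod_eq_left la _ fun x hx => by simp [kron, Ne.symm hx]] at h1
  simp only [Pi.smul_apply, Finset.sum_apply, smul_eq_mul, matMul]
  rw [mul_finsum]
  have h2 : ∀ m, g * (T (o, la) m * opMatrix (f n) m i) =
      T (o, la) m * (g * opMatrix (f n) m i) := fun m => by ring
  simp_rw [h2]
  rw [← h1]
  simp_rw [mul_finsum]
  rw [← finsum_sum_comm]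
  · refine finsum_congr fun m => ?_
    rw [sum_mul]
    refine sum_congr rfl fun x _ => ?_
    simp [kron]
    ring
  · intro x _
    refine (finite_support_left (hf x.2) (fun o i => T (o, la) i) o i).subset fun m hm h' => hm ?_
    simp only at h' ⊢
    rw [h', mul_zero]

variable [Algebra BaseField L]

lemma one_sub_qq_div_tt_pow (n : ℕ) : 1 - (qq L / tt L) ^ n =
    -((qq L / tt L) ^ n * (1 - (tt L / qq L) ^ n)) := by
  have hq := qq_ne_zero L
  have ht := tt_ne_zero L
  rw [mul_sub, ← mul_pow]
  field_simp
  simp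

variable [CharZero L]

/-- The coefficients of the annihilators in `φ⁺(z)`, in terms of `∂/∂pₙ`. -/
def phiPlusDer (L : Type*) [Field L] [Algebra BaseField L] (n : ℕ+) : L :=
  -((1 - tt L ^ (n : ℕ)) / ((n : ℕ) : L) * (1 - (tt L / qq L) ^ (n : ℕ)) *
      qtQuarter L ^ (n : ℕ)) * heisNorm L n

/-- The coefficients of the creators in `φ⁻(z)`. -/
def phiMinusCre (L : Type*) [Field L] [Algebra BaseField L] (n : ℕ+) : L :=
  (1 - (tt L)⁻¹ ^ (n : ℕ)) / ((n : ℕ) : L) * (1 - (tt L / qq L) ^ (n : ℕ)) *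
      qtQuarter L ^ (n : ℕ)

lemma phiPlusDer_eq (n : ℕ+) : phiPlusDer L n =
    -((1 - qq L ^ (n : ℕ)) * (1 - (tt L / qq L) ^ (n : ℕ)) * qtQuarter L ^ (n : ℕ)) := by
  have h1 := one_sub_tt_pow_ne_zero L n.pos
  have h2 : ((n : ℕ) : L) ≠ 0 := Nat.cast_ne_zero.mpr n.ne_zero
  rw [phiPlusDer, heisNorm]
  field_simp

lemma phiPlusMode_eq (n : ℕ) : phiPlusMode (L := L) (n : ℤ) =
    opMatrix (expCoeff L (fun j => phiPlusDer L j • dOp L j) n) := by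
  rw [phiPlusMode, vertexMode_zero_left]
  rfl

lemma phiMinusMode_eq (n : ℕ) : phiMinusMode (L := L) (-(n : ℤ)) =
    opMatrix (expCoeff L (fun j => phiMinusCre L j • aNeg L j) n) := by
  rw [phiMinusMode, vertexMode_zero_right]
  rfl

/-- The coefficients of the creators in the component `Φ_λ` of `Φ`. -/
def phiB (v : L) (la : YoungDiagram) (n : ℕ+) : L :=
  -(v ^ (n : ℕ) / ((n : ℕ) * (1 - qq L ^ (n : ℕ)))) * rowChar (qq L) (tt L) la n

/-- The coefficients of the annihilators in the component `Φ_λ` of `Φ`. -/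
def phiC (v : L) (la : YoungDiagram) (n : ℕ+) : L :=
  (qq L / tt L) ^ (n : ℕ) / (1 - (tt L)⁻¹ ^ (n : ℕ)) * v⁻¹ ^ (n : ℕ) *
    rowChar (qq L)⁻¹ (tt L)⁻¹ la n

/-- The coefficients of the creators in the component `Φ*_λ` of `Φ*`. -/
def starB (u : L) (la : YoungDiagram) (n : ℕ+) : L :=
  ((qtHalf L)⁻¹ * u) ^ (n : ℕ) / ((n : ℕ) * (1 - qq L ^ (n : ℕ))) * rowChar (qq L) (tt L) la n

/-- The coefficients of the annihilators in the component `Φ*_λ` of `Φ*`. -/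
def starC (u : L) (la : YoungDiagram) (n : ℕ+) : L :=
  -((qtHalf L * u⁻¹) ^ (n : ℕ) / (1 - (tt L)⁻¹ ^ (n : ℕ))) * rowChar (qq L)⁻¹ (tt L)⁻¹ la n

/-- The relations with `ψ⁺(z)` and `ψ⁻(z)` shift the annihilators and the creators past `Φ_λ` by
constants, because `P_λ` is an eigenvector of `ψ^±(z)`. This determines `Φ_λ` up to its vacuum
entry. -/
theorem IsPhi.isVertexOp {N : ℤ} {v u w : L} {T : FockIdx → YoungDiagram × FockIdx → L}
    (h : IsPhi N v u w T) (la : YoungDiagram) :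
    IsVertexOp (phiB v la) (phiC v la) (T 0 (la, 0)) (fun o i => T o (la, i)) := by
  obtain ⟨⟨-, -, -, hp, hm⟩, -⟩ := h
  have hp0 := qtHalf_ne_zero L
  have hp4 := qtQuarter_ne_zero L
  -- the relation with `ψ⁺(z)`
  have h1 : ∀ n, matMul (opMatrix (expCoeff L (fun j => phiPlusDer L j • dOp L j) n))
      (fun o i => T o (la, i)) = ∑ x ∈ antidiagonal n,
        (PowerSeries.coeff x.1 (Bplus la : PowerSeries L) * (qtQuarter L * v) ^ x.1) •
        matMul (fun o i => T o (la, i))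
          (opMatrix (expCoeff L (fun j => phiPlusDer L j • dOp L j) x.2)) := by
    intro n
    have := slice_left (f := expCoeff L fun j => phiPlusDer L j • dOp L j)
      (n := n) (g := qtHalf L ^ (N + 1)) (g' := qtHalf L ^ N)
      (eig := fun k la => qtHalf L * PowerSeries.coeff k (Bplus la : PowerSeries L) *
        (qtQuarter L * v) ^ k)
      (fun o i => by simp only [horizontal, phiPlusMode_eq])
      (fun o i => by
        simp only [tensor, horizontal, vertical, phiPlusMode_eq]
        refine sum_congr rfl fun k _ => ?_
        rw [one_zpow, inv_zpow, zpow_neg, inv_inv, zpow_natCast, mul_pow]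
        ring) (hp n) la
    rw [← inv_smul_smul₀ (zpow_ne_zero (N + 1) hp0) (matMul _ _), this, smul_sum]
    refine sum_congr rfl fun x _ => ?_
    rw [smul_smul]
    congr 1
    rw [zpow_add_one₀ hp0]
    field_simp
  -- the relation with `ψ⁻(z)`
  have h2 : ∀ n, matMul (opMatrix (expCoeff L (fun j => phiMinusCre L j • aNeg L j) n))
      (fun o i => T o (la, i)) = ∑ x ∈ antidiagonal n,
        (PowerSeries.coeff x.1 (Bminus la : PowerSeries L) * (qtQuarter L * v⁻¹) ^ x.1) •
        matMul (fun o i => T o (la, i))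
          (opMatrix (expCoeff L (fun j => phiMinusCre L j • aNeg L j) x.2)) := by
    intro n
    have := slice_left (f := expCoeff L fun j => phiMinusCre L j • aNeg L j)
      (n := n) (g := qtHalf L ^ (-(N + 1))) (g' := qtHalf L ^ (-N))
      (eig := fun k la => (qtHalf L)⁻¹ * PowerSeries.coeff k (Bminus la : PowerSeries L) *
        (qtQuarter L * v⁻¹) ^ k)
      (fun o i => by simp only [horizontal, phiMinusMode_eq])
      (fun o i => by
        simp only [tensor, horizontal, vertical, phiMinusMode_eq]
        refine sum_congr rfl fun k _ => ?_
        rw [one_zpow, inv_zpow, zpow_neg, inv_inv, zpow_natCast, mul_pow]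
        ring) (hm n) la
    rw [← inv_smul_smul₀ (zpow_ne_zero (-(N + 1)) hp0) (matMul _ _), this, smul_sum]
    refine sum_congr rfl fun x _ => ?_
    rw [smul_smul]
    congr 1
    rw [zpow_neg, zpow_neg, zpow_add_one₀ hp0]
    field_simp
  rw [Bplus_eq_expSeries] at h1
  rw [Bminus_eq_expSeries] at h2
  have s1 := shift_of_intertwining (commute_smul_dOp (phiPlusDer L))
    (fun n => (isLeftMul_dOp n).smul (phiPlusDer L n))
    (fun n => (isRightMul_dOp n).smul (phiPlusDer L n))
    (fun m n => commute_smul (commute_lAnn_rAnn m n) _ _)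
    (fun m n => commute_smul (commute_rAnn_rAnn m n) _ _) _ _ _ h1
  have s2 := shift_of_intertwining (commute_smul_aNeg (phiMinusCre L))
    (fun n => (isLeftMul_aNeg n).smul (phiMinusCre L n))
    (fun n => (isRightMul_aNeg n).smul (phiMinusCre L n))
    (fun m n => commute_smul (commute_lCre_rCre m n) _ _)
    (fun m n => commute_smul (commute_rCre_rCre m n) _ _) _ _ _ h2
  refine ⟨rfl, fun i n => ?_, fun o i n => ?_⟩
  · have := congrFun (congrFun (s2 n) 0) i
    simp only [lCre, rCre, LinearMap.smul_apply, Pi.smul_apply, Pi.add_apply, LinearMap.coe_mk,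
      AddHom.coe_mk, Finsupp.coe_zero, Pi.zero_apply, if_true, mul_zero, smul_eq_mul] at this
    have e1 := one_sub_tt_inv_pow_ne_zero L n.pos
    have e2 := one_sub_tt_div_qq_pow_ne_zero L n.pos
    have e3 : qtQuarter L ^ (n : ℕ) ≠ 0 := pow_ne_zero _ hp4
    have e4 : ((n : ℕ) : L) ≠ 0 := Nat.cast_ne_zero.mpr n.ne_zero
    have hne : phiMinusCre L n ≠ 0 := by
      rw [phiMinusCre]
      positivity
    refine mul_left_cancel₀ hne ?_
    rw [eq_neg_of_add_eq_zero_left this.symm, one_sub_qq_div_tt_pow, phiMinusCre, phiC, mul_pow]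
    generalize (qq L / tt L) ^ (n : ℕ) = a at *
    generalize (tt L / qq L) ^ (n : ℕ) = b at *
    generalize (tt L)⁻¹ ^ (n : ℕ) = d at *
    field_simp
  · have := congrFun (congrFun (s1 n) o) i
    simp only [lAnn, rAnn, LinearMap.smul_apply, Pi.smul_apply, Pi.add_apply, LinearMap.coe_mk,
      AddHom.coe_mk, smul_eq_mul] at this
    have e1 := one_sub_qq_pow_ne_zero L n.pos
    have e2 := one_sub_tt_div_qq_pow_ne_zero L n.pos
    have e3 : qtQuarter L ^ (n : ℕ) ≠ 0 := pow_ne_zero _ hp4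
    have e4 : ((n : ℕ) : L) ≠ 0 := Nat.cast_ne_zero.mpr n.ne_zero
    have hne : phiPlusDer L n ≠ 0 := by
      rw [phiPlusDer_eq]
      exact neg_ne_zero.mpr (mul_ne_zero (mul_ne_zero e1 e2) e3)
    refine mul_left_cancel₀ hne ?_
    rw [this, mul_add, phiPlusDer_eq, phiB, mul_pow]
    set b := (tt L / qq L) ^ (n : ℕ)
    field_simp

/-- The relations with `ψ^±(z)` determine `Φ*_λ` up to its vacuum entry. -/
theorem IsPhiStar.isVertexOp {N : ℤ} {v u w : L} {T : FockIdx × YoungDiagram → FockIdx → L}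
    (h : IsPhiStar N v u w T) (la : YoungDiagram) :
    IsVertexOp (starB u la) (starC u la) (T (0, la) 0) (fun o i => T (o, la) i) := by
  obtain ⟨⟨-, -, -, hp, hm⟩, -⟩ := h
  have hp0 := qtHalf_ne_zero L
  have hp4 := qtQuarter_ne_zero L
  -- the relation with `ψ⁺(z)`
  have h1 : ∀ n, matMul (fun o i => T (o, la) i)
      (opMatrix (expCoeff L (fun j => phiPlusDer L j • dOp L j) n)) = ∑ x ∈ antidiagonal n,
        (PowerSeries.coeff x.1 (Bplus la : PowerSeries L) * ((qtQuarter L)⁻¹ * u) ^ x.1) •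
        matMul (opMatrix (expCoeff L (fun j => phiPlusDer L j • dOp L j) x.2))
          (fun o i => T (o, la) i) := by
    intro n
    have := slice_right (f := expCoeff L fun j => phiPlusDer L j • dOp L j)
      (rowFinite_expCoeff (J := Unit) (commute_smul_dOp (phiPlusDer L))
        fun n => (isLeftMul_dOp n).smul (phiPlusDer L n))
      (n := n) (g := qtHalf L ^ (N + 1)) (g' := qtHalf L ^ N)
      (eig := fun k la => qtHalf L * PowerSeries.coeff k (Bplus la : PowerSeries L) *
        ((qtQuarter L)⁻¹ * u) ^ k)
      (fun o i => by simp only [horizontal, phiPlusMode_eq])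
      (fun o i => by
        simp only [tensor, horizontal, vertical, phiPlusMode_eq]
        rw [← Nat.sum_antidiagonal_swap]
        refine sum_congr rfl fun k _ => ?_
        simp only [Prod.fst_swap, Prod.snd_swap]
        rw [one_zpow, zpow_natCast, mul_pow]
        ring) (hp n) la
    rw [← inv_smul_smul₀ (zpow_ne_zero (N + 1) hp0) (matMul _ _), this, smul_sum]
    refine sum_congr rfl fun x _ => ?_
    rw [smul_smul]
    congr 1
    rw [zpow_add_one₀ hp0]
    field_simp
  -- the relation with `ψ⁻(z)`
  have h2 : ∀ n, matMul (fun o i => T (o, la) i)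
      (opMatrix (expCoeff L (fun j => phiMinusCre L j • aNeg L j) n)) = ∑ x ∈ antidiagonal n,
        (PowerSeries.coeff x.1 (Bminus la : PowerSeries L) * ((qtQuarter L)⁻¹ * u⁻¹) ^ x.1) •
        matMul (opMatrix (expCoeff L (fun j => phiMinusCre L j • aNeg L j) x.2))
          (fun o i => T (o, la) i) := by
    intro n
    have := slice_right (f := expCoeff L fun j => phiMinusCre L j • aNeg L j)
      (rowFinite_expCoeff (J := Unit) (commute_smul_aNeg (phiMinusCre L))
        fun n => (isLeftMul_aNeg n).smul (phiMinusCre L n))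
      (n := n) (g := qtHalf L ^ (-(N + 1))) (g' := qtHalf L ^ (-N))
      (eig := fun k la => (qtHalf L)⁻¹ * PowerSeries.coeff k (Bminus la : PowerSeries L) *
        ((qtQuarter L)⁻¹ * u⁻¹) ^ k)
      (fun o i => by simp only [horizontal, phiMinusMode_eq])
      (fun o i => by
        simp only [tensor, horizontal, vertical, phiMinusMode_eq]
        rw [← Nat.sum_antidiagonal_swap]
        refine sum_congr rfl fun k _ => ?_
        simp only [Prod.fst_swap, Prod.snd_swap]
        rw [one_zpow, zpow_natCast, mul_pow]
        ring) (hm n) la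
    rw [← inv_smul_smul₀ (zpow_ne_zero (-(N + 1)) hp0) (matMul _ _), this, smul_sum]
    refine sum_congr rfl fun x _ => ?_
    rw [smul_smul]
    congr 1
    rw [zpow_neg, zpow_neg, zpow_add_one₀ hp0]
    field_simp
  rw [Bplus_eq_expSeries] at h1
  rw [Bminus_eq_expSeries] at h2
  have s1 := shift_of_intertwining' (commute_smul_dOp (phiPlusDer L))
    (fun n => (isLeftMul_dOp n).smul (phiPlusDer L n))
    (fun n => (isRightMul_dOp n).smul (phiPlusDer L n))
    (fun m n => commute_smul (commute_lAnn_rAnn m n) _ _)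
    (fun m n => commute_smul (commute_lAnn_lAnn m n) _ _) _ _ _ h1
  have s2 := shift_of_intertwining' (commute_smul_aNeg (phiMinusCre L))
    (fun n => (isLeftMul_aNeg n).smul (phiMinusCre L n))
    (fun n => (isRightMul_aNeg n).smul (phiMinusCre L n))
    (fun m n => commute_smul (commute_lCre_rCre m n) _ _)
    (fun m n => commute_smul (commute_lCre_lCre m n) _ _) _ _ _ h2
  have hqt : ∀ n : ℕ, (qq L / tt L) ^ n = (qtQuarter L ^ n) ^ 4 := fun n => by
    rw [← qtQuarter_pow_four, pow_right_comm]
  have hh : ∀ n : ℕ, qtHalf L ^ n = (qtQuarter L ^ n) ^ 2 := fun n => by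
    rw [qtHalf, pow_right_comm]
  refine ⟨rfl, fun i n => ?_, fun o i n => ?_⟩
  · have := congrFun (congrFun (s2 n) 0) i
    simp only [lCre, rCre, LinearMap.smul_apply, Pi.smul_apply, Pi.add_apply, LinearMap.coe_mk,
      AddHom.coe_mk, Finsupp.coe_zero, Pi.zero_apply, if_true, mul_zero, smul_eq_mul,
      zero_add] at this
    have e1 := one_sub_tt_inv_pow_ne_zero L n.pos
    have e2 := one_sub_tt_div_qq_pow_ne_zero L n.pos
    have e3 : qtQuarter L ^ (n : ℕ) ≠ 0 := pow_ne_zero _ hp4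
    have e4 : ((n : ℕ) : L) ≠ 0 := Nat.cast_ne_zero.mpr n.ne_zero
    have hne : phiMinusCre L n ≠ 0 := by
      rw [phiMinusCre]
      positivity
    refine mul_left_cancel₀ hne ?_
    rw [this, one_sub_qq_div_tt_pow, phiMinusCre, starC, mul_pow, mul_pow, inv_pow (qtQuarter L),
      hqt, hh]
    generalize (tt L / qq L) ^ (n : ℕ) = b at *
    generalize qtQuarter L ^ (n : ℕ) = a at *
    generalize (tt L)⁻¹ ^ (n : ℕ) = d at *
    field_simp
  · have := congrFun (congrFun (s1 n) o) i
    simp only [lAnn, rAnn, LinearMap.smul_apply, Pi.smul_apply, Pi.add_apply, LinearMap.coe_mk,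
      AddHom.coe_mk, smul_eq_mul] at this
    have e1 := one_sub_qq_pow_ne_zero L n.pos
    have e2 := one_sub_tt_div_qq_pow_ne_zero L n.pos
    have e3 : qtQuarter L ^ (n : ℕ) ≠ 0 := pow_ne_zero _ hp4
    have e4 : ((n : ℕ) : L) ≠ 0 := Nat.cast_ne_zero.mpr n.ne_zero
    have hne : phiPlusDer L n ≠ 0 := by
      rw [phiPlusDer_eq]
      exact neg_ne_zero.mpr (mul_ne_zero (mul_ne_zero e1 e2) e3)
    refine mul_left_cancel₀ hne ?_
    rw [mul_add, this, phiPlusDer_eq, starB, mul_pow, mul_pow, inv_pow, inv_pow, hh]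
    generalize (tt L / qq L) ^ (n : ℕ) = b at *
    generalize qtQuarter L ^ (n : ℕ) = a at *
    field_simp
    ring

end Components

/-! ### Young diagrams and added boxes -/

section Young

open Finset

lemma youngDiagram_ext {la mu : YoungDiagram} (h : ∀ k, la.rowLen k = mu.rowLen k) : la = mu := by
  refine YoungDiagram.ext ?_
  ext ⟨i, j⟩
  rw [YoungDiagram.mem_cells, YoungDiagram.mem_cells, YoungDiagram.mem_iff_lt_rowLen,
    YoungDiagram.mem_iff_lt_rowLen, h]

lemma rowLen_pos_iff {la : YoungDiagram} {i : ℕ} : 0 < la.rowLen i ↔ i < la.colLen 0 := by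
  rw [← YoungDiagram.mem_iff_lt_rowLen, YoungDiagram.mem_iff_lt_colLen]

lemma rowLen_eq_zero {la : YoungDiagram} {i : ℕ} (h : la.colLen 0 ≤ i) : la.rowLen i = 0 := by
  have := mt rowLen_pos_iff.mp (not_lt.mpr h)
  omega

lemma rowLen_bot (i : ℕ) : (⊥ : YoungDiagram).rowLen i = 0 := by
  by_contra h
  have : (i, 0) ∈ (⊥ : YoungDiagram) :=
    YoungDiagram.mem_iff_lt_rowLen.mpr (Nat.pos_of_ne_zero h)
  exact YoungDiagram.notMem_bot _ this

variable {la mu : YoungDiagram} {i : ℕ}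

lemma IsAddBox.unique {mu' : YoungDiagram} (h : IsAddBox la i mu) (h' : IsAddBox la i mu') :
    mu = mu' :=
  youngDiagram_ext fun k => by rw [h k, h' k]

lemma IsAddBox.rowLen_self (h : IsAddBox la i mu) : mu.rowLen i = la.rowLen i + 1 := by
  rw [h i, if_pos rfl]

lemma IsAddBox.rowLen_ne (h : IsAddBox la i mu) {k : ℕ} (hk : k ≠ i) :
    mu.rowLen k = la.rowLen k := by
  rw [h k, if_neg hk, add_zero]

lemma IsAddBox.lt_colLen (h : IsAddBox la i mu) : i < mu.colLen 0 := by
  rw [← rowLen_pos_iff, h.rowLen_self]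
  omega

lemma IsAddBox.rowLen_lt (h : IsAddBox la i mu) {k : ℕ} (hk : k < i) :
    la.rowLen i < la.rowLen k := by
  have := mu.rowLen_anti k i hk.le
  rw [h.rowLen_self, h.rowLen_ne hk.ne] at this
  omega

lemma IsAddBox.lt_colLen_add_one (h : IsAddBox la i mu) : i < la.colLen 0 + 1 := by
  rcases Nat.eq_zero_or_pos i with rfl | hi
  · omega
  · have := h.rowLen_lt (k := i - 1) (by omega)
    have := rowLen_pos_iff.mp (Nat.lt_of_le_of_lt (Nat.zero_le _) this)
    omega

lemma IsAddBox.cells_eq (h : IsAddBox la i mu) : mu.cells = insert (i, la.rowLen i) la.cells := by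
  ext ⟨a, b⟩
  simp only [YoungDiagram.mem_cells, mem_insert, YoungDiagram.mem_iff_lt_rowLen, Prod.mk.injEq]
  rw [h a]
  split_ifs with ha
  · subst ha
    omega
  · simp [ha]

lemma IsAddBox.notMem (la : YoungDiagram) (i : ℕ) : (i, la.rowLen i) ∉ la.cells := by
  simp [YoungDiagram.mem_iff_lt_rowLen]

lemma IsAddBox.card_eq (h : IsAddBox la i mu) : mu.card = la.card + 1 := by
  rw [YoungDiagram.card, h.cells_eq, card_insert_of_notMem (IsAddBox.notMem la i)]

/-- Every Young diagram is obtained by successively adding boxes to the last row or below it. -/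
theorem youngDiagram_induction {P : YoungDiagram → Prop} (bot : P ⊥)
    (add : ∀ la i mu, IsAddBox la i mu → la.rowLen (i + 1) = 0 → P la → P mu)
    (mu : YoungDiagram) : P mu := by
  induction hn : mu.card generalizing mu with
  | zero =>
    have : mu = ⊥ := YoungDiagram.ext (by simpa [YoungDiagram.card] using hn)
    rw [this]
    exact bot
  | succ n ih =>
    have hne : 0 < mu.colLen 0 := by
      rw [← rowLen_pos_iff]
      by_contra h0
      have : mu = ⊥ := youngDiagram_ext fun k => by
        have := mu.rowLen_anti 0 k (Nat.zero_le k)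
        rw [rowLen_bot]
        omega
      subst this
      simp [YoungDiagram.card] at hn
    obtain ⟨l, hl⟩ : ∃ l, mu.colLen 0 = l + 1 := ⟨mu.colLen 0 - 1, by omega⟩
    have hr : 0 < mu.rowLen l := rowLen_pos_iff.mpr (by omega)
    have hlast : mu.rowLen (l + 1) = 0 := rowLen_eq_zero (by omega)
    -- remove the last box of the last row
    let la : YoungDiagram :=
      { cells := mu.cells.erase (l, mu.rowLen l - 1)
        isLowerSet := by
          rintro ⟨a, b⟩ ⟨c, d⟩ hle hab
          simp only [coe_erase, Set.mem_sdiff, Finset.mem_coe, Set.mem_singleton_iff,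
            YoungDiagram.mem_cells] at hab ⊢
          obtain ⟨h1, h2⟩ := hab
          refine ⟨mu.up_left_mem hle.1 hle.2 h1, fun h => h2 ?_⟩
          rw [Prod.mk.injEq] at h ⊢
          obtain ⟨rfl, rfl⟩ := h
          have hc : c ≤ a := hle.1
          have hd : mu.rowLen c - 1 ≤ b := hle.2
          rw [YoungDiagram.mem_iff_lt_rowLen] at h1
          have hac : a = c := by
            by_contra hne
            have := mu.rowLen_anti (c + 1) a (by omega)
            omega
          subst hac
          exact ⟨rfl, by omega⟩ }
    have hrow : ∀ k, mu.rowLen k = la.rowLen k + if k = l then 1 else 0 := by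
      intro k
      have hmem : ∀ j, j < la.rowLen k ↔ j < mu.rowLen k ∧ ¬ (k = l ∧ j = mu.rowLen l - 1) := by
        intro j
        rw [← YoungDiagram.mem_iff_lt_rowLen, ← YoungDiagram.mem_iff_lt_rowLen]
        change (k, j) ∈ mu.cells.erase (l, mu.rowLen l - 1) ↔ _
        rw [mem_erase, YoungDiagram.mem_cells, Ne, Prod.mk.injEq, and_comm]
      split_ifs with hk
      · subst hk
        have h1 := hmem (la.rowLen k)
        have h2 := hmem (la.rowLen k - 1)
        have h3 := hmem (mu.rowLen k - 1)
        omega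
      · have h1 := hmem (la.rowLen k)
        have h2 := hmem (mu.rowLen k)
        simp [hk] at h1 h2
        omega
    have hadd : IsAddBox la l mu := hrow
    refine add la l mu hadd ?_ (ih la ?_)
    · have := hadd.rowLen_ne (k := l + 1) (by omega)
      omega
    · have := hadd.card_eq
      omega

end Young

/-! ### The vacuum entries of the components of the intertwining operators -/

section Residue

open Finset PowerSeries

variable {L : Type*} [Field L]

lemma coeff_inv_oneSub (c : L) (n : ℕ) : coeff n (oneSub c)⁻¹ = c ^ n := by
  have h2 : (PowerSeries.mk fun n => c ^ n) * oneSub c = 1 := by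
    ext n
    rcases n with _ | n
    · simp [oneSub]
    · simp [oneSub, mul_sub, ← mul_assoc, coeff_succ_mul_X, coeff_one, pow_succ]
  rw [← (PowerSeries.eq_inv_iff_mul_eq_one (by simp [oneSub])).mpr h2, coeff_mk]

/-- If a combination of geometric sequences has a rational generating function with
denominator `∏ (1 - χᵢ z)`, then its coefficients are the residues. -/
lemma residue_of_geom {s s' : Finset ℕ} {α χ y : ℕ → L} {C : L}
    (h : ∀ m, ∑ i ∈ s, α i * χ i ^ m =
      C * coeff m ((∏ i ∈ s, (oneSub (χ i))⁻¹) * ∏ k ∈ s', oneSub (y k)))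
    {j : ℕ} (hj : j ∈ s) (hχ : χ j ≠ 0) :
    α j * ∏ i ∈ s.erase j, (1 - χ i / χ j) = C * ∏ k ∈ s', (1 - y k / χ j) := by
  have e1 : ∑ i ∈ s, PowerSeries.C (α i) * (oneSub (χ i))⁻¹ =
      PowerSeries.C C * ((∏ i ∈ s, (oneSub (χ i))⁻¹) * ∏ k ∈ s', oneSub (y k)) := by
    ext m
    rw [map_sum, coeff_C_mul, ← h]
    exact sum_congr rfl fun i _ => by rw [coeff_C_mul, coeff_inv_oneSub]
  have inv_cancel : ∀ c : L, oneSub c * (oneSub c)⁻¹ = 1 := fun c =>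
    PowerSeries.mul_inv_cancel _ (by simp [oneSub])
  have e2 : ∑ i ∈ s, PowerSeries.C (α i) * ∏ l ∈ s.erase i, oneSub (χ l) =
      PowerSeries.C C * ∏ k ∈ s', oneSub (y k) := by
    have := congrArg (fun f => (∏ i ∈ s, oneSub (χ i)) * f) e1
    simp only [mul_sum] at this
    have hR : (∏ i ∈ s, oneSub (χ i)) *
        (PowerSeries.C C * ((∏ i ∈ s, (oneSub (χ i))⁻¹) * ∏ k ∈ s', oneSub (y k))) =
        PowerSeries.C C * ∏ k ∈ s', oneSub (y k) := by
      have : (∏ i ∈ s, oneSub (χ i)) * (∏ i ∈ s, (oneSub (χ i))⁻¹) = 1 := by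
        rw [← prod_mul_distrib]
        exact prod_eq_one fun i _ => inv_cancel _
      linear_combination (PowerSeries.C C * ∏ k ∈ s', oneSub (y k)) * this
    rw [hR] at this
    rw [← this]
    refine sum_congr rfl fun i hi => ?_
    rw [← mul_prod_erase s _ hi]
    linear_combination (-PowerSeries.C (α i) * ∏ l ∈ s.erase i, oneSub (χ l)) * inv_cancel (χ i)
  -- the identity holds between polynomials, and may be evaluated at `1 / χ j`
  let q : L → Polynomial L := fun c => 1 - Polynomial.C c * Polynomial.X
  have hq : ∀ c, ((q c : Polynomial L) : PowerSeries L) = oneSub c := fun c => by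
    simp [q, oneSub]
  have e3 : ∑ i ∈ s, Polynomial.C (α i) * ∏ l ∈ s.erase i, q (χ l) =
      Polynomial.C C * ∏ k ∈ s', q (y k) := by
    refine Polynomial.coe_injective L ?_
    rw [← Polynomial.coeToPowerSeries.ringHom_apply, ← Polynomial.coeToPowerSeries.ringHom_apply]
    simp only [map_sum, map_mul, map_prod, Polynomial.coeToPowerSeries.ringHom_apply,
      Polynomial.coe_C, hq]
    exact e2
  have e4 := congrArg (Polynomial.eval (χ j)⁻¹) e3
  have hqe : ∀ c, Polynomial.eval (χ j)⁻¹ (q c) = 1 - c / χ j := fun c => by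
    simp [q, div_eq_mul_inv]
  simp only [Polynomial.eval_finsetSum, Polynomial.eval_mul, Polynomial.eval_C,
    Polynomial.eval_prod, hqe] at e4
  rw [← e4, sum_eq_single j]
  · intro i hi hij
    rw [prod_eq_zero (mem_erase.mpr ⟨hij.symm, hj⟩), mul_zero]
    rw [div_self hχ, sub_self]
  · exact fun h => absurd hj h

end Residue

section VacuumRecursion

open Finset MvPolynomial

variable {L : Type*} [Field L]

lemma rowVar_inv (q t : L) (la : YoungDiagram) (i : ℕ) :
    rowVar q⁻¹ t⁻¹ la i = (rowVar q t la i)⁻¹ := by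
  simp [rowVar, mul_comm]

lemma finsum_sum_isAddBox (la : YoungDiagram) (s : Finset ℕ) (F : ℕ → YoungDiagram → L)
    (hF : ∀ i mu, ¬ IsAddBox la i mu → F i mu = 0) :
    ∑ᶠ mu, ∑ i ∈ s, F i mu = ∑ i ∈ s, ∑ᶠ mu, F i mu := by
  refine finsum_sum_comm _ _ fun i _ => ?_
  refine Set.Subsingleton.finite fun mu hmu mu' hmu' => ?_
  have h1 : IsAddBox la i mu := not_not.mp fun h => hmu (hF i mu h)
  have h2 : IsAddBox la i mu' := not_not.mp fun h => hmu' (hF i mu' h)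
  exact h1.unique h2

variable [Algebra BaseField L]

lemma rowVar_ne_zero (la : YoungDiagram) (i : ℕ) : rowVar (qq L) (tt L) la i ≠ 0 :=
  mul_ne_zero (pow_ne_zero _ (qq_ne_zero L)) (pow_ne_zero _ (inv_ne_zero (tt_ne_zero L)))

lemma rowVar_eq_zpow (la : YoungDiagram) (i : ℕ) :
    rowVar (qq L) (tt L) la i = qq L ^ (la.rowLen i : ℤ) * tt L ^ (-(i : ℤ)) := by
  simp [rowVar]

end VacuumRecursion

section VacuumRecursion

open Finset MvPolynomial

variable {L : Type*} [Field L] [CharZero L]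

/-- The exponential of annihilators acts on the image of the vacuum, which is a coherent state, by
the contraction with the creators of the vertex operator. -/
lemma IsVertexOp.matMul_ann {b c : ℕ+ → L} {τ : L} {T : FockIdx → FockIdx → L}
    (h : IsVertexOp b c τ T) (a : ℕ+ → L) (n : ℕ) (o : FockIdx) :
    matMul (opMatrix (expCoeff L (fun j => a j • dOp L j) n)) T o 0 =
      expCoeff L (fun j => a j * b j) n * T o 0 := by
  induction n using Nat.strong_induction_on generalizing o with
  | _ n ih =>
    rcases Nat.eq_zero_or_pos n with rfl | hn
    · rw [expCoeff_zero, expCoeff_zero, opMatrix_one, matMul_kron_left, one_mul]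
    have hn' : (n : L) ≠ 0 := Nat.cast_ne_zero.mpr hn.ne'
    refine mul_left_cancel₀ hn' ?_
    have h1 := congrFun (congrFun (matMul_expCoeff_left_recursion (commute_smul_dOp a)
      (fun n => (isLeftMul_dOp n).smul (a n)) T n) o) 0
    have h2 := expCoeff_recursion (L := L) (b := fun j => a j * b j)
      (fun _ _ => Commute.all _ _) n
    simp only [Pi.smul_apply, Finset.sum_apply, smul_eq_mul] at h1 h2
    rw [h1, ← mul_assoc, h2, sum_mul]
    refine sum_congr rfl fun x hx => ?_
    rcases Nat.eq_zero_or_pos x.1 with h0 | h0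
    · simp [h0]
    obtain ⟨k, hk⟩ : ∃ k : ℕ+, (k : ℕ) = x.1 := ⟨⟨x.1, h0⟩, rfl⟩
    rw [← hk, coeff_currentSeries_pnat, coeff_currentSeries_pnat]
    simp only [LinearMap.smul_apply, Pi.smul_apply, lAnn, LinearMap.coe_mk, AddHom.coe_mk,
      smul_eq_mul]
    rw [ih x.2 (by have := mem_antidiagonal.mp hx; omega)]
    have := h.col o 0 k
    simp only [Finsupp.coe_zero, Pi.zero_apply, Nat.cast_zero, zero_mul, zero_add] at this
    linear_combination ((k : ℕ) : L) * a k * expCoeff L (fun j => a j * b j) x.2 * this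

/-- The dual of `IsVertexOp.matMul_ann`, for the dual vacuum. -/
lemma IsVertexOp.matMul_cre {b c : ℕ+ → L} {τ : L} {T : FockIdx → FockIdx → L}
    (h : IsVertexOp b c τ T) (a : ℕ+ → L) (n : ℕ) (i : FockIdx) :
    matMul T (opMatrix (expCoeff L (fun j => a j • aNeg L j) n)) 0 i =
      expCoeff L (fun j => a j * c j) n * T 0 i := by
  induction n using Nat.strong_induction_on generalizing i with
  | _ n ih =>
    rcases Nat.eq_zero_or_pos n with rfl | hn
    · rw [expCoeff_zero, expCoeff_zero, opMatrix_one, matMul_kron_right, one_mul]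
    have hn' : (n : L) ≠ 0 := Nat.cast_ne_zero.mpr hn.ne'
    refine mul_left_cancel₀ hn' ?_
    have h1 := congrFun (congrFun (matMul_expCoeff_right_recursion (commute_smul_aNeg a)
      (fun n => (isRightMul_aNeg n).smul (a n)) T n) 0) i
    have h2 := expCoeff_recursion (L := L) (b := fun j => a j * c j)
      (fun _ _ => Commute.all _ _) n
    simp only [Pi.smul_apply, Finset.sum_apply, smul_eq_mul] at h1 h2
    rw [h1, ← mul_assoc, h2, sum_mul]
    refine sum_congr rfl fun x hx => ?_
    rcases Nat.eq_zero_or_pos x.1 with h0 | h0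
    · simp [h0]
    obtain ⟨k, hk⟩ : ∃ k : ℕ+, (k : ℕ) = x.1 := ⟨⟨x.1, h0⟩, rfl⟩
    rw [← hk, coeff_currentSeries_pnat, coeff_currentSeries_pnat]
    simp only [LinearMap.smul_apply, Pi.smul_apply, rCre, LinearMap.coe_mk, AddHom.coe_mk,
      smul_eq_mul]
    rw [ih x.2 (by have := mem_antidiagonal.mp hx; omega), h.row]
    ring

/-- The exponential of the power sums of `Y_λ`, by which `x^±(z)` contracts with the components, is
rational. After cancellation its poles are simple, and they lie at the boxes that may be added. -/
lemma expSeries_rowChar (q t v : L) (la : YoungDiagram) :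
    expSeries L (fun n => v ^ (n : ℕ) * rowChar q t la n / (n : ℕ)) =
      (∏ i ∈ range (la.colLen 0 + 1), (oneSub (rowVar q t la i * v))⁻¹) *
        ∏ k ∈ range (la.colLen 0), oneSub (t⁻¹ * rowVar q t la k * v) := by
  simp only [← expSeries_pow_div]
  simp only [← expSeries_neg_pow_div, ← expSeries_sum, ← expSeries_add]
  congr 1
  funext n
  rw [rowChar, mul_sub, sub_div, sub_eq_add_neg, sum_neg_distrib, mul_sum, mul_sum, mul_sum,
    sum_div, sum_div]
  congr 1
  · exact sum_congr rfl fun i _ => by ring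
  · exact congrArg _ (sum_congr rfl fun i _ => by ring)

variable [Algebra BaseField L]

/-- The recursion for the vacuum entries of `Φ_λ`, which comes from the relation with `x⁺(z)`
between the vacua: both sides are residues at the position of the added box. -/
theorem IsPhi.vacuum_recursion {N : ℤ} {v u w : L} {T : FockIdx → YoungDiagram × FockIdx → L}
    (h : IsPhi N v u w T) (hv : v ≠ 0) {la mu : YoungDiagram} {i : ℕ} (hadd : IsAddBox la i mu) :
    Aplus la i * (rowVar (qq L) (tt L) la i * v) ^ (N + 1) * T 0 (mu, 0) *
      ∏ l ∈ (range (la.colLen 0 + 1)).erase i,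
        (1 - rowVar (qq L) (tt L) la l / rowVar (qq L) (tt L) la i) =
    w * qtHalf L ^ (-(N + 1)) * T 0 (la, 0) * ∏ k ∈ range (la.colLen 0),
        (1 - (tt L)⁻¹ * (rowVar (qq L) (tt L) la k / rowVar (qq L) (tt L) la i)) := by
  classical
  set x := rowVar (qq L) (tt L) la with hx
  have hχ : ∀ i, x i * v ≠ 0 := fun i => mul_ne_zero (rowVar_ne_zero la i) hv
  have hV := h.isVertexOp la
  let α : ℕ → L := fun i => ∑ᶠ mu, if IsAddBox la i mu then Aplus la i * T 0 (mu, 0) else 0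
  have key : ∀ m : ℕ, ∑ i ∈ range (la.colLen 0 + 1), (α i * (x i * v) ^ (N + 1)) * (x i * v) ^ m =
      (w * qtHalf L ^ (-(N + 1)) * T 0 (la, 0)) * PowerSeries.coeff m
        ((∏ i ∈ range (la.colLen 0 + 1), (oneSub (x i * v))⁻¹) *
          ∏ k ∈ range (la.colLen 0), oneSub ((tt L)⁻¹ * x k * v)) := by
    intro m
    have hrel := congrFun (congrFun (h.1.2.1 (N + 1 + m)) 0) (la, 0)
    have hl : matMul ((horizontal (N + 1) w).xp (N + 1 + m)) T 0 (la, 0) =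
        w * qtHalf L ^ (-(N + 1)) * (PowerSeries.coeff m
          ((∏ i ∈ range (la.colLen 0 + 1), (oneSub (x i * v))⁻¹) *
          ∏ k ∈ range (la.colLen 0), oneSub ((tt L)⁻¹ * x k * v)) * T 0 (la, 0)) := by
      have h1 := hV.matMul_ann
        (fun n => -((1 - tt L ^ (n : ℕ)) / ((n : ℕ) : L)) * heisNorm L n) m 0
      have h2 : (fun n : ℕ+ => -((1 - tt L ^ (n : ℕ)) / ((n : ℕ) : L)) * heisNorm L n *
          phiB v la n) = fun n : ℕ+ => v ^ (n : ℕ) * rowChar (qq L) (tt L) la n / (n : ℕ) := by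
        funext n
        have e1 := one_sub_qq_pow_ne_zero L n.pos
        have e2 := one_sub_tt_pow_ne_zero L n.pos
        have e4 : ((n : ℕ) : L) ≠ 0 := Nat.cast_ne_zero.mpr n.ne_zero
        rw [heisNorm, phiB]
        field_simp
      rw [h2] at h1
      rw [← expSeries_rowChar, expSeries, PowerSeries.coeff_mk, ← h1, matMul, matMul, mul_finsum]
      refine finsum_congr fun j => ?_
      simp only [horizontal]
      rw [add_sub_cancel_left, etaMode, vertexMode_zero_row]
      ring
    have hr : matMul T ((tensor (vertical v) (horizontal N u)).xp (N + 1 + m)) 0 (la, 0) =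
        ∑ i ∈ range (la.colLen 0 + 1), (α i * (x i * v) ^ (N + 1)) * (x i * v) ^ m := by
      have hcol : ∀ (k : ℕ) (o : FockIdx), (horizontal N u).xp (N + 1 + m + k) o 0 = 0 := by
        intro k o
        simp only [horizontal]
        rw [etaMode, vertexMode_zero_col_pos _ _ (by omega), mul_zero]
      simp only [matMul, tensor, hcol, mul_zero, finsum_zero, add_zero]
      rw [finsum_prod_eq_left (0 : FockIdx) _ fun y hy => by simp [kron, hy]]
      have hkr : kron L (0 : FockIdx) 0 = 1 := by simp [kron]
      simp only [hkr, mul_one, vertical, mul_sum]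
      rw [finsum_sum_isAddBox la _ _ fun i mu hn => by rw [if_neg hn, mul_zero]]
      refine sum_congr rfl fun i _ => ?_
      rw [mul_assoc (α i), ← zpow_natCast (x i * v) m, ← zpow_add₀ (hχ i), finsum_mul]
      refine finsum_congr fun mu => ?_
      rw [hx, rowVar_eq_zpow]
      split_ifs <;> simp
      ring
    rw [← hr, ← hrel, hl]
    ring
  have hres := residue_of_geom key (mem_range.mpr hadd.lt_colLen_add_one) (hχ i)
  have hα : α i = Aplus la i * T 0 (mu, 0) := by
    simp only [α]
    rw [finsum_eq_single _ mu fun mu' hne => if_neg fun h' => hne (h'.unique hadd), if_pos hadd]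
  rw [hα] at hres
  have hd : ∀ a, a * v / (x i * v) = a / x i := fun a => mul_div_mul_right _ _ hv
  simp only [hd, mul_div_assoc] at hres
  rw [← hres]
  ring

/-- The recursion for the vacuum entries of `Φ*_λ`, which comes from the relation with `x⁻(z)`
between the vacua. -/
theorem IsPhiStar.vacuum_recursion {N : ℤ} {v u w : L} {T : FockIdx × YoungDiagram → FockIdx → L}
    (h : IsPhiStar N v u w T) (hu : u ≠ 0) {la mu : YoungDiagram} {i : ℕ}
    (hadd : IsAddBox la i mu) :
    qtHalf L * Aminus mu i * (rowVar (qq L) (tt L) la i * u) ^ (-(N + 1)) * T (0, mu) 0 *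
      ∏ l ∈ (range (la.colLen 0 + 1)).erase i,
        (1 - rowVar (qq L) (tt L) la i / rowVar (qq L) (tt L) la l) =
    w⁻¹ * qtHalf L ^ (N + 1) * T (0, la) 0 * ∏ k ∈ range (la.colLen 0),
        (1 - tt L * (rowVar (qq L) (tt L) la i / rowVar (qq L) (tt L) la k)) := by
  classical
  set x := rowVar (qq L) (tt L) la with hx
  have hx' : ∀ i, rowVar (qq L)⁻¹ (tt L)⁻¹ la i = (x i)⁻¹ := rowVar_inv _ _ la
  have hx0 : ∀ i, x i ≠ 0 := rowVar_ne_zero la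
  have hχ : ∀ i, x i * u ≠ 0 := fun i => mul_ne_zero (hx0 i) hu
  have hV := h.isVertexOp la
  let α : ℕ → L := fun i =>
    ∑ᶠ mu, if IsAddBox la i mu then qtHalf L * Aminus mu i * T (0, mu) 0 else 0
  have key : ∀ m : ℕ, ∑ i ∈ range (la.colLen 0 + 1),
      (α i * (x i * u) ^ (-(N + 1))) * ((x i)⁻¹ * u⁻¹) ^ m =
      (w⁻¹ * qtHalf L ^ (N + 1) * T (0, la) 0) * PowerSeries.coeff m
        ((∏ i ∈ range (la.colLen 0 + 1), (oneSub ((x i)⁻¹ * u⁻¹))⁻¹) *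
          ∏ k ∈ range (la.colLen 0), oneSub (tt L * (x k)⁻¹ * u⁻¹)) := by
    intro m
    have hrel := congrFun (congrFun (h.1.2.2.1 (-(N + 1) - m)) (0, la)) 0
    have hr : matMul T ((horizontal (N + 1) w).xm (-(N + 1) - m)) (0, la) 0 =
        w⁻¹ * qtHalf L ^ (N + 1) * (PowerSeries.coeff m
          ((∏ i ∈ range (la.colLen 0 + 1), (oneSub ((x i)⁻¹ * u⁻¹))⁻¹) *
          ∏ k ∈ range (la.colLen 0), oneSub (tt L * (x k)⁻¹ * u⁻¹)) * T (0, la) 0) := by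
      have h1 := hV.matMul_cre
        (fun n => -((1 - (tt L)⁻¹ ^ (n : ℕ)) / ((n : ℕ) : L) * (qtHalf L)⁻¹ ^ (n : ℕ))) m 0
      have h2 : (fun n : ℕ+ => -((1 - (tt L)⁻¹ ^ (n : ℕ)) / ((n : ℕ) : L) *
          (qtHalf L)⁻¹ ^ (n : ℕ)) * starC u la n) =
          fun n : ℕ+ => u⁻¹ ^ (n : ℕ) * rowChar (qq L)⁻¹ (tt L)⁻¹ la n / (n : ℕ) := by
        funext n
        have e2 := one_sub_tt_inv_pow_ne_zero L n.pos
        have e4 : ((n : ℕ) : L) ≠ 0 := Nat.cast_ne_zero.mpr n.ne_zero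
        have e5 : qtHalf L ^ (n : ℕ) ≠ 0 := pow_ne_zero _ (qtHalf_ne_zero L)
        rw [starC, mul_pow, inv_pow (qtHalf L)]
        generalize (tt L)⁻¹ ^ (n : ℕ) = a at *
        generalize qtHalf L ^ (n : ℕ) = b at *
        field_simp
      rw [h2] at h1
      have h3 := expSeries_rowChar (qq L)⁻¹ (tt L)⁻¹ u⁻¹ la
      simp only [hx', inv_inv] at h3
      rw [← h3, expSeries, PowerSeries.coeff_mk, ← h1, matMul, matMul, mul_finsum]
      refine finsum_congr fun j => ?_
      simp only [horizontal]
      rw [show -(N + 1) - (m : ℤ) + (N + 1) = -(m : ℤ) by ring, xiMode, vertexMode_zero_col]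
      ring
    have hl : matMul ((tensor (horizontal N v) (vertical u)).xm (-(N + 1) - m)) T (0, la) 0 =
        ∑ i ∈ range (la.colLen 0 + 1),
          (α i * (x i * u) ^ (-(N + 1))) * ((x i)⁻¹ * u⁻¹) ^ m := by
      have hrow : ∀ (k : ℕ) (i : FockIdx),
          (horizontal N v).xm (-(N + 1) - m - k) 0 i = 0 := by
        intro k i
        simp only [horizontal]
        rw [xiMode, vertexMode_zero_row_neg _ _ (by omega), mul_zero]
      simp only [matMul, tensor, hrow, mul_zero, zero_mul, finsum_zero, zero_add]
      rw [finsum_prod_eq_right (0 : FockIdx) _ fun y hy => by simp [kron, Ne.symm hy]]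
      have hkr : kron L (0 : FockIdx) 0 = 1 := by simp [kron]
      simp only [hkr, one_mul, vertical]
      -- the removable boxes of `μ` that lead to `λ` are in the rows up to the length of `λ`
      have hrange : ∀ mu : YoungDiagram, (∑ i ∈ range (mu.colLen 0), if IsAddBox la i mu then
          (Aminus mu i : L) * (qq L ^ ((mu.rowLen i : ℤ) - 1) * tt L ^ (-(i : ℤ)) * u) ^
            (-(N + 1) - (m : ℤ)) else 0) =
          ∑ i ∈ range (la.colLen 0 + 1), if IsAddBox la i mu then
          Aminus mu i * (x i * u) ^ (-(N + 1) - (m : ℤ)) else 0 := by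
        intro mu
        rw [← sum_filter, ← sum_filter]
        refine sum_congr ?_ fun i hi => ?_
        · ext i
          simp only [mem_filter, mem_range]
          exact ⟨fun h => ⟨h.2.lt_colLen_add_one, h.2⟩, fun h => ⟨h.2.lt_colLen, h.2⟩⟩
        · have := (mem_filter.mp hi).2.rowLen_self
          rw [hx, rowVar_eq_zpow, this]
          push_cast
          rw [add_sub_cancel_right]
      simp only [hrange, mul_sum, sum_mul]
      rw [finsum_sum_isAddBox la _ _ fun i mu hn => by rw [if_neg hn, mul_zero, zero_mul]]
      refine sum_congr rfl fun i _ => ?_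
      rw [← mul_inv, ← zpow_natCast, inv_zpow, ← zpow_neg, mul_assoc (α i), ← zpow_add₀ (hχ i),
        ← sub_eq_add_neg, finsum_mul]
      refine finsum_congr fun mu => ?_
      split_ifs <;> simp
      ring
    rw [← hl, hrel, hr]
    ring
  have hres := residue_of_geom key (mem_range.mpr hadd.lt_colLen_add_one)
    (mul_ne_zero (inv_ne_zero (hx0 i)) (inv_ne_zero hu))
  have hα : α i = qtHalf L * Aminus mu i * T (0, mu) 0 := by
    simp only [α]
    rw [finsum_eq_single _ mu fun mu' hne => if_neg fun h' => hne (h'.unique hadd), if_pos hadd]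
  rw [hα] at hres
  have hd : ∀ a, a * u⁻¹ / ((x i)⁻¹ * u⁻¹) = a * x i := fun a => by
    have := hx0 i
    field_simp
  have hd' : ∀ l, (x l)⁻¹ * x i = x i / x l := fun l => by rw [div_eq_mul_inv, mul_comm]
  simp only [hd] at hres
  simp only [mul_assoc (tt L), hd'] at hres
  rw [← hres]
  ring

end VacuumRecursion

/-! ### Sums over the cells of Young diagrams -/

section Cells

open Finset

lemma prod_cells_eq {M : Type*} [CommMonoid M] (la : YoungDiagram) (f : ℕ × ℕ → M) {n : ℕ}
    (hn : la.colLen 0 ≤ n) :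
    ∏ s ∈ la.cells, f s = ∏ k ∈ range n, ∏ j ∈ range (la.rowLen k), f (k, j) := by
  rw [prod_sigma']
  refine prod_bij' (fun s _ => ⟨s.1, s.2⟩) (fun s _ => (s.1, s.2)) ?_ ?_ ?_ ?_ ?_
  · rintro ⟨i, j⟩ h
    rw [YoungDiagram.mem_cells, YoungDiagram.mem_iff_lt_rowLen] at h
    simp only [mem_sigma, mem_range]
    exact ⟨(rowLen_pos_iff.mp (by omega)).trans_le hn, h⟩
  · rintro ⟨i, j⟩ h
    simp only [mem_sigma, mem_range] at h
    rw [YoungDiagram.mem_cells, YoungDiagram.mem_iff_lt_rowLen]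
    exact h.2
  all_goals simp

lemma sum_cells_eq {M : Type*} [AddCommMonoid M] (la : YoungDiagram) (f : ℕ × ℕ → M) {n : ℕ}
    (hn : la.colLen 0 ≤ n) :
    ∑ s ∈ la.cells, f s = ∑ k ∈ range n, ∑ j ∈ range (la.rowLen k), f (k, j) :=
  prod_cells_eq (M := Multiplicative M) la f hn

/-- The cells of a row, grouped by the lengths of their columns. -/
lemma sum_row_by_colLen {M : Type*} [AddCommMonoid M] (la : YoungDiagram) (h : ℕ → ℕ → M)
    {i n : ℕ} (hin : i ≤ n) (hn : la.colLen 0 ≤ n) :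
    ∑ j ∈ range (la.rowLen i), h j (la.colLen j) =
      ∑ k ∈ Ico i n, ∑ j ∈ Ico (la.rowLen (k + 1)) (la.rowLen k), h j (k + 1) := by
  have key : ∀ n, i ≤ n → ∑ j ∈ Ico (la.rowLen n) (la.rowLen i), h j (la.colLen j) =
      ∑ k ∈ Ico i n, ∑ j ∈ Ico (la.rowLen (k + 1)) (la.rowLen k), h j (k + 1) := by
    intro n hin
    induction n, hin using Nat.le_induction with
    | base => simp
    | succ n hin ih =>
      rw [sum_Ico_succ_top hin, ← ih, ← sum_Ico_consecutive _ (la.rowLen_anti n (n + 1) (by omega))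
        (la.rowLen_anti i n hin), add_comm]
      congr 1
      refine sum_congr rfl fun j hj => ?_
      rw [mem_Ico] at hj
      congr 1
      have h1 : n < la.colLen j := by
        rw [← YoungDiagram.mem_iff_lt_colLen, YoungDiagram.mem_iff_lt_rowLen]
        exact hj.2
      have h2 : ¬ n + 1 < la.colLen j := by
        rw [← YoungDiagram.mem_iff_lt_colLen, YoungDiagram.mem_iff_lt_rowLen]
        omega
      omega
  rw [← key n hin, rowLen_eq_zero hn, range_eq_Ico]

end Cells

/-! ### The character of the pairs of partitions -/

section Character

open Finset

variable {G : Type*} [AddCommGroup G]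

lemma exists_antidifference (f : ℤ → G) : ∃ F : ℤ → G, ∀ a, F (a + 1) - F a = f a := by
  refine ⟨fun a => ∑ j ∈ Ico 0 a, f j - ∑ j ∈ Ico a 0, f j, fun a => ?_⟩
  change (∑ j ∈ Ico 0 (a + 1), f j - ∑ j ∈ Ico (a + 1) 0, f j) -
    (∑ j ∈ Ico 0 a, f j - ∑ j ∈ Ico a 0, f j) = f a
  rcases le_or_gt 0 a with h | h
  · rw [Ico_eq_empty (a := a + 1) (b := 0) (by omega), Ico_eq_empty (a := a) (b := 0) (by omega),
      ← Finset.insert_Ico_right_eq_Ico_add_one h, sum_insert (by simp)]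
    simp
  · rw [Ico_eq_empty (a := 0) (b := a + 1) (by omega), Ico_eq_empty (a := 0) (b := a) (by omega),
      ← Finset.insert_Ico_add_one_left_eq_Ico h, sum_insert (by simp)]
    simp

/-- For functions on the lattice of the weights `q^a t^b`, the value at the character of
`N_{λ,μ}` is the value at `χ_λ + q⁻¹ t χ_μ* - (1 - q⁻¹)(1 - t) χ_λ χ_μ*`, where `χ_λ` is the sum of
the contents `q^j t^{-i}`. -/
theorem sum_nek_weights (la mu : YoungDiagram) (f : ℤ → ℤ → G) :
    ∑ s ∈ la.cells, f (-(mu.rowLen s.1 : ℤ) + s.2) (-(la.colLen s.2 : ℤ) + s.1 + 1) +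
      ∑ s ∈ mu.cells, f ((la.rowLen s.1 : ℤ) - s.2 - 1) ((mu.colLen s.2 : ℤ) - s.1) =
    ∑ s ∈ la.cells, f s.2 (-s.1) + ∑ r ∈ mu.cells, f (-1 - r.2) (1 + r.1) -
      ∑ s ∈ la.cells, ∑ r ∈ mu.cells,
        (f ((s.2 : ℤ) - r.2) ((r.1 : ℤ) - s.1) - f ((s.2 : ℤ) - r.2 - 1) ((r.1 : ℤ) - s.1) -
          f ((s.2 : ℤ) - r.2) ((r.1 : ℤ) - s.1 + 1) +
          f ((s.2 : ℤ) - r.2 - 1) ((r.1 : ℤ) - s.1 + 1)) := by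
  choose F hF using fun b => exists_antidifference fun a => f a b
  have tel : ∀ (b c : ℤ) {m n : ℕ}, m ≤ n →
      ∑ j ∈ Ico m n, f (c + j) b = F b (c + n) - F b (c + m) := by
    intro b c m n hmn
    induction n, hmn using Nat.le_induction with
    | base => simp
    | succ n hmn ih =>
      rw [sum_Ico_succ_top hmn, ih, ← hF b]
      push_cast
      rw [← add_assoc]
      abel
  have tel' : ∀ (b c : ℤ) {m n : ℕ}, m ≤ n →
      ∑ j ∈ Ico m n, f (c - j - 1) b = F b (c - m) - F b (c - n) := by
    intro b c m n hmn
    induction n, hmn using Nat.le_induction with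
    | base => simp
    | succ n hmn ih =>
      rw [sum_Ico_succ_top hmn, ih, ← hF b]
      push_cast
      rw [sub_add_cancel, sub_sub]
      abel
  obtain ⟨n, hl, hm⟩ : ∃ n, la.colLen 0 ≤ n ∧ mu.colLen 0 ≤ n :=
    ⟨max (la.colLen 0) (mu.colLen 0), le_max_left _ _, le_max_right _ _⟩
  let A : ℕ → ℕ → ℤ → G := fun k i b => F b ((la.rowLen k : ℤ) - mu.rowLen i)
  have hA : ∀ k i b, A k i b = F b ((la.rowLen k : ℤ) - mu.rowLen i) := fun _ _ _ => rfl
  have hl0 : la.rowLen n = 0 := rowLen_eq_zero hl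
  have hm0 : mu.rowLen n = 0 := rowLen_eq_zero hm
  -- the two parts of the left side
  have e1 : ∑ s ∈ la.cells, f (-(mu.rowLen s.1 : ℤ) + s.2) (-(la.colLen s.2 : ℤ) + s.1 + 1) =
      ∑ i ∈ range n, (∑ k ∈ Ico i n, A k i (i - k) - ∑ k ∈ Ico (i + 1) (n + 1), A k i (i - k + 1))
      := by
    rw [sum_cells_eq la _ hl]
    refine sum_congr rfl fun i hi => ?_
    rw [mem_range] at hi
    rw [sum_row_by_colLen la (fun j c => f (-(mu.rowLen i : ℤ) + j) (-(c : ℤ) + i + 1)) hi.le hl,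
      ← sum_Ico_add' (fun k : ℕ => A k i (i - k + 1)) i n 1, ← sum_sub_distrib]
    refine sum_congr rfl fun k hk => ?_
    rw [tel _ _ (la.rowLen_anti k (k + 1) (by omega)), hA, hA]
    congr 2 <;> (push_cast; ring)
  have e2 : ∑ s ∈ mu.cells, f ((la.rowLen s.1 : ℤ) - s.2 - 1) ((mu.colLen s.2 : ℤ) - s.1) =
      ∑ k ∈ range n, (∑ i ∈ Ico (k + 1) (n + 1), A k i (i - k) - ∑ i ∈ Ico k n, A k i (i - k + 1))
      := by
    rw [sum_cells_eq mu _ hm]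
    refine sum_congr rfl fun k hk => ?_
    rw [mem_range] at hk
    rw [sum_row_by_colLen mu (fun j c => f ((la.rowLen k : ℤ) - j - 1) ((c : ℤ) - k)) hk.le hm,
      ← sum_Ico_add' (fun i : ℕ => A k i (i - k)) k n 1, ← sum_sub_distrib]
    refine sum_congr rfl fun i hi => ?_
    rw [tel' _ _ (mu.rowLen_anti i (i + 1) (by omega)), hA, hA]
    push_cast
    congr 3
    ring
  -- the parts of the right side
  have e3 : ∑ s ∈ la.cells, f s.2 (-s.1) =
      ∑ k ∈ range n, (F (-k) (la.rowLen k) - F (-k) 0) := by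
    rw [sum_cells_eq la _ hl]
    refine sum_congr rfl fun k _ => ?_
    have := tel (-k) 0 (Nat.zero_le (la.rowLen k))
    simp only [zero_add, Nat.cast_zero, ← range_eq_Ico] at this
    exact this
  have e4 : ∑ r ∈ mu.cells, f (-1 - r.2) (1 + r.1) =
      ∑ i ∈ range n, (F (1 + i) 0 - F (1 + i) (-mu.rowLen i)) := by
    rw [sum_cells_eq mu _ hm]
    refine sum_congr rfl fun i _ => ?_
    have := tel' (1 + i) 0 (Nat.zero_le (mu.rowLen i))
    simp only [zero_sub, Nat.cast_zero, sub_zero, ← range_eq_Ico] at this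
    rw [← this]
    exact sum_congr rfl fun j _ => by congr 1; ring
  have e5 : ∑ s ∈ la.cells, ∑ r ∈ mu.cells,
        (f ((s.2 : ℤ) - r.2) ((r.1 : ℤ) - s.1) - f ((s.2 : ℤ) - r.2 - 1) ((r.1 : ℤ) - s.1) -
          f ((s.2 : ℤ) - r.2) ((r.1 : ℤ) - s.1 + 1) +
          f ((s.2 : ℤ) - r.2 - 1) ((r.1 : ℤ) - s.1 + 1)) =
      ∑ k ∈ range n, ∑ i ∈ range n,
        ((F (i - k) (la.rowLen k) - F (i - k + 1) (la.rowLen k)) -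
          (F (i - k) 0 - F (i - k + 1) 0) + (F (i - k) (-mu.rowLen i) - F (i - k + 1) (-mu.rowLen i))
          - (A k i (i - k) - A k i (i - k + 1))) := by
    simp only [sum_cells_eq la _ hl, sum_cells_eq mu _ hm]
    refine sum_congr rfl fun k _ => ?_
    rw [sum_comm]
    refine sum_congr rfl fun i _ => ?_
    have h1 : ∀ j : ℕ, ∑ l ∈ range (mu.rowLen i),
        (f ((j : ℤ) - l) ((i : ℤ) - k) - f ((j : ℤ) - l - 1) ((i : ℤ) - k) -
          f ((j : ℤ) - l) ((i : ℤ) - k + 1) + f ((j : ℤ) - l - 1) ((i : ℤ) - k + 1)) =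
        f (0 + j) (i - k) - f (-mu.rowLen i + j) (i - k) - f (0 + j) (i - k + 1) +
          f (-mu.rowLen i + j) (i - k + 1) := by
      intro j
      generalize mu.rowLen i = m
      induction m with
      | zero => simp
      | succ m ih =>
        rw [sum_range_succ, ih]
        push_cast
        rw [show -((m : ℤ) + 1) + j = j - m - 1 by ring, show -(m : ℤ) + j = j - m by ring]
        abel
    simp only [h1]
    have h2 := fun b => tel b 0 (Nat.zero_le (la.rowLen k))
    have h3 := fun b => tel b (-mu.rowLen i) (Nat.zero_le (la.rowLen k))
    simp only [← range_eq_Ico] at h2 h3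
    rw [sum_add_distrib, sum_sub_distrib, sum_sub_distrib, h2, h2, h3, h3, hA, hA]
    simp only [zero_add, Nat.cast_zero, add_zero, neg_add_eq_sub]
    abel
  -- telescoping in the second coordinate
  have t1 : ∀ (k : ℕ) (a : ℤ), ∑ i ∈ range n, (F (i - k) a - F (i - k + 1) a) =
      F (-k) a - F (n - k) a := by
    intro k a
    have := sum_range_sub' (fun i : ℕ => F (i - k) a) n
    simp only [Nat.cast_zero, zero_sub] at this
    rw [← this]
    refine sum_congr rfl fun i _ => ?_
    congr 2
    push_cast
    ring
  have t2 : ∀ (i : ℕ) (a : ℤ), ∑ k ∈ range n, (F (i - k) a - F (i - k + 1) a) =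
      F (i - n + 1) a - F (1 + i) a := by
    intro i a
    have := sum_range_sub (fun k : ℕ => F (i - k + 1) a) n
    simp only [Nat.cast_zero, sub_zero] at this
    rw [add_comm (1 : ℤ), ← this]
    refine sum_congr rfl fun k _ => ?_
    congr 2
    push_cast
    ring
  have t3 : ∑ k ∈ range n, F (n - k) 0 = ∑ i ∈ range n, F (1 + i) 0 := by
    rw [← sum_range_reflect]
    refine sum_congr rfl fun i hi => ?_
    rw [mem_range] at hi
    congr 1
    omega
  rw [e1, e2, e3, e4, e5]
  have hL1 : ∑ i ∈ range n, ∑ k ∈ Ico i n, A k i (i - k) +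
      ∑ k ∈ range n, ∑ i ∈ Ico (k + 1) (n + 1), A k i (i - k) =
      ∑ k ∈ range n, ∑ i ∈ range n, A k i (i - k) + ∑ k ∈ range n, F (n - k) (la.rowLen k) := by
    have : ∑ k ∈ range n, ∑ i ∈ Ico (k + 1) (n + 1), A k i (i - k) =
        ∑ k ∈ range n, ∑ i ∈ Ico (k + 1) n, A k i (i - k) +
          ∑ k ∈ range n, F (n - k) (la.rowLen k) := by
      rw [← sum_add_distrib]
      refine sum_congr rfl fun k hk => ?_
      rw [sum_Ico_succ_top (by have := mem_range.mp hk; omega), hA k n, hm0]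
      simp
    rw [this, ← add_assoc]
    congr 1
    have hc : ∑ i ∈ range n, ∑ k ∈ Ico i n, A k i (i - k) =
        ∑ k ∈ range n, ∑ i ∈ range (k + 1), A k i (i - k) := by
      refine sum_comm' fun i k => ?_
      simp only [mem_range, mem_Ico]
      omega
    rw [hc, ← sum_add_distrib]
    refine sum_congr rfl fun k hk => ?_
    rw [range_eq_Ico, range_eq_Ico, sum_Ico_consecutive _ (Nat.zero_le _)
      (by have := mem_range.mp hk; omega)]
  have hL2 : ∑ i ∈ range n, ∑ k ∈ Ico (i + 1) (n + 1), A k i (i - k + 1) +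
      ∑ k ∈ range n, ∑ i ∈ Ico k n, A k i (i - k + 1) =
      ∑ k ∈ range n, ∑ i ∈ range n, A k i (i - k + 1) +
        ∑ i ∈ range n, F (i - n + 1) (-mu.rowLen i) := by
    have : ∑ i ∈ range n, ∑ k ∈ Ico (i + 1) (n + 1), A k i (i - k + 1) =
        ∑ i ∈ range n, ∑ k ∈ Ico (i + 1) n, A k i (i - k + 1) +
          ∑ i ∈ range n, F (i - n + 1) (-mu.rowLen i) := by
      rw [← sum_add_distrib]
      refine sum_congr rfl fun k hk => ?_
      rw [sum_Ico_succ_top (by have := mem_range.mp hk; omega), hA n k, hl0]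
      simp
    rw [this, add_right_comm]
    congr 1
    have hc : ∑ i ∈ range n, ∑ k ∈ Ico (i + 1) n, A k i (i - k + 1) =
        ∑ k ∈ range n, ∑ i ∈ range k, A k i (i - k + 1) := by
      refine sum_comm' fun i k => ?_
      simp only [mem_range, mem_Ico]
      omega
    rw [hc, ← sum_add_distrib]
    refine sum_congr rfl fun k hk => ?_
    rw [range_eq_Ico, range_eq_Ico, sum_Ico_consecutive _ (Nat.zero_le _)
      (by have := mem_range.mp hk; omega)]
  have hR : ∑ k ∈ range n, ∑ i ∈ range n,
        ((F (i - k) (la.rowLen k) - F (i - k + 1) (la.rowLen k)) -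
          (F (i - k) 0 - F (i - k + 1) 0) + (F (i - k) (-mu.rowLen i) - F (i - k + 1) (-mu.rowLen i))
          - (A k i (i - k) - A k i (i - k + 1))) =
      ∑ k ∈ range n, (F (-k) (la.rowLen k) - F (n - k) (la.rowLen k)) -
        ∑ k ∈ range n, (F (-k) 0 - F (n - k) 0) +
        ∑ i ∈ range n, (F (i - n + 1) (-mu.rowLen i) - F (1 + i) (-mu.rowLen i)) -
        (∑ k ∈ range n, ∑ i ∈ range n, A k i (i - k) -
          ∑ k ∈ range n, ∑ i ∈ range n, A k i (i - k + 1)) := by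
    simp only [← t1, ← t2]
    rw [sum_comm (s := range n) (t := range n) (f := fun i k => F ((i : ℤ) - k) (-mu.rowLen i) -
      F (i - k + 1) (-mu.rowLen i))]
    simp only [sum_sub_distrib, sum_add_distrib]
  rw [hR]
  simp only [sum_sub_distrib]
  rw [t3]
  have h1 := hL1
  have h2 := hL2
  rw [← eq_sub_iff_add_eq] at h1 h2
  rw [h1, h2]
  abel

end Character

/-! ### Contents and the characters of the vertical modules -/

section Contents

open Finset

variable {L : Type*} [Field L] [Algebra BaseField L]

/-- The content `q^j t^{-i}` of the cell `(i, j)`. -/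
def content (L : Type*) [Field L] [Algebra BaseField L] (s : ℕ × ℕ) : L :=
  qq L ^ s.2 * (tt L)⁻¹ ^ s.1

lemma content_ne_zero (s : ℕ × ℕ) : content L s ≠ 0 :=
  mul_ne_zero (pow_ne_zero _ (qq_ne_zero L)) (pow_ne_zero _ (inv_ne_zero (tt_ne_zero L)))

lemma content_eq_zpow (s : ℕ × ℕ) : content L s = qq L ^ (s.2 : ℤ) * tt L ^ (-(s.1 : ℤ)) := by
  simp [content]

/-- The sum over the rows that defines `Y_λ` is the sum `1 - (1 - q) (1 - t⁻¹) ∑ q^j t^{-i}` over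
the cells. -/
lemma rowChar_eq_sum_cells {F : Type*} [Field F] (q t : F) (la : YoungDiagram) (n : ℕ) :
    rowChar q t la n =
      1 - (1 - q ^ n) * (1 - t⁻¹ ^ n) * ∑ s ∈ la.cells, (q ^ s.2 * t⁻¹ ^ s.1) ^ n := by
  have h1 : (1 - q ^ n) * ∑ s ∈ la.cells, (q ^ s.2 * t⁻¹ ^ s.1) ^ n =
      ∑ k ∈ range (la.colLen 0), ((t⁻¹ ^ n) ^ k - rowVar q t la k ^ n) := by
    rw [sum_cells_eq la _ le_rfl, mul_sum]
    refine sum_congr rfl fun k _ => ?_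
    have := mul_neg_geom_sum (q ^ n) (la.rowLen k)
    have h2 : ∑ j ∈ range (la.rowLen k), (q ^ j * t⁻¹ ^ k) ^ n =
        (t⁻¹ ^ n) ^ k * ∑ j ∈ range (la.rowLen k), (q ^ n) ^ j := by
      rw [mul_sum]
      exact sum_congr rfl fun j _ => by ring
    rw [h2, mul_left_comm, this, rowVar]
    ring
  have h3 := mul_neg_geom_sum (t⁻¹ ^ n) (la.colLen 0)
  have h4 : rowVar q t la (la.colLen 0) ^ n = (t⁻¹ ^ n) ^ la.colLen 0 := by
    rw [rowVar, rowLen_eq_zero le_rfl]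
    ring
  rw [mul_right_comm, h1, sum_sub_distrib, rowChar, sum_range_succ, h4]
  linear_combination h3

end Contents

/-! ### The contraction of two vertex operators -/

section Contraction

open Finset PowerSeries

variable {L : Type*} [Field L] [Algebra BaseField L]

/-- `N_{λ,μ}(z)` as a power series in `z`. -/
def nekSeries (L : Type*) [Field L] [Algebra BaseField L] (la mu : YoungDiagram) : PowerSeries L :=
  (∏ s ∈ la.cells,
    oneSub (qq L ^ (-(mu.rowLen s.1 : ℤ) + s.2) * tt L ^ (-(la.colLen s.2 : ℤ) + s.1 + 1))) *
  ∏ s ∈ mu.cells,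
    oneSub (qq L ^ ((la.rowLen s.1 : ℤ) - s.2 - 1) * tt L ^ ((mu.colLen s.2 : ℤ) - s.1))

/-- The exponent `Y_λ Y_μ* / (n (1 - qⁿ)(1 - t^{-n}))` of the contraction. -/
def contr (L : Type*) [Field L] [Algebra BaseField L] (la mu : YoungDiagram) (n : ℕ+) : L :=
  rowChar (qq L) (tt L) la n * rowChar (qq L)⁻¹ (tt L)⁻¹ mu n /
    ((n : ℕ) * ((1 - qq L ^ (n : ℕ)) * (1 - (tt L)⁻¹ ^ (n : ℕ))))

lemma sum_weights_pow (la mu : YoungDiagram) (n : ℕ+) :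
    ∑ s ∈ la.cells, (qq L ^ (-(mu.rowLen s.1 : ℤ) + s.2) *
        tt L ^ (-(la.colLen s.2 : ℤ) + s.1 + 1)) ^ (n : ℕ) +
      ∑ s ∈ mu.cells, (qq L ^ ((la.rowLen s.1 : ℤ) - s.2 - 1) *
        tt L ^ ((mu.colLen s.2 : ℤ) - s.1)) ^ (n : ℕ) =
    (1 - rowChar (qq L) (tt L) la n * rowChar (qq L)⁻¹ (tt L)⁻¹ mu n) /
      ((1 - qq L ^ (n : ℕ)) * (1 - (tt L)⁻¹ ^ (n : ℕ))) := by
  have hq := qq_ne_zero L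
  have ht := tt_ne_zero L
  have e1 := one_sub_qq_pow_ne_zero L n.pos
  have e2 := one_sub_tt_inv_pow_ne_zero L n.pos
  rw [sum_nek_weights la mu fun a b => (qq L ^ a * tt L ^ b) ^ (n : ℕ), eq_div_iff (by positivity),
    rowChar_eq_sum_cells, rowChar_eq_sum_cells]
  have hX : ∑ s ∈ la.cells, (qq L ^ (s.2 : ℤ) * tt L ^ (-(s.1 : ℤ))) ^ (n : ℕ) =
      ∑ s ∈ la.cells, (qq L ^ s.2 * (tt L)⁻¹ ^ s.1) ^ (n : ℕ) :=
    sum_congr rfl fun s _ => by simp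
  have hY : ∑ r ∈ mu.cells, (qq L ^ (-1 - (r.2 : ℤ)) * tt L ^ (1 + (r.1 : ℤ))) ^ (n : ℕ) =
      (tt L / qq L) ^ (n : ℕ) *
        ∑ r ∈ mu.cells, ((qq L)⁻¹ ^ r.2 * (tt L)⁻¹⁻¹ ^ r.1) ^ (n : ℕ) := by
    rw [mul_sum]
    refine sum_congr rfl fun r _ => ?_
    rw [← mul_pow, zpow_sub₀ hq, zpow_add₀ ht]
    congr 1
    simp
    field_simp
  have hXY : ∑ s ∈ la.cells, ∑ r ∈ mu.cells,
        ((qq L ^ ((s.2 : ℤ) - r.2) * tt L ^ ((r.1 : ℤ) - s.1)) ^ (n : ℕ) -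
          (qq L ^ ((s.2 : ℤ) - r.2 - 1) * tt L ^ ((r.1 : ℤ) - s.1)) ^ (n : ℕ) -
          (qq L ^ ((s.2 : ℤ) - r.2) * tt L ^ ((r.1 : ℤ) - s.1 + 1)) ^ (n : ℕ) +
          (qq L ^ ((s.2 : ℤ) - r.2 - 1) * tt L ^ ((r.1 : ℤ) - s.1 + 1)) ^ (n : ℕ)) =
      (1 - (qq L)⁻¹ ^ (n : ℕ)) * (1 - tt L ^ (n : ℕ)) *
        ((∑ s ∈ la.cells, (qq L ^ s.2 * (tt L)⁻¹ ^ s.1) ^ (n : ℕ)) *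
        ∑ r ∈ mu.cells, ((qq L)⁻¹ ^ r.2 * (tt L)⁻¹⁻¹ ^ r.1) ^ (n : ℕ)) := by
    rw [sum_mul_sum, mul_sum]
    refine sum_congr rfl fun s _ => ?_
    rw [mul_sum]
    refine sum_congr rfl fun r _ => ?_
    rw [zpow_sub_one₀ hq, zpow_add_one₀ ht, zpow_sub₀ hq, zpow_sub₀ ht]
    simp only [zpow_natCast, inv_pow, inv_inv, mul_pow, div_pow]
    have h1 : (qq L ^ r.2) ^ (n : ℕ) ≠ 0 := pow_ne_zero _ (pow_ne_zero _ hq)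
    have h2 : (tt L ^ s.1) ^ (n : ℕ) ≠ 0 := pow_ne_zero _ (pow_ne_zero _ ht)
    have h3 : qq L ^ (n : ℕ) ≠ 0 := pow_ne_zero _ hq
    field_simp
    ring
  rw [hX, hY, hXY]
  generalize ∑ s ∈ la.cells, (qq L ^ s.2 * (tt L)⁻¹ ^ s.1) ^ (n : ℕ) = X
  generalize ∑ r ∈ mu.cells, ((qq L)⁻¹ ^ r.2 * (tt L)⁻¹⁻¹ ^ r.1) ^ (n : ℕ) = Y
  have h3 : qq L ^ (n : ℕ) ≠ 0 := pow_ne_zero _ hq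
  have h4 : tt L ^ (n : ℕ) ≠ 0 := pow_ne_zero _ ht
  simp only [inv_pow, inv_inv, div_pow]
  field_simp
  ring

variable [CharZero L]

/-- `exp(-∑ zⁿ/n · Y_λ Y_μ* / ((1 - qⁿ)(1 - t^{-n})))` is the quotient of `𝒢(z)` by `N_{λ,μ}(z)`. -/
theorem expSeries_neg_contr_mul (la mu : YoungDiagram) :
    expSeries L (fun n => -contr L la mu n) * nekSeries L la mu =
      expSeries L fun n : ℕ+ => -(1 / (((n : ℕ) : L) *
        ((1 - qq L ^ (n : ℕ)) * (1 - (tt L)⁻¹ ^ (n : ℕ))))) := by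
  simp only [nekSeries, ← expSeries_neg_pow_div, ← expSeries_sum, ← expSeries_add]
  congr 1
  funext n
  have := sum_weights_pow (L := L) la mu n
  have e1 := one_sub_qq_pow_ne_zero L n.pos
  have e2 := one_sub_tt_inv_pow_ne_zero L n.pos
  have e4 : ((n : ℕ) : L) ≠ 0 := Nat.cast_ne_zero.mpr n.ne_zero
  simp only [sum_neg_distrib, ← sum_div]
  rw [← neg_add, ← add_div, this, contr]
  field_simp
  ring

end Contraction

/-! ### Symmetry and norms -/

section Flip

open Finset

variable {L : Type*} [Field L] [Algebra BaseField L]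

lemma prod_weights (la mu : YoungDiagram) :
    (∏ s ∈ la.cells, (qq L ^ (-(mu.rowLen s.1 : ℤ) + s.2) *
        tt L ^ (-(la.colLen s.2 : ℤ) + s.1 + 1))) *
      ∏ s ∈ mu.cells, (qq L ^ ((la.rowLen s.1 : ℤ) - s.2 - 1) *
        tt L ^ ((mu.colLen s.2 : ℤ) - s.1)) =
    (∏ s ∈ la.cells, content L s) * ∏ r ∈ mu.cells, (tt L / qq L * (content L r)⁻¹) := by
  have hq := qq_ne_zero L
  have ht := tt_ne_zero L
  let a : Lˣ := Units.mk0 (qq L) hq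
  let b : Lˣ := Units.mk0 (tt L) ht
  have key := sum_nek_weights la mu fun m n => Additive.ofMul (a ^ m * b ^ n)
  have h0 : ∑ s ∈ la.cells, ∑ r ∈ mu.cells,
      (Additive.ofMul (a ^ ((s.2 : ℤ) - r.2) * b ^ ((r.1 : ℤ) - s.1)) -
        Additive.ofMul (a ^ ((s.2 : ℤ) - r.2 - 1) * b ^ ((r.1 : ℤ) - s.1)) -
        Additive.ofMul (a ^ ((s.2 : ℤ) - r.2) * b ^ ((r.1 : ℤ) - s.1 + 1)) +
        Additive.ofMul (a ^ ((s.2 : ℤ) - r.2 - 1) * b ^ ((r.1 : ℤ) - s.1 + 1))) = 0 := by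
    refine sum_eq_zero fun s _ => sum_eq_zero fun r _ => ?_
    rw [zpow_add_one]
    simp only [ofMul_mul]
    abel
  rw [h0, sub_zero, ← ofMul_prod, ← ofMul_prod, ← ofMul_prod, ← ofMul_prod, ← ofMul_mul,
    ← ofMul_mul] at key
  have := congrArg (Units.val (α := L)) (Additive.ofMul.injective key)
  simp only [Units.val_mul, Units.coe_prod, Units.val_zpow_eq_zpow_val, a, b, Units.val_mk0] at this
  rw [this]
  congr 1
  · exact prod_congr rfl fun s _ => (content_eq_zpow s).symm
  · refine prod_congr rfl fun r _ => ?_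
    rw [content_eq_zpow, zpow_sub₀ hq, zpow_add₀ ht, zpow_neg (tt L)]
    simp
    field_simp

/-- The reflection of the argument of `N_{λ,μ}`, which exchanges the two partitions. -/
theorem nekN_flip (la mu : YoungDiagram) {z : L} (hz : z ≠ 0) :
    nekN la mu z = (∏ s ∈ la.cells, (-z * content L s)) *
      (∏ r ∈ mu.cells, (-z * (tt L / qq L * (content L r)⁻¹))) *
        nekN mu la (qq L / tt L * z⁻¹) := by
  have hq := qq_ne_zero L
  have ht := tt_ne_zero L
  have hw := prod_weights (L := L) la mu
  have h1 : ∀ c d : L, c ≠ 0 → qq L / tt L * z⁻¹ * d = (z * c)⁻¹ →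
      1 - z * c = (-z * c) * (1 - qq L / tt L * z⁻¹ * d) := by
    intro c d hc hd
    rw [hd]
    field_simp
    ring
  have hA : ∏ s ∈ la.cells, (1 - z * qq L ^ (-(mu.rowLen s.1 : ℤ) + s.2) *
        tt L ^ (-(la.colLen s.2 : ℤ) + s.1 + 1)) =
      (∏ s ∈ la.cells, (-z * (qq L ^ (-(mu.rowLen s.1 : ℤ) + s.2) *
        tt L ^ (-(la.colLen s.2 : ℤ) + s.1 + 1)))) *
      ∏ s ∈ la.cells, (1 - qq L / tt L * z⁻¹ * qq L ^ ((mu.rowLen s.1 : ℤ) - s.2 - 1) *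
        tt L ^ ((la.colLen s.2 : ℤ) - s.1)) := by
    rw [← prod_mul_distrib]
    refine prod_congr rfl fun s _ => ?_
    rw [mul_assoc, h1 _ (qq L ^ ((mu.rowLen s.1 : ℤ) - s.2 - 1) *
        tt L ^ ((la.colLen s.2 : ℤ) - s.1))
      (mul_ne_zero (zpow_ne_zero _ hq) (zpow_ne_zero _ ht)), ← mul_assoc (_ * z⁻¹)]
    rw [zpow_add₀ hq, zpow_add₀ ht, zpow_add₀ ht, zpow_sub₀ hq, zpow_sub₀ hq, zpow_sub₀ ht,
      zpow_neg, zpow_neg]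
    simp only [zpow_natCast, zpow_one]
    field_simp
  have hB : ∏ s ∈ mu.cells, (1 - z * qq L ^ ((la.rowLen s.1 : ℤ) - s.2 - 1) *
        tt L ^ ((mu.colLen s.2 : ℤ) - s.1)) =
      (∏ s ∈ mu.cells, (-z * (qq L ^ ((la.rowLen s.1 : ℤ) - s.2 - 1) *
        tt L ^ ((mu.colLen s.2 : ℤ) - s.1)))) *
      ∏ s ∈ mu.cells, (1 - qq L / tt L * z⁻¹ * qq L ^ (-(la.rowLen s.1 : ℤ) + s.2) *
        tt L ^ (-(mu.colLen s.2 : ℤ) + s.1 + 1)) := by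
    rw [← prod_mul_distrib]
    refine prod_congr rfl fun s _ => ?_
    rw [mul_assoc, h1 _ (qq L ^ (-(la.rowLen s.1 : ℤ) + s.2) *
        tt L ^ (-(mu.colLen s.2 : ℤ) + s.1 + 1))
      (mul_ne_zero (zpow_ne_zero _ hq) (zpow_ne_zero _ ht)), ← mul_assoc (_ * z⁻¹)]
    rw [zpow_add₀ hq, zpow_add₀ ht, zpow_add₀ ht, zpow_sub₀ hq, zpow_sub₀ hq, zpow_sub₀ ht,
      zpow_neg, zpow_neg]
    simp only [zpow_natCast, zpow_one]
    field_simp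
  rw [nekN, hA, hB, nekN]
  simp only [prod_mul_distrib] at hw ⊢
  linear_combination (∏ s ∈ la.cells, (-z)) * (∏ s ∈ mu.cells, (-z)) *
    (∏ s ∈ la.cells, (1 - qq L / tt L * z⁻¹ * qq L ^ ((mu.rowLen s.1 : ℤ) - s.2 - 1) *
        tt L ^ ((la.colLen s.2 : ℤ) - s.1))) *
    (∏ s ∈ mu.cells, (1 - qq L / tt L * z⁻¹ * qq L ^ (-(la.rowLen s.1 : ℤ) + s.2) *
        tt L ^ (-(mu.colLen s.2 : ℤ) + s.1 + 1))) * hw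

lemma nekN_self_ne_zero (la : YoungDiagram) : nekN la la (1 : L) ≠ 0 := by
  refine mul_ne_zero (prod_ne_zero_iff.mpr fun s hs => ?_) (prod_ne_zero_iff.mpr fun s hs => ?_)
  · rw [YoungDiagram.mem_cells, ← Prod.mk.eta (p := s), YoungDiagram.mem_iff_lt_rowLen] at hs
    rw [one_mul]
    exact one_sub_zpow_ne_zero (Or.inl (by omega))
  · rw [YoungDiagram.mem_cells, ← Prod.mk.eta (p := s), YoungDiagram.mem_iff_lt_colLen] at hs
    rw [one_mul]
    exact one_sub_zpow_ne_zero (Or.inr (by omega))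

end Flip

/-! ### The product of the vacuum entries of `Φ_λ` and `Φ*_λ` -/

section Norm

open Finset

variable {L : Type*} [Field L] [Algebra BaseField L]

lemma nekN_self_eq (la : YoungDiagram) {n : ℕ} (hn : la.colLen 0 ≤ n) : nekN la la (1 : L) =
    ∏ k ∈ range n, ∏ j ∈ range (la.rowLen k),
      ((1 - qq L ^ (-(la.rowLen k : ℤ) + j) * tt L ^ (-(la.colLen j : ℤ) + k + 1)) *
        (1 - qq L ^ ((la.rowLen k : ℤ) - j - 1) * tt L ^ ((la.colLen j : ℤ) - k))) := by
  rw [nekN, ← prod_mul_distrib, prod_cells_eq la _ hn]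
  simp only [one_mul]

lemma rowVar_div (la : YoungDiagram) (i k : ℕ) :
    rowVar (qq L) (tt L) la i / rowVar (qq L) (tt L) la k =
      qq L ^ ((la.rowLen i : ℤ) - la.rowLen k) * tt L ^ ((k : ℤ) - i) := by
  rw [rowVar_eq_zpow, rowVar_eq_zpow, zpow_sub₀ (qq_ne_zero L), zpow_sub₀ (tt_ne_zero L),
    zpow_neg, zpow_neg]
  have := qq_ne_zero L
  have := tt_ne_zero L
  field_simp

/-- The change of `N_{λ,λ}(1)` when a box is added to the last row. -/
lemma nekN_self_addBox {la mu : YoungDiagram} {i : ℕ} (hadd : IsAddBox la i mu)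
    (hlast : la.rowLen (i + 1) = 0) {x : ℕ → L} (hx : x = rowVar (qq L) (tt L) la) :
    nekN mu mu 1 * ∏ k ∈ range i,
      ((1 - (tt L)⁻¹ * (x k / x i)) * (1 - qq L * (x i / x k))) =
    nekN la la 1 * ((1 - qq L ^ (-(la.rowLen i : ℤ) - 1)) * (1 - qq L ^ la.rowLen i * tt L)) *
      ∏ k ∈ range i, ((1 - qq L * (tt L)⁻¹ * (x i / x k)) * (1 - x k / x i)) := by
  have hq := qq_ne_zero L
  have ht := tt_ne_zero L
  have hl : la.colLen 0 ≤ i + 1 := by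
    by_contra h
    have := rowLen_pos_iff.mpr (not_le.mp h)
    omega
  have hm : mu.colLen 0 ≤ i + 1 := by
    by_contra h
    have := rowLen_pos_iff.mpr (not_le.mp h)
    rw [hadd.rowLen_ne (by omega)] at this
    omega
  have hcol : ∀ j k, k < mu.colLen j ↔ j < mu.rowLen k := fun j k => by
    rw [← YoungDiagram.mem_iff_lt_colLen, YoungDiagram.mem_iff_lt_rowLen]
  have hcol' : ∀ j k, k < la.colLen j ↔ j < la.rowLen k := fun j k => by
    rw [← YoungDiagram.mem_iff_lt_colLen, YoungDiagram.mem_iff_lt_rowLen]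
  have hcne : ∀ j, j ≠ la.rowLen i → mu.colLen j = la.colLen j := by
    intro j hj
    refine eq_of_forall_lt_iff fun k => ?_
    rw [hcol, hcol', hadd k]
    split_ifs with h
    · subst h
      omega
    · rfl
  have hc1 : la.colLen (la.rowLen i) = i := by
    refine eq_of_forall_lt_iff fun k => ?_
    rw [hcol']
    constructor
    · intro h
      by_contra hk
      have := la.rowLen_anti i k (by omega)
      omega
    · exact fun h => hadd.rowLen_lt h
  have hc2 : mu.colLen (la.rowLen i) = i + 1 := by
    refine eq_of_forall_lt_iff fun k => ?_
    rw [hcol, hadd k]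
    constructor
    · intro h
      by_contra hk
      have := la.rowLen_anti (i + 1) k (by omega)
      rw [if_neg (by omega)] at h
      omega
    · intro h
      rcases Nat.lt_succ_iff_lt_or_eq.mp h with h | rfl
      · have := hadd.rowLen_lt h
        omega
      · simp
  -- the rows above
  have hrow : ∀ k ∈ range i, (∏ j ∈ range (mu.rowLen k),
      ((1 - qq L ^ (-(mu.rowLen k : ℤ) + j) * tt L ^ (-(mu.colLen j : ℤ) + k + 1)) *
        (1 - qq L ^ ((mu.rowLen k : ℤ) - j - 1) * tt L ^ ((mu.colLen j : ℤ) - k)))) *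
      ((1 - (tt L)⁻¹ * (x k / x i)) * (1 - qq L * (x i / x k))) =
      (∏ j ∈ range (la.rowLen k),
      ((1 - qq L ^ (-(la.rowLen k : ℤ) + j) * tt L ^ (-(la.colLen j : ℤ) + k + 1)) *
        (1 - qq L ^ ((la.rowLen k : ℤ) - j - 1) * tt L ^ ((la.colLen j : ℤ) - k)))) *
      ((1 - qq L * (tt L)⁻¹ * (x i / x k)) * (1 - x k / x i)) := by
    intro k hk
    have hk' := mem_range.mp hk
    have hmem : la.rowLen i ∈ range (la.rowLen k) := mem_range.mpr (hadd.rowLen_lt hk')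
    rw [hadd.rowLen_ne hk'.ne, ← mul_prod_erase _ _ hmem, ← mul_prod_erase _ _ hmem]
    have hE : ∀ P Q P' D E : L, P' = P → Q * D = E → Q * P' * D = E * P := by
      rintro P Q P' D E rfl rfl
      ring
    rw [hE _ _ _ _ _ (prod_congr rfl fun j hj => by rw [hcne j (mem_erase.mp hj).1]) rfl]
    have hρ : x i / x k = qq L ^ ((la.rowLen i : ℤ) - la.rowLen k) * tt L ^ ((k : ℤ) - i) := by
      rw [hx, rowVar_div]
    have hρ0 : x i / x k ≠ 0 := by
      rw [hρ]
      exact mul_ne_zero (zpow_ne_zero _ hq) (zpow_ne_zero _ ht)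
    have hρ' : x k / x i = (x i / x k)⁻¹ := (inv_div _ _).symm
    rw [hc1, hc2, hρ']
    have f1 : qq L ^ (-(la.rowLen k : ℤ) + la.rowLen i) * tt L ^ (-((i + 1 : ℕ) : ℤ) + k + 1) =
        x i / x k := by
      rw [hρ]
      congr 2
      · ring
      · push_cast
        ring
    have f2 : qq L ^ (-(la.rowLen k : ℤ) + la.rowLen i) * tt L ^ (-(i : ℤ) + k + 1) =
        tt L * (x i / x k) := by
      rw [hρ, mul_left_comm, ← zpow_one_add₀ ht]
      congr 2
      · ring
      · ring
    have f3 : qq L ^ ((la.rowLen k : ℤ) - la.rowLen i - 1) * tt L ^ ((i : ℤ) - k) =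
        (qq L)⁻¹ * (x i / x k)⁻¹ := by
      rw [hρ, mul_inv, ← zpow_neg, ← zpow_neg, ← mul_assoc, mul_comm (qq L)⁻¹, ← zpow_sub_one₀ hq]
      congr 2
      · ring
      · ring
    have f4 : qq L ^ ((la.rowLen k : ℤ) - la.rowLen i - 1) * tt L ^ (((i + 1 : ℕ) : ℤ) - k) =
        (qq L)⁻¹ * tt L * (x i / x k)⁻¹ := by
      rw [mul_right_comm, ← f3, mul_assoc, ← zpow_add_one₀ ht]
      congr 2
      push_cast
      ring
    rw [f1, f2, f3, f4]
    generalize x i / x k = ρ at hρ0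
    generalize ∏ j ∈ (range (la.rowLen k)).erase (la.rowLen i),
      ((1 - qq L ^ (-(la.rowLen k : ℤ) + j) * tt L ^ (-(la.colLen j : ℤ) + k + 1)) *
        (1 - qq L ^ ((la.rowLen k : ℤ) - j - 1) * tt L ^ ((la.colLen j : ℤ) - k))) = R
    field_simp
    ring
  -- the row of the added box
  have hi : ∏ j ∈ range (mu.rowLen i),
      ((1 - qq L ^ (-(mu.rowLen i : ℤ) + j) * tt L ^ (-(mu.colLen j : ℤ) + i + 1)) *
        (1 - qq L ^ ((mu.rowLen i : ℤ) - j - 1) * tt L ^ ((mu.colLen j : ℤ) - i))) =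
      (∏ j ∈ range (la.rowLen i),
      ((1 - qq L ^ (-(la.rowLen i : ℤ) + j) * tt L ^ (-(la.colLen j : ℤ) + i + 1)) *
        (1 - qq L ^ ((la.rowLen i : ℤ) - j - 1) * tt L ^ ((la.colLen j : ℤ) - i)))) *
      ((1 - qq L ^ (-(la.rowLen i : ℤ) - 1)) * (1 - qq L ^ la.rowLen i * tt L)) := by
    have hcm : ∀ j, j < mu.rowLen i → mu.colLen j = i + 1 := by
      intro j hj
      have h1 := (hcol j i).mpr hj
      have h2 : ¬ i + 1 < mu.colLen j := by
        rw [hcol, hadd.rowLen_ne (by omega), hlast]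
        omega
      omega
    have hs := hadd.rowLen_self
    rw [hs, prod_range_succ']
    congr 1
    · refine prod_congr rfl fun j hj => ?_
      have hj' := mem_range.mp hj
      have : la.colLen j = i + 1 := by rw [← hcne j (by omega), hcm j (by omega)]
      rw [this, hcm (j + 1) (by omega)]
      congr 3
      · congr 1
        push_cast
        ring
      · congr 1
        push_cast
        ring
    · rw [hcm 0 (by omega)]
      have g1 : -((i + 1 : ℕ) : ℤ) + i + 1 = 0 := by push_cast; ring
      have g2 : ((i + 1 : ℕ) : ℤ) - i = 1 := by push_cast; ring
      have g3 : -((la.rowLen i + 1 : ℕ) : ℤ) + ((0 : ℕ) : ℤ) = -(la.rowLen i : ℤ) - 1 := by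
        push_cast; ring
      have g4 : ((la.rowLen i + 1 : ℕ) : ℤ) - ((0 : ℕ) : ℤ) - 1 = (la.rowLen i : ℤ) := by
        push_cast; ring
      rw [g1, g2, g3, g4]
      simp
  rw [nekN_self_eq mu hm, nekN_self_eq la hl, prod_range_succ, prod_range_succ, hi,
    mul_right_comm, ← prod_mul_distrib, prod_congr rfl hrow, prod_mul_distrib]
  ring

variable [CharZero L]

/-- Up to monomials, the product of the vacuum entries of `Φ_λ` and `Φ*_λ` is
`1 / N_{λ,λ}(1)`. -/
theorem vacuum_mul_vacuum {N : ℤ} {v u w u' w' : L} {T : FockIdx → YoungDiagram × FockIdx → L}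
    {T' : FockIdx × YoungDiagram → FockIdx → L} (h : IsPhi N v u w T)
    (h' : IsPhiStar (N - 1) u' v w' T') (hv : v ≠ 0) (hw' : w' ≠ 0) (la : YoungDiagram) :
    T 0 (la, 0) * T' (0, la) 0 * nekN la la 1 =
      ∏ s ∈ la.cells, (w / (w' * v) * ((qtHalf L)⁻¹ ^ 2 * (content L s)⁻¹)) := by
  induction la using youngDiagram_induction with
  | bot => rw [h.2, h'.2]; simp [nekN]
  | add la i mu hadd hlast ih =>
    rw [hadd.cells_eq, prod_insert (IsAddBox.notMem la i), ← ih]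
    have hp := qtHalf_ne_zero L
    have hq := qq_ne_zero L
    have ht := tt_ne_zero L
    have rP := h.vacuum_recursion hv hadd
    have rS := h'.vacuum_recursion hv hadd
    have rN := nekN_self_addBox (L := L) hadd hlast rfl
    obtain ⟨x, hx⟩ : ∃ x, x = rowVar (qq L) (tt L) la := ⟨_, rfl⟩
    rw [← hx] at rP rS rN
    have hx0 : ∀ i, x i ≠ 0 := by
      rw [hx]
      exact rowVar_ne_zero la
    have hdiv : ∀ k, x i / x k = qq L ^ ((la.rowLen i : ℤ) - la.rowLen k) * tt L ^ ((k : ℤ) - i) :=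
      fun k => by rw [hx, rowVar_div]
    have hcont : content L (i, la.rowLen i) = x i := by rw [hx, content, rowVar]
    rw [hcont]
    have hA : Aplus la i = (1 - tt L) * ((∏ k ∈ range i, (1 - tt L * (x i / x k))) *
        (∏ k ∈ range i, (1 - qq L * (tt L)⁻¹ * (x i / x k))) /
        ((∏ k ∈ range i, (1 - x i / x k)) * ∏ k ∈ range i, (1 - qq L * (x i / x k)))) := by
      rw [Aplus, ← prod_mul_distrib, ← prod_mul_distrib, ← prod_div_distrib]
      congr 1
      refine prod_congr rfl fun k _ => ?_
      rw [hdiv, zpow_add_one₀ hq, zpow_add_one₀ ht, zpow_sub_one₀ ht]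
      ring
    have hAm : Aminus mu i = (1 - (tt L)⁻¹) * ((1 - qq L ^ (-(la.rowLen i : ℤ) - 1)) /
        (1 - qq L ^ (-(la.rowLen i : ℤ)) * (tt L)⁻¹)) := by
      have hcl : mu.colLen 0 = i + 1 := by
        have h1 := hadd.lt_colLen
        by_contra h2
        have := rowLen_pos_iff.mpr (show i + 1 < mu.colLen 0 by omega)
        rw [hadd.rowLen_ne (by omega)] at this
        omega
      rw [Aminus, hcl, Ico_self, prod_empty, mul_one, hadd.rowLen_self, hadd.rowLen_ne (by omega),
        hlast]
      have g1 : ((0 : ℕ) : ℤ) - ((la.rowLen i + 1 : ℕ) : ℤ) = -(la.rowLen i : ℤ) - 1 := by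
        push_cast
        ring
      rw [g1, sub_add_cancel]
    have hne : ∀ k ∈ range i, la.rowLen i < la.rowLen k ∧ k < i := fun k hk =>
      ⟨hadd.rowLen_lt (mem_range.mp hk), mem_range.mp hk⟩
    have ne_b : ∏ k ∈ range i, (1 - x i / x k) ≠ 0 := prod_ne_zero_iff.mpr fun k hk => by
      have := hne k hk
      rw [hdiv]
      exact one_sub_zpow_ne_zero (Or.inl (by omega))
    have ne_a : ∏ k ∈ range i, (1 - x k / x i) ≠ 0 := prod_ne_zero_iff.mpr fun k hk => by
      have := hne k hk
      rw [hx, rowVar_div]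
      exact one_sub_zpow_ne_zero (Or.inl (by omega))
    have ne_d : ∏ k ∈ range i, (1 - tt L * (x i / x k)) ≠ 0 := prod_ne_zero_iff.mpr fun k hk => by
      have := hne k hk
      rw [hdiv, mul_left_comm, ← zpow_one_add₀ ht]
      exact one_sub_zpow_ne_zero (Or.inl (by omega))
    have ne_e : ∏ k ∈ range i, (1 - qq L * (tt L)⁻¹ * (x i / x k)) ≠ 0 :=
      prod_ne_zero_iff.mpr fun k hk => by
        have := hne k hk
        rw [hdiv, mul_mul_mul_comm, ← zpow_one_add₀ hq, mul_comm (tt L)⁻¹, ← zpow_sub_one₀ ht]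
        exact one_sub_zpow_ne_zero (Or.inr (by omega))
    have ne_f : ∏ k ∈ range i, (1 - qq L * (x i / x k)) ≠ 0 := prod_ne_zero_iff.mpr fun k hk => by
      have := hne k hk
      rw [hdiv, ← mul_assoc, ← zpow_one_add₀ hq]
      exact one_sub_zpow_ne_zero (Or.inr (by omega))
    have ne_c : ∏ k ∈ range i, (1 - (tt L)⁻¹ * (x k / x i)) ≠ 0 :=
      prod_ne_zero_iff.mpr fun k hk => by
        have := hne k hk
        rw [hx, rowVar_div, mul_left_comm, mul_comm (tt L)⁻¹, ← zpow_sub_one₀ ht]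
        exact one_sub_zpow_ne_zero (Or.inl (by omega))
    have n1 : 1 - tt L ≠ 0 := by simpa using one_sub_tt_pow_ne_zero L one_pos
    have n2 : 1 - (tt L)⁻¹ ≠ 0 := by simpa using one_sub_tt_inv_pow_ne_zero L one_pos
    have n3 : 1 - qq L ^ (-(la.rowLen i : ℤ)) * (tt L)⁻¹ ≠ 0 := by
      have := one_sub_zpow_ne_zero (L := L) (a := -(la.rowLen i : ℤ)) (b := -1) (Or.inr (by omega))
      simpa using this
    have n4 : 1 - qq L ^ (-(la.rowLen i : ℤ) - 1) ≠ 0 := by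
      have := one_sub_zpow_ne_zero (L := L) (a := -(la.rowLen i : ℤ) - 1) (b := 0)
        (Or.inl (by omega))
      simpa using this
    have n5 : 1 - qq L ^ la.rowLen i * tt L ≠ 0 := by
      have := one_sub_zpow_ne_zero (L := L) (a := (la.rowLen i : ℤ)) (b := 1) (Or.inr (by omega))
      simpa using this
    have hχ : x i * v ≠ 0 := mul_ne_zero (hx0 i) hv
    rw [hA, neg_add, zpow_add₀ hp, zpow_add_one₀ hχ, zpow_neg, zpow_neg_one] at rP
    rw [hAm, sub_add_cancel, zpow_neg (x i * v)] at rS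
    rw [prod_mul_distrib, prod_mul_distrib] at rN
    have hP0 := zpow_ne_zero N hp
    have hX0 := zpow_ne_zero N hχ
    -- the last row of `μ` is either new or the last row of `λ`
    have hl : la.colLen 0 = i ∧ la.rowLen i = 0 ∨ la.colLen 0 = i + 1 := by
      have h1 := hadd.lt_colLen_add_one
      have h2 : ¬ i + 1 < la.colLen 0 := fun h => by
        have := rowLen_pos_iff.mpr h
        omega
      rcases Nat.lt_or_ge i (la.colLen 0) with h | h
      · right; omega
      · exact Or.inl ⟨by omega, rowLen_eq_zero h⟩
    have hQ : qq L ^ la.rowLen i ≠ 0 := pow_ne_zero _ hq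
    rw [zpow_neg (qq L) (la.rowLen i), zpow_natCast] at rS n3
    obtain ⟨rP', rS'⟩ : (1 - tt L) * ((∏ k ∈ range i, (1 - tt L * (x i / x k))) *
          (∏ k ∈ range i, (1 - qq L * (tt L)⁻¹ * (x i / x k))) /
          ((∏ k ∈ range i, (1 - x i / x k)) * ∏ k ∈ range i, (1 - qq L * (x i / x k)))) *
          ((x i * v) ^ N * (x i * v)) * T 0 (mu, 0) * ((∏ k ∈ range i, (1 - x k / x i)) *
          (1 - (qq L ^ la.rowLen i)⁻¹ * (tt L)⁻¹)) =
        w * ((qtHalf L ^ N)⁻¹ * (qtHalf L)⁻¹) * T 0 (la, 0) *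
          ((∏ k ∈ range i, (1 - (tt L)⁻¹ * (x k / x i))) * (1 - (tt L)⁻¹)) ∧
        qtHalf L * ((1 - (tt L)⁻¹) * ((1 - qq L ^ (-(la.rowLen i : ℤ) - 1)) /
          (1 - (qq L ^ la.rowLen i)⁻¹ * (tt L)⁻¹))) * ((x i * v) ^ N)⁻¹ * T' (0, mu) 0 *
          ((∏ k ∈ range i, (1 - x i / x k)) * (1 - qq L ^ la.rowLen i * tt L)) =
        w'⁻¹ * qtHalf L ^ N * T' (0, la) 0 *
          ((∏ k ∈ range i, (1 - tt L * (x i / x k))) * (1 - tt L)) := by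
      rcases hl with ⟨hl, h0⟩ | hl
      · have he : (range (i + 1)).erase i = range i := by
          rw [range_add_one, erase_insert (by simp)]
        rw [hl, he] at rP rS
        rw [h0] at rS ⊢
        simp only [pow_zero, inv_one, one_mul] at rS ⊢
        exact ⟨by linear_combination (1 - (tt L)⁻¹) * rP, by linear_combination (1 - tt L) * rS⟩
      · have he : (range (i + 1 + 1)).erase i = insert (i + 1) (range i) := by
          ext k
          simp only [mem_erase, mem_range, mem_insert]
          omega
        have hi : i + 1 ∉ range i := by simp
        have hx1 : x i / x (i + 1) = qq L ^ la.rowLen i * tt L := by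
          rw [hdiv, hlast]
          simp
        have hx2 : x (i + 1) / x i = (qq L ^ la.rowLen i)⁻¹ * (tt L)⁻¹ := by
          rw [← inv_div, hx1, mul_inv]
        rw [hl, he, prod_insert hi, prod_range_succ, div_self (hx0 i), mul_one] at rP rS
        rw [hx2] at rP
        rw [hx1] at rS
        exact ⟨by linear_combination rP, by linear_combination rS⟩
    have hx0i := hx0 i
    clear rP rS hA hAm hdiv hcont hx ih hl hne hlast hadd hx0
    generalize ∏ k ∈ range i, (1 - x i / x k) = b at *
    generalize ∏ k ∈ range i, (1 - x k / x i) = a at *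
    generalize ∏ k ∈ range i, (1 - tt L * (x i / x k)) = d at *
    generalize ∏ k ∈ range i, (1 - (tt L)⁻¹ * (x k / x i)) = c at *
    generalize ∏ k ∈ range i, (1 - qq L * (tt L)⁻¹ * (x i / x k)) = e at *
    generalize ∏ k ∈ range i, (1 - qq L * (x i / x k)) = f at *
    generalize 1 - (qq L ^ la.rowLen i)⁻¹ * (tt L)⁻¹ = m3 at *
    generalize 1 - qq L ^ (-(la.rowLen i : ℤ) - 1) = m4 at *
    generalize 1 - qq L ^ la.rowLen i * tt L = m5 at *
    generalize 1 - (tt L)⁻¹ = m2 at *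
    generalize 1 - tt L = m1 at *
    generalize (x i * v) ^ N = X at *
    generalize qtHalf L ^ N = P at *
    generalize x i = χ at *
    generalize qtHalf L = p at *
    generalize T 0 (mu, 0) = T1 at *
    generalize T 0 (la, 0) = T2 at *
    generalize T' (0, mu) 0 = T3 at *
    generalize T' (0, la) 0 = T4 at *
    generalize nekN mu mu (1 : L) = n1 at *
    generalize nekN la la (1 : L) = n2 at *
    have e1 : T1 = w * (P⁻¹ * p⁻¹) * T2 * (c * m2) * (b * f) / (m1 * (d * e) * (X * (χ * v)) *
        (a * m3)) := by
      rw [eq_div_iff (by simp [*])]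
      field_simp at rP'
      field_simp
      linear_combination rP'
    have e2 : T3 = w'⁻¹ * P * T4 * (d * m1) * m3 * X / (p * (m2 * m4) * (b * m5)) := by
      rw [eq_div_iff (by simp [*])]
      field_simp at rS'
      field_simp
      linear_combination rS'
    have e3 : n1 = n2 * (m4 * m5) * (e * a) / (c * f) := by
      rw [eq_div_iff (by simp [*]), rN]
    rw [e1, e2, e3]
    field_simp

end Norm

/-! ### Formal sums of Hahn series -/

section HahnSum

open Finset

variable {Γ K ι κ : Type*}

lemma hasHahnSum_iff [PartialOrder Γ] [AddCommMonoid K] {f : ι → HahnSeries Γ K}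
    {s : HahnSeries Γ K} : HasHahnSum f s ↔ (⋃ i, (f i).support).IsPWO ∧
      (∀ g, {i | (f i).coeff g ≠ 0}.Finite) ∧ ∀ g, s.coeff g = ∑ᶠ i, (f i).coeff g := by
  constructor
  · rintro ⟨F, rfl, rfl⟩
    exact ⟨F.isPWO_iUnion_support, F.finite_co_support, fun g =>
      HahnSeries.SummableFamily.coeff_hsum⟩
  · rintro ⟨h1, h2, h3⟩
    refine ⟨⟨f, h1, h2⟩, rfl, ?_⟩
    ext g
    rw [HahnSeries.SummableFamily.coeff_hsum, h3]
    rfl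

lemma HasHahnSum.unique [PartialOrder Γ] [AddCommMonoid K] {f : ι → HahnSeries Γ K}
    {s s' : HahnSeries Γ K} (h : HasHahnSum f s) (h' : HasHahnSum f s') : s = s' := by
  ext g
  rw [(hasHahnSum_iff.mp h).2.2, (hasHahnSum_iff.mp h').2.2]

lemma hasHahnSum_comp_equiv [PartialOrder Γ] [AddCommMonoid K] (e : ι ≃ κ)
    {f : κ → HahnSeries Γ K} {s : HahnSeries Γ K} :
    HasHahnSum (fun i => f (e i)) s ↔ HasHahnSum f s := by
  rw [hasHahnSum_iff, hasHahnSum_iff]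
  refine and_congr ?_ (and_congr (forall_congr' fun g => ?_) (forall_congr' fun g => ?_))
  · rw [e.surjective.iUnion_comp fun k => (f k).support]
  · constructor
    · intro h
      refine (h.image e).subset fun k hk => ⟨e.symm k, by simpa using hk, by simp⟩
    · exact fun h => h.preimage e.injective.injOn
  · rw [finsum_comp_equiv e (f := fun k => (f k).coeff g)]

/-- Summands that vanish may be added or omitted. -/
lemma hasHahnSum_comp_injective [PartialOrder Γ] [AddCommMonoid K] {e : ι → κ}
    (he : Function.Injective e) {f : κ → HahnSeries Γ K} (h0 : ∀ k, k ∉ Set.range e → f k = 0)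
    {s : HahnSeries Γ K} : HasHahnSum (fun i => f (e i)) s ↔ HasHahnSum f s := by
  rw [hasHahnSum_iff, hasHahnSum_iff]
  refine and_congr ?_ (and_congr (forall_congr' fun g => ?_) (forall_congr' fun g => ?_))
  · have : (⋃ i, (f (e i)).support) = ⋃ k, (f k).support := by
      refine Set.Subset.antisymm (Set.iUnion_subset fun i => Set.subset_iUnion
        (fun k => (f k).support) (e i)) (Set.iUnion_subset fun k => ?_)
      by_cases hk : k ∈ Set.range e
      · obtain ⟨i, rfl⟩ := hk
        exact Set.subset_iUnion (fun i => (f (e i)).support) i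
      · rw [h0 k hk]
        simp
    rw [this]
  · constructor
    · intro h
      refine (h.image e).subset fun k hk => ?_
      by_cases hk' : k ∈ Set.range e
      · obtain ⟨i, rfl⟩ := hk'
        exact ⟨i, hk, rfl⟩
      · exact absurd (by simp [h0 k hk']) hk
    · exact fun h => h.preimage he.injOn
  · have : ∑ᶠ i, (f (e i)).coeff g = ∑ᶠ k, (f k).coeff g := by
      rw [← finsum_mem_range (f := fun k => (f k).coeff g) he]
      refine finsum_congr fun k => ?_
      by_cases hk : k ∈ Set.range e
      · simp [hk]
      · simp [hk, h0 k hk]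
    rw [this]

lemma HasHahnSum.add [PartialOrder Γ] [AddCommMonoid K] {f f' : ι → HahnSeries Γ K}
    {s s' : HahnSeries Γ K} (h : HasHahnSum f s) (h' : HasHahnSum f' s') :
    HasHahnSum (fun i => f i + f' i) (s + s') := by
  obtain ⟨F, rfl, rfl⟩ := h
  obtain ⟨F', rfl, rfl⟩ := h'
  exact ⟨F + F', rfl, HahnSeries.SummableFamily.hsum_add⟩

/-- The sum over pairs may be computed iteratively. -/
lemma HasHahnSum.sigma [PartialOrder Γ] [AddCommMonoid K] {f : ι × κ → HahnSeries Γ K}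
    {s : HahnSeries Γ K} (h : HasHahnSum f s) {g : ι → HahnSeries Γ K}
    (hg : ∀ i, HasHahnSum (fun k => f (i, k)) (g i)) : HasHahnSum g s := by
  obtain ⟨h1, h2, h3⟩ := hasHahnSum_iff.mp h
  have hne : ∀ i γ, (g i).coeff γ ≠ 0 → ∃ k, (f (i, k)).coeff γ ≠ 0 := by
    intro i γ hi
    rw [(hasHahnSum_iff.mp (hg i)).2.2] at hi
    exact by_contra fun hk => hi (finsum_eq_zero_of_forall_eq_zero fun k => not_not.mp (not_exists.mp hk k))
  refine hasHahnSum_iff.mpr ⟨h1.mono (Set.iUnion_subset fun i γ hγ => ?_), fun γ => ?_, fun γ => ?_⟩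
  · obtain ⟨k, hk⟩ := hne i γ hγ
    exact Set.mem_iUnion.mpr ⟨(i, k), hk⟩
  · refine ((h2 γ).image Prod.fst).subset fun i hi => ?_
    obtain ⟨k, hk⟩ := hne i γ hi
    exact ⟨(i, k), hk, rfl⟩
  · rw [h3, finsum_curry _ (h2 γ)]
    exact finsum_congr fun i => ((hasHahnSum_iff.mp (hg i)).2.2 γ).symm

lemma hasHahnSum_unique [PartialOrder Γ] [AddCommMonoid K] [Unique ι] (f : ι → HahnSeries Γ K) :
    HasHahnSum f (f default) := by
  refine hasHahnSum_iff.mpr ⟨?_, fun g => Set.toFinite _, fun g => ?_⟩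
  · exact (f default).isPWO_support.mono
      (Set.iUnion_subset fun i => by rw [Unique.eq_default i])
  · rw [finsum_unique]

lemma hasHahnSum_of_finset [PartialOrder Γ] [AddCommMonoid K] {f : ι → HahnSeries Γ K}
    {s : Finset ι} (h : ∀ i, i ∉ s → f i = 0) : HasHahnSum f (∑ i ∈ s, f i) := by
  classical
  let F : ι →₀ HahnSeries Γ K := Finsupp.onFinset s f fun i hi => by
    by_contra hs
    exact hi (h i hs)
  refine ⟨HahnSeries.SummableFamily.ofFinsupp F, rfl, ?_⟩
  rw [HahnSeries.SummableFamily.hsum_ofFinsupp, Finsupp.sum_of_support_subset F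
    (Finsupp.support_onFinset_subset) _ (fun _ _ => rfl)]
  rfl

variable [AddCommGroup Γ] [LinearOrder Γ] [IsOrderedAddMonoid Γ] [Field K]

lemma HasHahnSum.const_mul {f : ι → HahnSeries Γ K} {s : HahnSeries Γ K} (h : HasHahnSum f s)
    (c : HahnSeries Γ K) : HasHahnSum (fun i => c * f i) (c * s) := by
  obtain ⟨F, rfl, rfl⟩ := h
  exact ⟨c • F, funext fun i => HahnSeries.SummableFamily.smul_apply,
    HahnSeries.SummableFamily.hsum_smul⟩

lemma HasHahnSum.mul {f : ι → HahnSeries Γ K} {f' : κ → HahnSeries Γ K} {s s' : HahnSeries Γ K}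
    (h : HasHahnSum f s) (h' : HasHahnSum f' s') :
    HasHahnSum (fun p : ι × κ => f p.1 * f' p.2) (s * s') := by
  obtain ⟨F, rfl, rfl⟩ := h
  obtain ⟨F', rfl, rfl⟩ := h'
  exact ⟨F.mul F', rfl, HahnSeries.SummableFamily.hsum_mul F F'⟩

lemma HasHahnSum.prod_fin {n : ℕ} {f : Fin n → ι → HahnSeries Γ K} {s : Fin n → HahnSeries Γ K}
    (h : ∀ k, HasHahnSum (f k) (s k)) :
    HasHahnSum (fun p : Fin n → ι => ∏ k, f k (p k)) (∏ k, s k) := by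
  induction n with
  | zero =>
    have := hasHahnSum_unique (fun p : Fin 0 → ι => ∏ k, f k (p k))
    simpa using this
  | succ n ih =>
    have h1 := (h 0).mul (ih fun k => h k.succ)
    rw [← hasHahnSum_comp_equiv (Fin.consEquiv fun _ : Fin (n + 1) => ι), Fin.prod_univ_succ]
    convert h1 using 2 with p
    rw [Fin.prod_univ_succ]
    simp [Fin.consEquiv]

/-- A family of monomials is summable, up to a common factor, if the exponents are positive
combinations of finitely many positive exponents and the coefficients of these combinations
determine the summand up to finitely many possibilities. -/
lemma exists_hasHahnSum_of_degree {J : Type*} [Finite J] {f : ι → HahnSeries Γ K}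
    {A : HahnSeries Γ K} {φ : (J → ℕ) → Γ} (hφ : StrictMono φ) (d : ι → J → ℕ)
    (hd : ∀ v, {i | d i = v}.Finite) (hf : ∀ i, ∃ c, f i = A * HahnSeries.single (φ (d i)) c) :
    ∃ s, HasHahnSum f s := by
  choose c hc using hf
  suffices h : ∃ s, HasHahnSum (fun i => HahnSeries.single (φ (d i)) (c i)) s by
    obtain ⟨s, hs⟩ := h
    refine ⟨A * s, ?_⟩
    convert hs.const_mul A using 1
    exact funext hc
  have hsub : ∀ i, (HahnSeries.single (φ (d i)) (c i)).support ⊆ {φ (d i)} := fun i =>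
    HahnSeries.support_single_subset
  refine ⟨_, ⟨_, ?_, fun g => ?_⟩, rfl, rfl⟩
  · refine ((Set.isPWO_of_wellQuasiOrderedLE (Set.univ : Set (J → ℕ))).image_of_monotone
      hφ.monotone).mono (Set.iUnion_subset fun i γ hγ => ⟨d i, trivial, ?_⟩)
    exact (Set.mem_singleton_iff.mp (hsub i hγ)).symm
  · have hA : {v | φ v = g}.Finite := by
      refine WellQuasiOrderedLE.finite_of_isAntichain fun v hv v' hv' hne hle => ?_
      have := hφ (lt_of_le_of_ne hle hne)
      rw [hv, hv'] at this
      exact lt_irrefl _ this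
    refine (hA.biUnion fun v _ => hd v).subset fun i hi => ?_
    have : g = φ (d i) := hsub i hi
    exact Set.mem_biUnion (x := d i) this.symm rfl

lemma strictMono_degree {J : Type*} [Fintype J] (g₀ : Γ) {r : J → Γ} (hr : ∀ j, 0 < r j) :
    StrictMono fun v : J → ℕ => g₀ + ∑ j, v j • r j := by
  intro v v' h
  obtain ⟨hle, j, hj⟩ := Pi.lt_def.mp h
  refine add_lt_add_right (Finset.sum_lt_sum (fun j _ => nsmul_le_nsmul_left (hr j).le (hle j))
    ⟨j, mem_univ j, nsmul_lt_nsmul_left (hr j) hj⟩) _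

end HahnSum

/-! ### Coherent states -/

section Coherent

open Finset

variable {L : Type*} [Field L]

/-- The weight `∑ n mₙ` of the monomial `∏ pₙ^{mₙ}`. -/
def wt (m : FockIdx) : ℕ := m.sum fun n k => (n : ℕ) * k

/-- The coefficients `∏ βₙ^{mₙ}/mₙ!` of the coherent state `exp(∑ βₙ pₙ)`. -/
def coh (β : ℕ+ → L) (m : FockIdx) : L := m.prod fun n k => β n ^ k / (k.factorial : L)

lemma wt_zero : wt 0 = 0 := by simp [wt]

lemma wt_add (m m' : FockIdx) : wt (m + m') = wt m + wt m' :=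
  Finsupp.sum_add_index' (by simp) (by intros; ring)

lemma wt_single (n : ℕ+) (k : ℕ) : wt (Finsupp.single n k) = n * k := by
  simp [wt]

lemma mul_apply_le_wt (m : FockIdx) (n : ℕ+) : (n : ℕ) * m n ≤ wt m := by
  have : m = Finsupp.single n (m n) + m.erase n := (Finsupp.single_add_erase n m).symm
  calc (n : ℕ) * m n = wt (Finsupp.single n (m n)) := (wt_single n _).symm
    _ ≤ wt m := by conv_rhs => rw [this, wt_add]
                   exact Nat.le_add_right _ _

lemma finite_wt_eq (N : ℕ) : {m : FockIdx | wt m = N}.Finite := by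
  classical
  let M : FockIdx := Finsupp.onFinset ((Finset.range N).image Nat.succPNat)
    (fun n => if (n : ℕ) ≤ N then N else 0) (by
      intro n hn
      have hn' : (n : ℕ) ≤ N := by
        by_contra h
        simp [h] at hn
      refine mem_image.mpr ⟨n.natPred, ?_, n.succPNat_natPred⟩
      have := n.natPred_add_one
      rw [mem_range]
      omega)
  refine (Set.finite_Iic M).subset fun m hm n => ?_
  have h1 := mul_apply_le_wt m n
  have hm' : wt m = N := hm
  rw [hm'] at h1
  rcases Nat.eq_zero_or_pos (m n) with h0 | h0
  · rw [h0]
    exact Nat.zero_le _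
  · have h2 : (n : ℕ) ≤ N := le_trans (Nat.le_mul_of_pos_right _ h0) h1
    have h3 : m n ≤ N := le_trans (Nat.le_mul_of_pos_left _ n.pos) h1
    simpa [M, h2] using h3

lemma coh_zero_index (β : ℕ+ → L) : coh β 0 = 1 := by simp [coh]

lemma coh_mul (c β : ℕ+ → L) (m : FockIdx) :
    coh (fun n => c n * β n) m = (m.prod fun n k => c n ^ k) * coh β m := by
  rw [coh, coh, ← Finsupp.prod_mul]
  exact Finsupp.prod_congr fun n _ => by rw [mul_pow, mul_div_assoc]

lemma coh_zero_of_ne {m : FockIdx} (hm : m ≠ 0) : coh (fun _ => (0 : L)) m = 0 := by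
  obtain ⟨n, hn⟩ := Finsupp.ne_iff.mp hm
  refine prod_eq_zero (Finsupp.mem_support_iff.mpr hn) ?_
  change (0 : L) ^ m n / _ = 0
  rw [zero_pow hn, zero_div]

/-- Induction over the monomials `∏ pₙ^{mₙ}`, one factor at a time. -/
lemma fock_induction {P : FockIdx → Prop} (h0 : P 0)
    (h1 : ∀ m n, P m → P (m + Finsupp.single n 1)) (m : FockIdx) : P m := by
  induction m using Finsupp.induction with
  | zero => exact h0
  | single_add n k m _ _ ih =>
    rw [add_comm]
    clear * - ih h1
    induction k with
    | zero => simpa using ih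
    | succ k ih' =>
      rw [Finsupp.single_add, ← add_assoc]
      exact h1 _ _ ih'

variable [CharZero L]

lemma coh_add_single (β : ℕ+ → L) (m : FockIdx) (n : ℕ+) :
    ((m n : L) + 1) * coh β (m + Finsupp.single n 1) = β n * coh β m := by
  have e1 : ∀ k : ℕ, coh β (m.erase n + Finsupp.single n k) =
      coh β (m.erase n) * (β n ^ k / (k.factorial : L)) := by
    intro k
    have hd : Disjoint (m.erase n).support (Finsupp.single n k).support := by
      refine Disjoint.mono_right Finsupp.support_single_subset ?_
      simp
    rw [coh, Finsupp.prod_add_index_of_disjoint hd]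
    congr 1
    exact Finsupp.prod_single_index (by simp)
  have e2 : m = m.erase n + Finsupp.single n (m n) := (Finsupp.erase_add_single n m).symm
  have e3 : m + Finsupp.single n 1 = m.erase n + Finsupp.single n (m n + 1) := by
    rw [Finsupp.single_add, ← add_assoc, ← e2]
  rw [e3, e1]
  conv_rhs => rw [e2, e1]
  have h1 : ((m n).factorial : L) ≠ 0 := Nat.cast_ne_zero.mpr (Nat.factorial_ne_zero _)
  have h2 : (m n : L) + 1 ≠ 0 := by exact_mod_cast Nat.succ_ne_zero (m n)
  rw [Nat.factorial_succ]
  push_cast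
  field_simp
  ring

lemma sum_mul_coh (a : ℕ+ → L) (k : ℕ+) {N N' : ℕ} (h : (k : ℕ) + N' = N) :
    ∑ m ∈ (finite_wt_eq N).toFinset, (m k : L) * coh a m =
      a k * ∑ m ∈ (finite_wt_eq N').toFinset, coh a m := by
  rw [mul_sum]
  symm
  refine sum_of_injOn (fun m => m + Finsupp.single k 1) (add_left_injective _).injOn ?_ ?_ ?_
  · intro m hm
    simp only [Set.Finite.coe_toFinset, Set.mem_ofPred_eq] at hm ⊢
    rw [wt_add, wt_single, hm]
    omega
  · intro m hm hm'
    by_contra h0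
    have hk : m k ≠ 0 := fun h => h0 (by rw [h]; simp)
    refine hm' ⟨m - Finsupp.single k 1, ?_, ?_⟩
    · have h1 : m - Finsupp.single k 1 + Finsupp.single k 1 = m :=
        tsub_add_cancel_of_le (Finsupp.single_le_iff.mpr (Nat.one_le_iff_ne_zero.mpr hk))
      simp only [Set.Finite.coe_toFinset, Set.mem_ofPred_eq, Set.Finite.mem_toFinset] at hm ⊢
      rw [← h1, wt_add, wt_single] at hm
      omega
    · exact tsub_add_cancel_of_le (Finsupp.single_le_iff.mpr (Nat.one_le_iff_ne_zero.mpr hk))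
  · intro m _
    rw [← coh_add_single]
    simp

/-- The homogeneous components of the total mass of a coherent state. -/
lemma sum_coh_eq_expCoeff (a : ℕ+ → L) (N : ℕ) :
    ∑ m ∈ (finite_wt_eq N).toFinset, coh a m = expCoeff L a N := by
  classical
  let f : PowerSeries L := PowerSeries.mk fun N => ∑ m ∈ (finite_wt_eq N).toFinset, coh a m
  suffices h : f = expSeries L a by
    have := congrArg (PowerSeries.coeff N) h
    simpa [f, expSeries] using this
  refine eq_expSeries ?_ fun n => ?_
  · have : (finite_wt_eq 0).toFinset = {0} := by
      ext m
      simp only [Set.Finite.mem_toFinset, Set.mem_ofPred_eq, mem_singleton]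
      refine ⟨fun h => Finsupp.ext fun n => ?_, fun h => by rw [h, wt_zero]⟩
      have h1 := mul_apply_le_wt m n
      rw [h] at h1
      exact (Nat.mul_eq_zero.mp (Nat.le_zero.mp h1)).resolve_left n.ne_zero
    simp [f, this, coh_zero_index]
  · simp only [f, PowerSeries.coeff_mk, smul_eq_mul]
    let e : FockIdx → ℕ → ℕ := fun m j => if h : 0 < j then m ⟨j, h⟩ else 0
    have he : ∀ m ∈ (finite_wt_eq n).toFinset,
        (n : L) = ∑ x ∈ antidiagonal n, (x.1 : L) * e m x.1 := by
      intro m hm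
      have hm' : wt m = n := by simpa using hm
      have : wt m = ∑ x ∈ antidiagonal n, x.1 * e m x.1 := by
        refine sum_of_injOn (fun k : ℕ+ => ((k : ℕ), n - k)) ?_ ?_ ?_ ?_
        · intro k _ l _ h
          exact PNat.coe_injective (Prod.mk.inj h).1
        · intro k hk
          have h1 := mul_apply_le_wt m k
          have h2 : 0 < m k := Nat.pos_of_ne_zero (Finsupp.mem_support_iff.mp hk)
          have h3 : (k : ℕ) ≤ (k : ℕ) * m k := Nat.le_mul_of_pos_right _ h2
          rw [mem_coe, HasAntidiagonal.mem_antidiagonal]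
          change (k : ℕ) + (n - k) = n
          omega
        · intro x hx hx'
          rcases Nat.eq_zero_or_pos x.1 with h0 | h0
          · rw [h0, zero_mul]
          · simp only [e, h0, dif_pos]
            by_contra hne
            refine hx' ⟨⟨x.1, h0⟩, ?_, ?_⟩
            · exact Finsupp.mem_support_iff.mpr fun h => hne (by rw [h, mul_zero])
            · have := HasAntidiagonal.mem_antidiagonal.mp hx
              exact Prod.ext rfl (by simp only [PNat.mk_coe]; omega)
        · intro k _
          simp only [e, dif_pos k.pos]
          rfl
      have h2 := congrArg (Nat.cast (R := L)) this
      rw [hm'] at h2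
      rw [h2]
      push_cast
      rfl
    calc (n : L) * ∑ m ∈ (finite_wt_eq n).toFinset, coh a m
        = ∑ m ∈ (finite_wt_eq n).toFinset, ∑ x ∈ antidiagonal n,
            (x.1 : L) * ((e m x.1 : L) * coh a m) := by
          rw [mul_sum]
          refine sum_congr rfl fun m hm => ?_
          rw [he m hm, sum_mul]
          exact sum_congr rfl fun x _ => mul_assoc _ _ _
      _ = _ := by
          rw [sum_comm]
          refine sum_congr rfl fun x hx => ?_
          rw [← mul_sum]
          rcases Nat.eq_zero_or_pos x.1 with h0 | h0
          · rw [h0, Nat.cast_zero, zero_mul, zero_mul]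
          · obtain ⟨k, hk⟩ : ∃ k : ℕ+, (k : ℕ) = x.1 := ⟨⟨x.1, h0⟩, rfl⟩
            rw [← hk, coeff_currentSeries_pnat, ← sum_mul_coh a k (N := n)
              (by have := HasAntidiagonal.mem_antidiagonal.mp hx; omega)]
            simp only [e, dif_pos k.pos]
            rfl

end Coherent

/-! ### Sums over coherent states -/

section CoherentSum

open Finset

variable {Γ K : Type*} [AddCommGroup Γ] [LinearOrder Γ] [IsOrderedAddMonoid Γ] [Field K]

/-- The total mass of the coherent state with the parameters `γₙ` is `E`, that is,
`E = exp(∑ γₙ)`. -/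
def HasMass (γ : ℕ+ → HahnSeries Γ K) (E : HahnSeries Γ K) : Prop := HasHahnSum (coh γ) E

lemma hasMass_zero : HasMass (fun _ => (0 : HahnSeries Γ K)) 1 := by
  rw [HasMass, ← hasHahnSum_comp_injective (e := fun _ : Unit => (0 : FockIdx))
    (Function.injective_of_subsingleton _) (fun m hm => coh_zero_of_ne fun h => hm ⟨(), h.symm⟩)]
  have := hasHahnSum_unique (fun _ : Unit => coh (fun _ => (0 : HahnSeries Γ K)) (0 : FockIdx))
  rwa [coh_zero_index] at this

variable [CharZero K]

instance charZero_hahnSeries : CharZero (HahnSeries Γ K) :=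
  charZero_of_injective_algebraMap (R := K) (algebraMap K (HahnSeries Γ K)).injective

lemma IsVertexOp.zero_row {L : Type*} [Field L] {b c : ℕ+ → L} {τ : L}
    {T : FockIdx → FockIdx → L} (h : IsVertexOp b c τ T) (i : FockIdx) :
    T 0 i = τ * i.prod fun n k => c n ^ k := by
  induction i using fock_induction with
  | h0 => simp [h.vac]
  | h1 i n ih =>
    rw [h.row, ih, Finsupp.prod_add_index' (by simp) (by intros; rw [pow_add]),
      Finsupp.prod_single_index (by simp)]
    ring

/-- A vertex operator maps a coherent state to a coherent state. -/
theorem IsVertexOp.hasHahnSum_coh {b c : ℕ+ → HahnSeries Γ K} {τ : HahnSeries Γ K}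
    {T : FockIdx → FockIdx → HahnSeries Γ K} (h : IsVertexOp b c τ T)
    {β : ℕ+ → HahnSeries Γ K} {E : HahnSeries Γ K} (hE : HasMass (fun n => c n * β n) E)
    (o : FockIdx) :
    HasHahnSum (fun i => T o i * coh β i) (τ * E * coh (fun n => β n + b n) o) := by
  induction o using fock_induction with
  | h0 =>
    rw [coh_zero_index, mul_one]
    convert hE.const_mul τ using 2 with i
    rw [h.zero_row, coh_mul, mul_assoc]
  | h1 o n ih =>
    have hn : (o n : HahnSeries Γ K) + 1 ≠ 0 := by exact_mod_cast Nat.succ_ne_zero (o n)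
    have h1 : HasHahnSum (fun i => (i n : HahnSeries Γ K) * T o (i - Finsupp.single n 1) *
        coh β i) (β n * (τ * E * coh (fun n => β n + b n) o)) := by
      rw [← hasHahnSum_comp_injective (e := fun i => i + Finsupp.single n 1)
        (add_left_injective _)]
      · convert ih.const_mul (β n) using 2 with i
        rw [add_tsub_cancel_right]
        have := coh_add_single β i n
        simp only [Finsupp.coe_add, Pi.add_apply, Finsupp.single_eq_same]
        push_cast
        linear_combination T o i * this
      · intro i hi
        have : i n = 0 := by
          by_contra hne
          exact hi ⟨i - Finsupp.single n 1, tsub_add_cancel_of_le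
            (Finsupp.single_le_iff.mpr (Nat.one_le_iff_ne_zero.mpr hne))⟩
        rw [this, Nat.cast_zero, zero_mul, zero_mul]
    have h2 := (h1.add (ih.const_mul (b n))).const_mul ((o n : HahnSeries Γ K) + 1)⁻¹
    have h3 := coh_add_single (fun n => β n + b n) o n
    have aux : ∀ {A T₁ T₀ T₂ I B C : HahnSeries Γ K}, A ≠ 0 → A * T₁ = I * T₀ + B * T₂ →
        T₁ * C = A⁻¹ * (I * T₀ * C + B * (T₂ * C)) := by
      intro A T₁ T₀ T₂ I B C hA h
      rw [← mul_assoc B, ← add_mul, ← h, ← mul_assoc, inv_mul_cancel_left₀ hA]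
    convert h2 using 1
    · exact funext fun i => aux hn (h.col o i n)
    · rw [mul_comm, aux hn (h3.trans (add_mul _ _ _))]
      ring

/-- The matrix of the multiplication by a coherent state. -/
def cohMul {L : Type*} [Field L] (γ : ℕ+ → L) (o i : FockIdx) : L :=
  open Classical in if i ≤ o then coh γ (o - i) else 0

lemma isVertexOp_cohMul {L : Type*} [Field L] [CharZero L] (γ : ℕ+ → L) :
    IsVertexOp γ (fun _ => 0) 1 (cohMul γ) where
  vac := by simp [cohMul, coh_zero_index]
  row i n := by
    rw [zero_mul, cohMul, if_neg]
    intro h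
    have := h n
    simp at this
  col o i n := by
    have hsub : ∀ {i o : FockIdx}, i ≤ o → ((o - i) n : L) + i n = o n := by
      intro i o h
      have := h n
      rw [Finsupp.tsub_apply, Nat.cast_sub this]
      ring
    by_cases hin : i n = 0
    · have h1 : i ≤ o + Finsupp.single n 1 ↔ i ≤ o := by
        refine ⟨fun h k => ?_, fun h => h.trans le_self_add⟩
        rcases eq_or_ne k n with rfl | hk
        · rw [hin]
          exact Nat.zero_le _
        · simpa [Finsupp.single_apply, hk.symm] using h k
      rw [hin, Nat.cast_zero, zero_mul, zero_add, cohMul, cohMul]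
      by_cases h : i ≤ o
      · have h2 := coh_add_single γ (o - i) n
        have h3 := hsub h
        rw [hin, Nat.cast_zero, add_zero] at h3
        rw [if_pos (h1.mpr h), if_pos h, tsub_add_eq_add_tsub h] at *
        rw [← h2, h3]
      · rw [if_neg (mt h1.mp h), if_neg h, mul_zero, mul_zero]
    · have h1 : i - Finsupp.single n 1 ≤ o ↔ i ≤ o + Finsupp.single n 1 := tsub_le_iff_right
      have h2 : o - (i - Finsupp.single n 1) = o + Finsupp.single n 1 - i := by
        ext k
        rcases eq_or_ne k n with rfl | hk
        · simp only [Finsupp.tsub_apply, Finsupp.add_apply, Finsupp.single_eq_same]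
          omega
        · simp [hk.symm]
      rw [cohMul, cohMul, cohMul, h2]
      by_cases h : i ≤ o
      · have h3 := coh_add_single γ (o - i) n
        have h4 := hsub h
        have h5 : i ≤ o + Finsupp.single n 1 := h.trans le_self_add
        rw [tsub_add_eq_add_tsub h] at h3
        rw [if_pos h5, if_pos (h1.mpr h5), if_pos h]
        linear_combination h3 - coh γ (o + Finsupp.single n 1 - i) * h4
      · rw [if_neg h, mul_zero, add_zero]
        by_cases h5 : i ≤ o + Finsupp.single n 1
        · rw [if_pos h5, if_pos (h1.mpr h5)]
          have : i n = o n + 1 := by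
            refine le_antisymm (by simpa using h5 n) ?_
            by_contra hlt
            refine h fun k => ?_
            rcases eq_or_ne k n with rfl | hk
            · omega
            · simpa [Finsupp.single_apply, hk.symm] using h5 k
          rw [this]
          push_cast
          ring
        · rw [if_neg h5, if_neg (mt h1.mp h5), mul_zero, mul_zero]

/-- Masses are multiplicative: the operator of multiplication by the coherent state is a vertex
operator. -/
lemma HasMass.add {γ γ' : ℕ+ → HahnSeries Γ K} {E E' : HahnSeries Γ K} (h : HasMass γ E)
    (h' : HasMass γ' E') : HasMass (fun n => γ n + γ' n) (E * E') := by
  have h1 : HasHahnSum (fun p : FockIdx × FockIdx => cohMul γ' p.1 p.2 * coh γ p.2) (E * E') := by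
    rw [← hasHahnSum_comp_injective (e := fun p : FockIdx × FockIdx => (p.1 + p.2, p.1))]
    · convert h.mul h' using 2 with p
      rw [cohMul, if_pos le_self_add, add_tsub_cancel_left, mul_comm]
    · rintro ⟨a, b⟩ ⟨c, d⟩ hp
      obtain ⟨h1, rfl⟩ := Prod.mk.inj hp
      exact Prod.ext rfl (add_left_cancel h1)
    · rintro ⟨a, b⟩ hp
      rw [cohMul, if_neg, zero_mul]
      exact fun hle => hp ⟨(b, a - b), Prod.ext (add_tsub_cancel_of_le hle) rfl⟩
  have h2 := fun o => (isVertexOp_cohMul γ').hasHahnSum_coh (β := γ) (E := 1)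
    (by simpa using hasMass_zero) o
  simp only [one_mul] at h2
  exact h1.sigma h2

lemma HasMass.sum {ι : Type*} (s : Finset ι) {γ : ι → ℕ+ → HahnSeries Γ K}
    {E : ι → HahnSeries Γ K} (h : ∀ i ∈ s, HasMass (γ i) (E i)) :
    HasMass (fun n => ∑ i ∈ s, γ i n) (∏ i ∈ s, E i) := by
  classical
  induction s using Finset.induction_on with
  | empty => simpa using hasMass_zero
  | insert i s hi ih =>
    simp only [sum_insert hi, prod_insert hi]
    exact (h i (mem_insert_self i s)).add (ih fun j hj => h j (mem_insert_of_mem hj))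

lemma coh_single {ρ : Γ} {κ : K} (a : ℕ+ → K) (m : FockIdx) :
    coh (fun n => a n • HahnSeries.single ρ κ ^ (n : ℕ)) m =
      coh a m • HahnSeries.single ρ κ ^ wt m := by
  induction m using fock_induction with
  | h0 => simp [coh_zero_index, wt_zero]
  | h1 m n ih =>
    have h1 : ((m n : HahnSeries Γ K) + 1) ≠ 0 := by exact_mod_cast Nat.succ_ne_zero (m n)
    refine mul_left_cancel₀ h1 ?_
    rw [coh_add_single, ih, wt_add, wt_single, mul_one, pow_add]
    have h2 := coh_add_single a m n
    have h3 : ((m n : HahnSeries Γ K) + 1) = HahnSeries.C ((m n : K) + 1) := by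
      rw [map_add, map_natCast, map_one]
    rw [h3, ← HahnSeries.C_mul_eq_smul, ← HahnSeries.C_mul_eq_smul, ← HahnSeries.C_mul_eq_smul,
      ← mul_assoc (HahnSeries.C _) (HahnSeries.C _), ← map_mul, h2, map_mul]
    ring

/-- The mass of a coherent state with homogeneous parameters. -/
theorem hasMass_heval {ρ : Γ} (hρ : 0 < ρ) (κ : K) (a : ℕ+ → K) :
    HasMass (fun n => a n • HahnSeries.single ρ κ ^ (n : ℕ))
      (PowerSeries.heval (HahnSeries.single ρ κ) (expSeries K a)) := by
  have hr : 0 < (HahnSeries.single ρ κ : HahnSeries Γ K).orderTop :=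
    lt_of_lt_of_le (by exact_mod_cast hρ) HahnSeries.orderTop_single_le
  obtain ⟨s, hs⟩ := exists_hasHahnSum_of_degree (J := Unit)
    (f := coh fun n => a n • (HahnSeries.single ρ κ : HahnSeries Γ K) ^ (n : ℕ)) (A := 1)
    (strictMono_degree (0 : Γ) (r := fun _ => ρ) fun _ => hρ) (fun m _ => wt m)
    (fun v => (finite_wt_eq (v ())).subset fun m hm => congrFun hm ()) (fun m => by
      refine ⟨coh a m * κ ^ wt m, ?_⟩
      rw [coh_single, HahnSeries.single_pow, ← HahnSeries.C_mul_eq_smul, HahnSeries.C_apply,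
        HahnSeries.single_mul_single]
      simp)
  have h1 : HasHahnSum (fun p : ℕ × FockIdx => open Classical in if wt p.2 = p.1 then
      coh (fun n => a n • (HahnSeries.single ρ κ : HahnSeries Γ K) ^ (n : ℕ)) p.2 else 0) s := by
    rw [← hasHahnSum_comp_injective (e := fun m => (wt m, m))]
    · simpa using hs
    · exact fun m m' h => (Prod.mk.inj h).2
    · rintro ⟨N, m⟩ h
      rw [if_neg]
      exact fun h' => h ⟨m, Prod.ext h' rfl⟩
  have h2 : HasHahnSum (fun N => PowerSeries.coeff N (expSeries K a) •
      (HahnSeries.single ρ κ : HahnSeries Γ K) ^ N) s := by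
    refine h1.sigma fun N => ?_
    convert hasHahnSum_of_finset (s := (finite_wt_eq N).toFinset) (f := fun m => open Classical in
      if wt m = N then coh (fun n => a n • (HahnSeries.single ρ κ : HahnSeries Γ K) ^ (n : ℕ)) m
      else 0) (fun m hm => if_neg fun h => hm (by simpa using h)) using 1
    rw [expSeries, PowerSeries.coeff_mk, ← sum_coh_eq_expCoeff, sum_smul]
    refine sum_congr rfl fun m hm => ?_
    have hm' : wt m = N := by simpa using hm
    rw [if_pos hm', coh_single, hm']
  have h3 : HasHahnSum (fun N => PowerSeries.coeff N (expSeries K a) •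
      (HahnSeries.single ρ κ : HahnSeries Γ K) ^ N)
      (PowerSeries.heval (HahnSeries.single ρ κ) (expSeries K a)) :=
    ⟨_, funext (HahnSeries.SummableFamily.powerSeriesFamily_of_orderTop_pos hr _), rfl⟩
  rw [h3.unique h2]
  exact hs

end CoherentSum

/-! ### Chains of operators -/

section Chain

open Finset

lemma sum_succ_sub_castSucc {G : Type*} [AddCommGroup G] {n : ℕ} (g : Fin (n + 1) → G) :
    ∑ k : Fin n, (g k.succ - g k.castSucc) = g (Fin.last n) - g 0 := by
  have h1 := Fin.sum_univ_succ g
  rw [Fin.sum_univ_castSucc] at h1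
  rw [sum_sub_distrib, sub_eq_sub_iff_add_eq_add, add_comm, ← h1, add_comm]

variable {Γ K X Y J : Type*} [AddCommGroup Γ] [LinearOrder Γ] [IsOrderedAddMonoid Γ] [Field K]

/-- The summands of `M_{n-1} ⋯ M_0 ψ` at the state `y`, where each operator `M_k` has an
internal state; the summation is over the states `p` before each of the operators and over the
internal states `s`. -/
def chainFamily {n : ℕ} (M : Fin n → X → Y → X → HahnSeries Γ K) (ψ : X → HahnSeries Γ K) (y : X)
    (ps : (Fin n → X) × (Fin n → Y)) : HahnSeries Γ K :=
  ψ (Fin.snoc (α := fun _ => X) ps.1 y 0) *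
    ∏ k, M k (Fin.snoc (α := fun _ => X) ps.1 y k.succ) (ps.2 k) (ps.1 k)

lemma chainFamily_snoc {n : ℕ} (M : Fin (n + 1) → X → Y → X → HahnSeries Γ K)
    (ψ : X → HahnSeries Γ K) (y x : X) (t : Y) (p : Fin n → X) (s : Fin n → Y) :
    chainFamily M ψ y (Fin.snoc (α := fun _ => X) p x, Fin.snoc (α := fun _ => Y) s t) =
      M (Fin.last n) y t x * chainFamily (fun k => M k.castSucc) ψ x (p, s) := by
  rw [chainFamily, chainFamily, Fin.prod_univ_castSucc]
  simp only [Fin.snoc_castSucc, Fin.snoc_last, Fin.succ_last, Fin.succ_castSucc]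
  rw [← Fin.castSucc_zero, Fin.snoc_castSucc]
  ring

/-- The entries of the operators are monomials, whose exponents are differences of potentials
up to positive combinations of positive exponents that determine the state and
the internal state up to finitely many possibilities. -/
structure IsGradedChain [Fintype J] {n : ℕ} (M : Fin n → X → Y → X → HahnSeries Γ K)
    (pot : Fin (n + 1) → X → Γ) (r : Fin n → J → Γ)
    (deg : Fin n → X → Y → J → ℕ) : Prop where
  pos : ∀ k j, 0 < r k j
  finite : ∀ k v, {z : X × Y | deg k z.1 z.2 = v}.Finite
  mono : ∀ k y s x, ∃ c, M k y s x = HahnSeries.single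
    (pot k.succ y - pot k.castSucc x + ∑ j, deg k x s j • r k j) c

lemma prod_single {ι : Type*} (s : Finset ι) (g : ι → Γ) (c : ι → K) :
    ∏ i ∈ s, HahnSeries.single (g i) (c i) = HahnSeries.single (∑ i ∈ s, g i) (∏ i ∈ s, c i) := by
  classical
  induction s using Finset.induction_on with
  | empty => simp
  | insert i s hi ih => rw [prod_insert hi, ih, sum_insert hi, prod_insert hi,
      HahnSeries.single_mul_single]

variable [Fintype J]

lemma IsGradedChain.exists_hasHahnSum {n : ℕ} {M : Fin n → X → Y → X → HahnSeries Γ K}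
    {pot : Fin (n + 1) → X → Γ} {r : Fin n → J → Γ}
    {deg : Fin n → X → Y → J → ℕ} (h : IsGradedChain M pot r deg) {ψ : X → HahnSeries Γ K}
    (hψ : ∀ x, ∃ c, ψ x = HahnSeries.single (pot 0 x) c) (y : X) :
    ∃ s, HasHahnSum (chainFamily M ψ y) s := by
  refine exists_hasHahnSum_of_degree (J := Fin n × J) (A := 1)
    (strictMono_degree (pot (Fin.last n) y) (r := fun kj => r kj.1 kj.2)
      fun kj => h.pos kj.1 kj.2)
    (fun ps kj => deg kj.1 (ps.1 kj.1) (ps.2 kj.1) kj.2) (fun v => ?_) fun ps => ?_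
  · have hfin := Set.Finite.pi' (fun k : Fin n => h.finite k fun j => v (k, j))
    refine (hfin.preimage (f := fun ps : (Fin n → X) × (Fin n → Y) => fun k => (ps.1 k, ps.2 k))
      ?_).subset fun ps hps k => ?_
    · rintro ⟨p, s⟩ _ ⟨p', s'⟩ _ heq
      have := fun k => Prod.mk.inj (congrFun heq k)
      exact Prod.ext (funext fun k => (this k).1) (funext fun k => (this k).2)
    · exact funext fun j => congrFun hps (k, j)
  · choose c hc using fun k => h.mono k (Fin.snoc (α := fun _ => X) ps.1 y k.succ) (ps.2 k) (ps.1 k)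
    obtain ⟨c₀, hc₀⟩ := hψ (Fin.snoc (α := fun _ => X) ps.1 y 0)
    refine ⟨c₀ * ∏ k, c k, ?_⟩
    rw [chainFamily, hc₀, prod_congr rfl fun k _ => hc k, prod_single,
      HahnSeries.single_mul_single, one_mul]
    congr 1
    have tel := sum_succ_sub_castSucc fun k => pot k (Fin.snoc (α := fun _ => X) ps.1 y k)
    simp only [Fin.snoc_castSucc, Fin.snoc_last] at tel
    rw [sum_add_distrib, tel, Fintype.sum_prod_type]
    abel_nf

lemma IsGradedChain.comp {Y' : Type*} {n : ℕ} {M : Fin n → X → Y → X → HahnSeries Γ K}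
    {pot : Fin (n + 1) → X → Γ} {r : Fin n → J → Γ} {deg : Fin n → X → Y → J → ℕ}
    (h : IsGradedChain M pot r deg) {f : Fin n → Y' → Y} (hf : ∀ k, (f k).Injective) :
    IsGradedChain (fun k y s x => M k y (f k s) x) pot r (fun k x s => deg k x (f k s)) where
  pos := h.pos
  finite k v := by
    refine ((h.finite k v).preimage (f := Prod.map id (f k))
      (Function.injective_id.prodMap (hf k)).injOn).subset fun z hz => hz
  mono k y s x := h.mono k y (f k s) x

/-- The evaluation of a chain of operators, one after the other. -/
theorem IsGradedChain.hasHahnSum {n : ℕ} {M : Fin n → X → Y → X → HahnSeries Γ K}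
    {pot : Fin (n + 1) → X → Γ} {r : Fin n → J → Γ}
    {deg : Fin n → X → Y → J → ℕ} (h : IsGradedChain M pot r deg)
    {ψ : Fin (n + 1) → X → HahnSeries Γ K}
    (hψ : ∀ x, ∃ c, ψ 0 x = HahnSeries.single (pot 0 x) c)
    {C : Fin n → HahnSeries Γ K}
    (step : ∀ k y c T, HasHahnSum (fun z : X × Y => M k y z.2 z.1 * (c * ψ k.castSucc z.1)) T →
      T = c * (C k * ψ k.succ y)) (y : X) :
    HasHahnSum (chainFamily M (ψ 0) y) ((∏ k, C k) * ψ (Fin.last n) y) := by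
  induction n generalizing y with
  | zero =>
    have : Unique ((Fin 0 → X) × (Fin 0 → Y)) := ⟨⟨Fin.elim0, Fin.elim0⟩, fun _ =>
      Prod.ext (Subsingleton.elim _ _) (Subsingleton.elim _ _)⟩
    have := hasHahnSum_unique (chainFamily M (ψ 0) y)
    simpa [chainFamily, Fin.snoc] using this
  | succ n ih =>
    have h' : IsGradedChain (fun k : Fin n => M k.castSucc) (fun k => pot k.castSucc)
        (fun k => r k.castSucc) (fun k => deg k.castSucc) :=
      ⟨fun k => h.pos _, fun k => h.finite _, fun k => h.mono _⟩
    have ih' := ih h' (ψ := fun k => ψ k.castSucc) hψ (C := fun k => C k.castSucc)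
      (fun k => step k.castSucc)
    obtain ⟨T, hT⟩ := h.exists_hasHahnSum hψ y
    let E : (X × Y) × ((Fin n → X) × (Fin n → Y)) ≃ (Fin (n + 1) → X) × (Fin (n + 1) → Y) :=
      (Equiv.prodProdProdComm X Y (Fin n → X) (Fin n → Y)).trans
        (Equiv.prodCongr (Fin.snocEquiv fun _ => X) (Fin.snocEquiv fun _ => Y))
    have hE : ∀ z, chainFamily M (ψ 0) y (E z) = M (Fin.last n) y z.1.2 z.1.1 *
        chainFamily (fun k => M k.castSucc) (ψ 0) z.1.1 z.2 := fun z =>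
      chainFamily_snoc M (ψ 0) y z.1.1 z.1.2 z.2.1 z.2.2
    have h1 := (hasHahnSum_comp_equiv E).mpr hT
    simp only [hE] at h1
    have h2 := h1.sigma fun z => (ih' z.1).const_mul (M (Fin.last n) y z.2 z.1)
    rw [Fin.prod_univ_castSucc, mul_assoc, ← Fin.succ_last, ← step (Fin.last n) y _ _ h2]
    exact hT

/-- A fourfold sum of products is evaluated as the product of two twofold sums. -/
lemma eq_of_hasHahnSum_two_lines {α α' κ κ' : Type*} {f : κ → α → HahnSeries Γ K}
    {f' : κ' → α' → HahnSeries Γ K} {g : κ → HahnSeries Γ K} {g' : κ' → HahnSeries Γ K}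
    {s s' T : HahnSeries Γ K} (hf : ∀ c, HasHahnSum (f c) (g c)) (hg : HasHahnSum g s)
    (hf' : ∀ c, HasHahnSum (f' c) (g' c)) (hg' : HasHahnSum g' s')
    (hT : HasHahnSum (fun z : (α × α') × (κ × κ') => f z.2.1 z.1.1 * f' z.2.2 z.1.2) T) :
    T = s * s' := by
  have h1 : HasHahnSum (fun z : (κ × κ') × (α × α') => f z.1.1 z.2.1 * f' z.1.2 z.2.2) T :=
    (hasHahnSum_comp_equiv (Equiv.prodComm (κ × κ') (α × α'))
      (f := fun z : (α × α') × (κ × κ') => f z.2.1 z.1.1 * f' z.2.2 z.1.2)).mpr hT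
  have h2 : ∀ c : κ × κ', HasHahnSum (fun z : α × α' => f c.1 z.1 * f' c.2 z.2)
      (g c.1 * g' c.2) := fun c => (hf c.1).mul (hf' c.2)
  have h3 : HasHahnSum (fun c : κ × κ' => g c.1 * g' c.2) T := h1.sigma h2
  exact h3.unique (hg.mul hg')

variable [CharZero K]

/-- Two successive vertex operators map a coherent state to a coherent state. -/
lemma hasHahnSum_two_step {b₁ c₁ b₂ c₂ : ℕ+ → HahnSeries Γ K} {τ₁ τ₂ : HahnSeries Γ K}
    {V₁ V₂ : FockIdx → FockIdx → HahnSeries Γ K} (h₁ : IsVertexOp b₁ c₁ τ₁ V₁)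
    (h₂ : IsVertexOp b₂ c₂ τ₂ V₂) {β : ℕ+ → HahnSeries Γ K} {E₁ E₂ : HahnSeries Γ K}
    (hE₁ : HasMass (fun n => c₁ n * β n) E₁) (hE₂ : HasMass (fun n => c₂ n * (β n + b₁ n)) E₂)
    (y : FockIdx) :
    (∀ c, HasHahnSum (fun a => V₂ y c * (V₁ c a * coh β a))
      (V₂ y c * (τ₁ * E₁ * coh (fun n => β n + b₁ n) c))) ∧
    HasHahnSum (fun c => V₂ y c * (τ₁ * E₁ * coh (fun n => β n + b₁ n) c))
      (τ₁ * E₁ * (τ₂ * E₂) * coh (fun n => β n + b₁ n + b₂ n) y) := by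
  refine ⟨fun c => (h₁.hasHahnSum_coh hE₁ c).const_mul _, ?_⟩
  convert (h₂.hasHahnSum_coh hE₂ y).const_mul (τ₁ * E₁) using 1
  · exact funext fun c => mul_left_comm _ _ _
  · ring

end Chain

/-! ### Contractions in the field of Hahn series -/

section Masses

open Finset

section Constants

variable {L : Type*} [Field L] [Algebra BaseField L]

lemma algebraMap_qq : algebraMap BaseField L (qq BaseField) = qq L := by
  simp [qq, qRoot]

lemma algebraMap_tt : algebraMap BaseField L (tt BaseField) = tt L := by
  simp [tt, tRoot]

lemma algebraMap_qtHalf : algebraMap BaseField L (qtHalf BaseField) = qtHalf L := by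
  simp [qtHalf, qtQuarter, qRoot, tRoot]

lemma algebraMap_rowChar (q t : BaseField) (la : YoungDiagram) (n : ℕ) :
    algebraMap BaseField L (rowChar q t la n) =
      rowChar (algebraMap BaseField L q) (algebraMap BaseField L t) la n := by
  simp [rowChar, rowVar]

lemma algebraMap_contr (la mu : YoungDiagram) (n : ℕ+) :
    algebraMap BaseField L (contr BaseField la mu n) = contr L la mu n := by
  simp [contr, algebraMap_rowChar, algebraMap_qq, algebraMap_tt]

lemma algebraMap_nekN (la mu : YoungDiagram) (z : BaseField) :
    algebraMap BaseField L (nekN la mu z) = nekN la mu (algebraMap BaseField L z) := by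
  simp [nekN, algebraMap_qq, algebraMap_tt]

lemma starC_mul_starB (u u' : L) (la mu : YoungDiagram) (n : ℕ+) :
    starC u' mu n * starB u la n = -contr L la mu n * (u / u') ^ (n : ℕ) := by
  have hp : qtHalf L ^ (n : ℕ) ≠ 0 := pow_ne_zero _ (qtHalf_ne_zero L)
  rw [starC, starB, contr]
  simp only [mul_pow, div_pow, inv_pow]
  field_simp

lemma phiC_mul_phiB (v v' : L) (la mu : YoungDiagram) (n : ℕ+) :
    phiC v' mu n * phiB v la n = -contr L la mu n * (qq L / tt L * (v / v')) ^ (n : ℕ) := by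
  rw [phiC, phiB, contr]
  simp only [mul_pow, div_pow, inv_pow]
  field_simp

lemma phiC_mul_starB (u v' : L) (la mu : YoungDiagram) (n : ℕ+) :
    phiC v' mu n * starB u la n = contr L la mu n * (qtHalf L * (u / v')) ^ (n : ℕ) := by
  have hp : qtHalf L ^ (n : ℕ) ≠ 0 := pow_ne_zero _ (qtHalf_ne_zero L)
  have h2 : qq L / tt L = qtHalf L * qtHalf L := by rw [← qtHalf_sq, sq]
  rw [phiC, starB, contr, h2]
  simp only [mul_pow, div_pow, inv_pow]
  field_simp

lemma starC_mul_phiB (v u' : L) (la mu : YoungDiagram) (n : ℕ+) :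
    starC u' mu n * phiB v la n = contr L la mu n * (qtHalf L * (v / u')) ^ (n : ℕ) := by
  rw [starC, phiB, contr]
  simp only [mul_pow, div_pow, inv_pow]
  field_simp

end Constants

variable {Γ : Type*} [AddCommGroup Γ] [LinearOrder Γ] [IsOrderedAddMonoid Γ]

lemma heval_nekSeries {ρ : Γ} (hρ : 0 < ρ) (κ : BaseField) (la mu : YoungDiagram) :
    PowerSeries.heval (HahnSeries.single ρ κ) (nekSeries BaseField la mu) =
      nekN la mu (HahnSeries.single ρ κ) := by
  have hr : 0 < (HahnSeries.single ρ κ : HahnSeries Γ BaseField).orderTop :=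
    lt_of_lt_of_le (by exact_mod_cast hρ) HahnSeries.orderTop_single_le
  have h1 : ∀ c : BaseField, PowerSeries.heval (HahnSeries.single ρ κ) (oneSub c) =
      1 - HahnSeries.single ρ κ * algebraMap BaseField (HahnSeries Γ BaseField) c := by
    intro c
    rw [oneSub, map_sub, map_one, map_mul, PowerSeries.heval_X _ hr, PowerSeries.heval_C,
      Algebra.algebraMap_eq_smul_one, mul_comm]
  rw [nekSeries, nekN, map_mul, map_prod, map_prod]
  simp only [h1, map_mul, map_zpow₀, algebraMap_qq, algebraMap_tt, ← mul_assoc]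

lemma calG_eq : calG = expSeries BaseField fun n : ℕ+ => -(1 / (((n : ℕ) : BaseField) *
    ((1 - qq BaseField ^ (n : ℕ)) * (1 - (tt BaseField)⁻¹ ^ (n : ℕ))))) := rfl

lemma evalG_ne_zero (z : HahnSeries Γ BaseField) : evalG z ≠ 0 := by
  have h := expSeries_neg_mul fun n : ℕ+ => -(1 / (((n : ℕ) : BaseField) *
    ((1 - qq BaseField ^ (n : ℕ)) * (1 - (tt BaseField)⁻¹ ^ (n : ℕ)))))
  rw [← calG_eq] at h
  have := congrArg (PowerSeries.heval z) h
  rw [map_mul, map_one] at this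
  exact right_ne_zero_of_mul_eq_one this

lemma heval_expSeries_contr_mul {ρ : Γ} (hρ : 0 < ρ) (κ : BaseField) (la mu : YoungDiagram) :
    PowerSeries.heval (HahnSeries.single ρ κ)
      (expSeries BaseField fun n => -contr BaseField la mu n) *
        nekN la mu (HahnSeries.single ρ κ) = evalG (HahnSeries.single ρ κ) := by
  rw [← heval_nekSeries hρ, ← map_mul, expSeries_neg_contr_mul]
  rfl

lemma nekN_ne_zero {ρ : Γ} (hρ : 0 < ρ) (κ : BaseField) (la mu : YoungDiagram) :
    nekN la mu (HahnSeries.single ρ κ) ≠ 0 :=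
  right_ne_zero_of_mul (heval_expSeries_contr_mul hρ κ la mu ▸ evalG_ne_zero _)

/-- The contraction of two vertex operators of the same kind. -/
lemma hasMass_neg_contr {ρ : Γ} (hρ : 0 < ρ) (κ : BaseField) (la mu : YoungDiagram) :
    HasMass (fun n => -contr (HahnSeries Γ BaseField) la mu n *
        HahnSeries.single ρ κ ^ (n : ℕ))
      (evalG (HahnSeries.single ρ κ) / nekN la mu (HahnSeries.single ρ κ)) := by
  have h := hasMass_heval hρ κ fun n => -contr BaseField la mu n
  rw [← heval_expSeries_contr_mul hρ κ la mu, mul_div_cancel_right₀ _ (nekN_ne_zero hρ κ la mu)]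
  convert h using 2 with n
  rw [← algebraMap_contr, ← map_neg, Algebra.smul_def]

/-- The contraction of two vertex operators of different kinds. -/
lemma hasMass_contr {ρ : Γ} (hρ : 0 < ρ) (κ : BaseField) (la mu : YoungDiagram) :
    HasMass (fun n => contr (HahnSeries Γ BaseField) la mu n *
        HahnSeries.single ρ κ ^ (n : ℕ))
      (nekN la mu (HahnSeries.single ρ κ) / evalG (HahnSeries.single ρ κ)) := by
  have h := hasMass_heval hρ κ fun n => contr BaseField la mu n
  have h1 := congrArg (PowerSeries.heval (HahnSeries.single ρ κ))
    (expSeries_neg_mul fun n => contr BaseField la mu n)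
  rw [map_mul, map_one] at h1
  rw [← heval_expSeries_contr_mul hρ κ la mu, div_mul_cancel_right₀ (nekN_ne_zero hρ κ la mu),
    ← eq_inv_of_mul_eq_one_right h1]
  convert h using 2 with n
  rw [← algebraMap_contr, Algebra.smul_def]

end Masses

/-! ### The exponents of the matrix elements -/

section Exponents

open Finset

variable {Γ : Type*} [AddCommGroup Γ] [LinearOrder Γ] [IsOrderedAddMonoid Γ]

lemma IsVertexOp.exists_eq_single {K : Type*} [Field K] [CharZero K]
    {b c : ℕ+ → HahnSeries Γ K} {τ : HahnSeries Γ K}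
    {T : FockIdx → FockIdx → HahnSeries Γ K} (h : IsVertexOp b c τ T) {ζ : Γ}
    (hb : ∀ n : ℕ+, ∃ κ, b n = HahnSeries.single ((n : ℕ) • ζ) κ)
    (hc : ∀ n : ℕ+, ∃ κ, c n = HahnSeries.single (-((n : ℕ) • ζ)) κ) (o i : FockIdx) :
    ∃ κ, T o i = τ * HahnSeries.single (wt o • ζ - wt i • ζ) κ := by
  induction o using fock_induction generalizing i with
  | h0 =>
    induction i using fock_induction with
    | h0 => exact ⟨1, by rw [h.vac]; simp [wt_zero]⟩
    | h1 i n ih =>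
      obtain ⟨κ, hκ⟩ := ih
      obtain ⟨κ', hκ'⟩ := hc n
      refine ⟨κ' * κ, ?_⟩
      rw [h.row, hκ, hκ', mul_left_comm, HahnSeries.single_mul_single]
      rw [wt_add, wt_single, mul_one, add_smul, ← neg_add_eq_sub, ← neg_add_eq_sub, neg_add_rev,
        add_assoc]
  | h1 o n ih =>
    have hn : (o n : K) + 1 ≠ 0 := by exact_mod_cast Nat.succ_ne_zero (o n)
    obtain ⟨κ, hκ⟩ := hb n
    obtain ⟨κ₁, hκ₁⟩ := ih i
    have h1 : ∃ κ₀, (i n : HahnSeries Γ K) * T o (i - Finsupp.single n 1) = τ *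
        HahnSeries.single (wt (o + Finsupp.single n 1) • ζ - wt i • ζ) κ₀ := by
      rcases Nat.eq_zero_or_pos (i n) with h0 | h0
      · exact ⟨0, by simp [h0]⟩
      · obtain ⟨κ₂, hκ₂⟩ := ih (i - Finsupp.single n 1)
        have hi : i - Finsupp.single n 1 + Finsupp.single n 1 = i :=
          tsub_add_cancel_of_le (Finsupp.single_le_iff.mpr h0)
        refine ⟨(i n : K) * κ₂, ?_⟩
        have hcast : (i n : HahnSeries Γ K) = HahnSeries.single 0 (i n : K) := by
          rw [← HahnSeries.C_apply, map_natCast]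
        rw [hκ₂, hcast, mul_left_comm, HahnSeries.single_mul_single, zero_add]
        have hw : wt (o + Finsupp.single n 1) • ζ - wt i • ζ =
            wt o • ζ - wt (i - Finsupp.single n 1) • ζ := by
          conv_lhs => rw [← hi]
          rw [wt_add, wt_add, add_smul, add_smul, add_sub_add_right_eq_sub]
        rw [hw]
    obtain ⟨κ₀, hκ₀⟩ := h1
    refine ⟨((o n : K) + 1)⁻¹ * (κ₀ + κ * κ₁), ?_⟩
    have hcast : (o n : HahnSeries Γ K) + 1 = HahnSeries.single 0 ((o n : K) + 1) := by
      rw [← HahnSeries.C_apply, map_add, map_natCast, map_one]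
    have hn' : (HahnSeries.single (0 : Γ) ((o n : K) + 1)) ≠ 0 :=
      HahnSeries.single_ne_zero hn
    refine mul_left_cancel₀ hn' ?_
    rw [← hcast, h.col, hκ₀, hκ, hκ₁, hcast, mul_left_comm _ τ, mul_left_comm _ τ, ← mul_add,
      HahnSeries.single_mul_single, HahnSeries.single_mul_single, zero_add,
      mul_inv_cancel_left₀ hn, HahnSeries.single_add, wt_add, wt_single, mul_one, add_smul,
      ← add_sub_assoc, add_comm (n.val • ζ)]

variable {g : Γ} {c : BaseField}

lemma algebraMap_mul_single_pow (κ : BaseField) (n : ℕ) :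
    algebraMap BaseField (HahnSeries Γ BaseField) κ * HahnSeries.single g c ^ n =
      HahnSeries.single (n • g) (κ * c ^ n) := by
  have h : algebraMap BaseField (HahnSeries Γ BaseField) κ = HahnSeries.single 0 κ := rfl
  rw [HahnSeries.single_pow, h, HahnSeries.single_mul_single, zero_add]

lemma starB_eq_single (la : YoungDiagram) (n : ℕ+) :
    ∃ κ, starB (HahnSeries.single g c) la n = HahnSeries.single ((n : ℕ) • g) κ := by
  refine ⟨_, Eq.trans ?_ (algebraMap_mul_single_pow (g := g) (c := c)
    ((qtHalf BaseField)⁻¹ ^ (n : ℕ) / ((n : ℕ) * (1 - qq BaseField ^ (n : ℕ))) *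
    rowChar (qq BaseField) (tt BaseField) la n) n)⟩
  simp only [starB, map_mul, map_div₀, map_pow, map_inv₀, map_sub, map_one, map_natCast,
    algebraMap_rowChar, algebraMap_qq, algebraMap_tt, algebraMap_qtHalf]
  ring

lemma phiB_eq_single (la : YoungDiagram) (n : ℕ+) :
    ∃ κ, phiB (HahnSeries.single g c) la n = HahnSeries.single ((n : ℕ) • g) κ := by
  refine ⟨_, Eq.trans ?_ (algebraMap_mul_single_pow (g := g) (c := c)
    (-(1 / ((n : ℕ) * (1 - qq BaseField ^ (n : ℕ)))) *
    rowChar (qq BaseField) (tt BaseField) la n) n)⟩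
  simp only [phiB, map_mul, map_neg, map_div₀, map_pow, map_sub, map_one, map_natCast,
    algebraMap_rowChar, algebraMap_qq, algebraMap_tt]
  ring

lemma starC_eq_single (la : YoungDiagram) (n : ℕ+) :
    ∃ κ, starC (HahnSeries.single g c) la n = HahnSeries.single (-((n : ℕ) • g)) κ := by
  rw [← smul_neg]
  refine ⟨_, Eq.trans ?_ (algebraMap_mul_single_pow (g := -g) (c := c⁻¹)
    (-(qtHalf BaseField ^ (n : ℕ) / (1 - (tt BaseField)⁻¹ ^ (n : ℕ))) *
    rowChar (qq BaseField)⁻¹ (tt BaseField)⁻¹ la n) n)⟩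
  rw [← HahnSeries.inv_single]
  simp only [starC, map_mul, map_neg, map_div₀, map_pow, map_inv₀, map_sub, map_one,
    algebraMap_rowChar, algebraMap_qq, algebraMap_tt, algebraMap_qtHalf]
  ring

lemma phiC_eq_single (la : YoungDiagram) (n : ℕ+) :
    ∃ κ, phiC (HahnSeries.single g c) la n = HahnSeries.single (-((n : ℕ) • g)) κ := by
  rw [← smul_neg]
  refine ⟨_, Eq.trans ?_ (algebraMap_mul_single_pow (g := -g) (c := c⁻¹)
    ((qq BaseField / tt BaseField) ^ (n : ℕ) / (1 - (tt BaseField)⁻¹ ^ (n : ℕ)) *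
    rowChar (qq BaseField)⁻¹ (tt BaseField)⁻¹ la n) n)⟩
  rw [← HahnSeries.inv_single]
  simp only [phiC, map_mul, map_div₀, map_pow, map_inv₀, map_sub, map_one,
    algebraMap_rowChar, algebraMap_qq, algebraMap_tt]
  ring

lemma IsPhi.exists_eq_single {N : ℤ} {u w : HahnSeries Γ BaseField}
    {T : FockIdx → YoungDiagram × FockIdx → HahnSeries Γ BaseField}
    (h : IsPhi N (HahnSeries.single g c) u w T) (la : YoungDiagram) (o i : FockIdx) :
    ∃ κ, T o (la, i) = T 0 (la, 0) * HahnSeries.single (wt o • g - wt i • g) κ :=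
  (h.isVertexOp la).exists_eq_single (phiB_eq_single la) (phiC_eq_single la) o i

lemma IsPhiStar.exists_eq_single {N : ℤ} {v w : HahnSeries Γ BaseField}
    {T : FockIdx × YoungDiagram → FockIdx → HahnSeries Γ BaseField}
    (h : IsPhiStar N v (HahnSeries.single g c) w T) (la : YoungDiagram) (o i : FockIdx) :
    ∃ κ, T (o, la) i = T (0, la) 0 * HahnSeries.single (wt o • g - wt i • g) κ :=
  (h.isVertexOp la).exists_eq_single (starB_eq_single la) (starC_eq_single la) o i

/-- The product of the vacuum entries of `Φ_λ` and `Φ*_λ` is a monomial, whose exponent is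
proportional to `|λ|`. -/
lemma exists_vacuum_mul_vacuum_eq_single {N : ℤ} {gw gw' : Γ} {cw cw' : BaseField} (hc : c ≠ 0)
    (hcw' : cw' ≠ 0) {u u' : HahnSeries Γ BaseField}
    {T : FockIdx → YoungDiagram × FockIdx → HahnSeries Γ BaseField}
    {T' : FockIdx × YoungDiagram → FockIdx → HahnSeries Γ BaseField}
    (h : IsPhi N (HahnSeries.single g c) u (HahnSeries.single gw cw) T)
    (h' : IsPhiStar (N - 1) u' (HahnSeries.single g c) (HahnSeries.single gw' cw') T')
    (la : YoungDiagram) :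
    ∃ κ, T 0 (la, 0) * T' (0, la) 0 = HahnSeries.single (la.card • (gw - gw' - g)) κ := by
  have h1 := vacuum_mul_vacuum h h' (HahnSeries.single_ne_zero hc)
    (HahnSeries.single_ne_zero hcw') la
  have h2 : nekN la la (1 : HahnSeries Γ BaseField) =
      algebraMap BaseField _ (nekN la la (1 : BaseField)) := by
    rw [algebraMap_nekN, map_one]
  rw [prod_mul_distrib, prod_const, prod_mul_distrib, prod_const, ← eq_div_iff
    (nekN_self_ne_zero la), h2, ← algebraMap_qtHalf] at h1
  have h3 : ∏ s ∈ la.cells, (content (HahnSeries Γ BaseField) s)⁻¹ =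
      algebraMap BaseField _ (∏ s ∈ la.cells, (content BaseField s)⁻¹) := by
    simp [content, algebraMap_qq, algebraMap_tt]
  rw [h3, HahnSeries.single_mul_single, HahnSeries.single_div_single] at h1
  refine ⟨_, Eq.trans (h1.trans ?_) (algebraMap_mul_single_pow (g := gw - gw' - g)
    (c := cw / (cw' * c)) (((qtHalf BaseField)⁻¹ ^ 2) ^ la.card *
      (∏ s ∈ la.cells, (content BaseField s)⁻¹) / nekN la la (1 : BaseField)) la.card)⟩
  rw [map_div₀ (algebraMap _ _), map_mul (algebraMap _ _), map_pow (algebraMap _ _),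
    map_pow (algebraMap _ _), map_inv₀ (algebraMap _ _), ← sub_sub, YoungDiagram.card]
  ring

end Exponents

/-! ### The network of intertwining operators -/

section Network

open Finset

variable {Γ : Type*} [AddCommGroup Γ] [LinearOrder Γ] [IsOrderedAddMonoid Γ] {N : ℕ}

/-- The assumptions on the operators of the network: `gw`, `gx`, `gy` are the exponents of the
spectral parameters of the vertical edges, and `gus`, `gvs` those of the horizontal modules at the
beginning of each of the six point operators. -/
structure IsNetwork (gw gx gy gus gvs : Fin N → Γ)
    (S₁ S₂ : Fin N → FockIdx × YoungDiagram → FockIdx → HahnSeries Γ BaseField)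
    (P₁ P₂ : Fin N → FockIdx → YoungDiagram × FockIdx → HahnSeries Γ BaseField) : Prop where
  S₁ : ∀ k, ∃ a, IsPhiStar (0 - 1) a (HahnSeries.single (gw k) (-1))
    (HahnSeries.single (gus k) 1) (S₁ k)
  P₁ : ∀ k, ∃ a, IsPhi 0 (HahnSeries.single (gw k) (-1)) a
    (HahnSeries.single (gvs k + gw k) 1) (P₁ k)
  P₂ : ∀ k, ∃ a b, IsPhi (-1) (HahnSeries.single (gx k) (-1)) a b (P₂ k)
  S₂ : ∀ k, ∃ a b, IsPhiStar 0 a (HahnSeries.single (gy k) (-1)) b (S₂ k)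
  x_lt_w : ∀ k, gx k < gw k
  y_lt_w : ∀ k, gy k < gw k
  w_lt_x : ∀ i k, i < k → gw k < gx i
  w_lt_y : ∀ i k, i < k → gw k < gy i
  u_lt_v : ∀ k, gus k < gvs k

variable {gw gx gy gus gvs : Fin N → Γ}
  {S₁ S₂ : Fin N → FockIdx × YoungDiagram → FockIdx → HahnSeries Γ BaseField}
  {P₁ P₂ : Fin N → FockIdx → YoungDiagram × FockIdx → HahnSeries Γ BaseField}

lemma finite_card_eq (n : ℕ) : {μ : YoungDiagram | μ.card = n}.Finite := by
  refine ((Finset.powerset (range n ×ˢ range n)).finite_toSet.preimage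
    (f := YoungDiagram.cells) (fun μ _ ν _ h => YoungDiagram.ext h)).subset fun μ hμ => ?_
  rw [Set.mem_preimage, mem_coe, mem_powerset]
  intro s hs
  have hs' : (s.1, s.2) ∈ μ := hs
  rw [← hμ, mem_product, mem_range, mem_range]
  refine ⟨(YoungDiagram.mem_iff_lt_colLen.mp hs').trans_le ?_,
    (YoungDiagram.mem_iff_lt_rowLen.mp hs').trans_le ?_⟩
  · rw [YoungDiagram.colLen_eq_card]
    exact card_le_card (filter_subset _ _)
  · rw [YoungDiagram.rowLen_eq_card]
    exact card_le_card (filter_subset _ _)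

/-- The summands of the matrix elements of a six point operator are monomials. -/
lemma IsNetwork.sixPointTerm_eq_single (h : IsNetwork gw gx gy gus gvs S₁ S₂ P₁ P₂) (k : Fin N)
    (o : FockIdx × FockIdx × YoungDiagram) (i : YoungDiagram × FockIdx × FockIdx)
    (s : FockIdx × YoungDiagram × FockIdx) :
    ∃ κ, sixPointTerm (S₁ k) (P₁ k) (P₂ k) (S₂ k) o i s =
      (P₂ k 0 (i.1, 0) * S₂ k (0, o.2.2) 0) *
      HahnSeries.single (wt o.1 • gx k + wt o.2.1 • gy k - wt i.2.1 • gw k - wt i.2.2 • gw k +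
        (wt s.1 • (gw k - gx k) + wt s.2.2 • (gw k - gy k) +
          s.2.1.card • (gvs k - gus k))) κ := by
  obtain ⟨a₁, h₁⟩ := h.S₁ k
  obtain ⟨a₂, h₂⟩ := h.P₁ k
  obtain ⟨a₃, b₃, h₃⟩ := h.P₂ k
  obtain ⟨a₄, b₄, h₄⟩ := h.S₂ k
  obtain ⟨κ₁, e₁⟩ := h₁.exists_eq_single s.2.1 s.1 i.2.1
  obtain ⟨κ₂, e₂⟩ := h₂.exists_eq_single s.2.1 s.2.2 i.2.2
  obtain ⟨κ₃, e₃⟩ := h₃.exists_eq_single i.1 o.1 s.1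
  obtain ⟨κ₄, e₄⟩ := h₄.exists_eq_single o.2.2 o.2.1 s.2.2
  obtain ⟨κ₅, e₅⟩ := exists_vacuum_mul_vacuum_eq_single (neg_ne_zero.mpr one_ne_zero) one_ne_zero
    h₂ h₁ s.2.1
  refine ⟨κ₁ * κ₂ * κ₃ * κ₄ * κ₅, ?_⟩
  have hs : sixPointTerm (S₁ k) (P₁ k) (P₂ k) (S₂ k) o i s =
      (P₂ k o.1 (i.1, s.1) * S₂ k (o.2.1, o.2.2) s.2.2) * P₁ k s.2.2 (s.2.1, i.2.2) *
        S₁ k (s.1, s.2.1) i.2.1 := rfl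
  rw [hs, e₁, e₂, e₃, e₄]
  have hre : ∀ p q r t b c d f : HahnSeries Γ BaseField,
      (p * b * (q * c)) * (r * d) * (t * f) = (p * q) * (f * d * b * c * (r * t)) := by
    intros; ring
  rw [hre, e₅]
  simp only [HahnSeries.single_mul_single]
  congr 2
  simp only [smul_sub, smul_add]
  abel_nf

/-- The six point operators are well defined. -/
lemma IsNetwork.exists_hasHahnSum_sixPointTerm (h : IsNetwork gw gx gy gus gvs S₁ S₂ P₁ P₂)
    (k : Fin N) (o : FockIdx × FockIdx × YoungDiagram) (i : YoungDiagram × FockIdx × FockIdx) :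
    ∃ s, HasHahnSum (sixPointTerm (S₁ k) (P₁ k) (P₂ k) (S₂ k) o i) s := by
  refine exists_hasHahnSum_of_degree (J := Fin 3) (A := P₂ k 0 (i.1, 0) * S₂ k (0, o.2.2) 0)
    (strictMono_degree (wt o.1 • gx k + wt o.2.1 • gy k - wt i.2.1 • gw k - wt i.2.2 • gw k)
      (r := ![gw k - gx k, gw k - gy k, gvs k - gus k]) ?_)
    (fun s => ![wt s.1, wt s.2.2, s.2.1.card]) (fun v => ?_) fun s => ?_
  · intro j
    fin_cases j
    exacts [sub_pos.mpr (h.x_lt_w k), sub_pos.mpr (h.y_lt_w k), sub_pos.mpr (h.u_lt_v k)]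
  · refine ((finite_wt_eq (v 0)).prod ((finite_card_eq (v 2)).prod (finite_wt_eq (v 1)))).subset ?_
    intro s hs
    exact ⟨congrFun hs 0, congrFun hs 2, congrFun hs 1⟩
  · obtain ⟨κ, hκ⟩ := h.sixPointTerm_eq_single k o i s
    refine ⟨κ, ?_⟩
    rw [hκ, Fin.sum_univ_three]
    rfl

/-- The matrices of the four point operators, before the summation over the internal states. -/
def fourPointTerm (S₁ S₂ : Fin N → FockIdx × YoungDiagram → FockIdx → HahnSeries Γ BaseField)
    (P₁ P₂ : Fin N → FockIdx → YoungDiagram × FockIdx → HahnSeries Γ BaseField)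
    (k : Fin N) (o : FockIdx × FockIdx) (s : FockIdx × YoungDiagram × FockIdx)
    (i : FockIdx × FockIdx) : HahnSeries Γ BaseField :=
  sixPointTerm (S₁ k) (P₁ k) (P₂ k) (S₂ k) (o.1, o.2, ⊥) (⊥, i.1, i.2) s

lemma IsNetwork.w_lt_w (h : IsNetwork gw gx gy gus gvs S₁ S₂ P₁ P₂) {i k : Fin N} (hik : i < k) :
    gw k < gw i :=
  (h.w_lt_x i k hik).trans (h.x_lt_w i)

lemma lt_cons_castSucc {Γ : Type*} [Preorder Γ] {N : ℕ} {gw gx : Fin N → Γ} {A : Γ} (hA : ∀ k, gw k < A)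
    (hwx : ∀ i k, i < k → gw k < gx i) (k : Fin N) :
    gw k < (Fin.cons A gx : Fin (N + 1) → Γ) k.castSucc := by
  cases N with
  | zero => exact k.elim0
  | succ n =>
    induction k using Fin.cases with
    | zero => exact hA 0
    | succ k =>
      rw [← Fin.succ_castSucc, Fin.cons_succ]
      exact hwx _ _ Fin.castSucc_lt_succ

/-- The potential of the state before the `k`-th operator is computed with the exponents of the
last parameters `x` and `y` that were inserted. -/
lemma IsNetwork.isGradedChain (h : IsNetwork gw gx gy gus gvs S₁ S₂ P₁ P₂) {A : Γ}
    (hA : ∀ k, gw k < A) :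
    IsGradedChain (fourPointTerm S₁ S₂ P₁ P₂)
      (fun k x => wt x.1 • (Fin.cons A gx : Fin (N + 1) → Γ) k +
        wt x.2 • (Fin.cons A gy : Fin (N + 1) → Γ) k)
      (fun k => ![(Fin.cons A gx : Fin (N + 1) → Γ) k.castSucc - gw k,
        (Fin.cons A gy : Fin (N + 1) → Γ) k.castSucc - gw k, gw k - gx k, gw k - gy k,
        gvs k - gus k])
      (fun _ x s => ![wt x.1, wt x.2, wt s.1, wt s.2.2, s.2.1.card]) where
  pos k j := by
    fin_cases j
    exacts [sub_pos.mpr (lt_cons_castSucc hA h.w_lt_x k),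
      sub_pos.mpr (lt_cons_castSucc hA h.w_lt_y k), sub_pos.mpr (h.x_lt_w k),
      sub_pos.mpr (h.y_lt_w k), sub_pos.mpr (h.u_lt_v k)]
  finite k v := by
    refine (((finite_wt_eq (v 0)).prod (finite_wt_eq (v 1))).prod ((finite_wt_eq (v 2)).prod
      ((finite_card_eq (v 4)).prod (finite_wt_eq (v 3))))).subset fun z hz => ?_
    exact ⟨⟨congrFun hz 0, congrFun hz 1⟩, congrFun hz 2, congrFun hz 4, congrFun hz 3⟩
  mono k y s x := by
    obtain ⟨κ, hκ⟩ := h.sixPointTerm_eq_single k (y.1, y.2, ⊥) (⊥, x.1, x.2) s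
    obtain ⟨a₃, b₃, h₃⟩ := h.P₂ k
    obtain ⟨a₄, b₄, h₄⟩ := h.S₂ k
    refine ⟨κ, ?_⟩
    rw [fourPointTerm, hκ, h₃.2, h₄.2, one_mul, one_mul, Fin.sum_univ_five]
    congr 2
    simp only [Fin.cons_succ, smul_sub, Matrix.cons_val]
    abel

end Network

/-! ### Reflection of the Nekrasov factors in the product of all the contractions -/

section Reflection

open Finset

variable {L : Type*} [Field L] [Algebra BaseField L]

lemma nekN_bot_bot (z : L) : nekN ⊥ ⊥ z = 1 := by
  simp [nekN]

lemma tt_div_qq : tt L / qq L = (qtHalf L)⁻¹ ^ 2 := by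
  rw [inv_pow, qtHalf_sq, inv_div]

/-- The ratio of the two sides of the reflection formulas is a power, because the contents of the
cells cancel. -/
lemma nekN_reflect_pair (la mu : YoungDiagram) {a b c d : L} (ha : a ≠ 0) (hb : b ≠ 0)
    (hc : c ≠ 0) (hd : d ≠ 0) :
    nekN la ⊥ (qtHalf L * (a / d)) * nekN ⊥ mu (qtHalf L * (c / b)) /
        nekN la mu (qq L / tt L * (a / b)) =
      nekN ⊥ la (qtHalf L * (d / a)) * nekN mu ⊥ (qtHalf L * (b / c)) / nekN mu la (b / a) *
        (((qtHalf L)⁻¹ * (b / d)) ^ la.card * ((qtHalf L)⁻¹ * (c / a)) ^ mu.card) := by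
  have hp := qtHalf_ne_zero L
  have hq : qq L / tt L = qtHalf L ^ 2 := (qtHalf_sq L).symm
  have e1 : qq L / tt L * (qtHalf L * (d / a))⁻¹ = qtHalf L * (a / d) := by
    rw [hq]; field_simp
  have e2 : qq L / tt L * (qtHalf L * (b / c))⁻¹ = qtHalf L * (c / b) := by
    rw [hq]; field_simp
  have e3 : qq L / tt L * (b / a)⁻¹ = qq L / tt L * (a / b) := by rw [inv_div]
  rw [nekN_flip ⊥ la (mul_ne_zero hp (div_ne_zero hd ha)), e1,
    nekN_flip mu ⊥ (mul_ne_zero hp (div_ne_zero hb hc)), e2,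
    nekN_flip mu la (div_ne_zero hb ha), e3, tt_div_qq]
  simp only [YoungDiagram.cells_bot, prod_empty, one_mul, mul_one]
  have h1 : ((qtHalf L)⁻¹ * (b / d)) ^ la.card *
      ∏ r ∈ la.cells, (-(qtHalf L * (d / a)) * ((qtHalf L)⁻¹ ^ 2 * (content L r)⁻¹)) =
      ∏ r ∈ la.cells, (-(b / a) * ((qtHalf L)⁻¹ ^ 2 * (content L r)⁻¹)) := by
    rw [YoungDiagram.card, ← prod_const, ← prod_mul_distrib]
    refine prod_congr rfl fun r _ => ?_
    field_simp
  have h2 : ((qtHalf L)⁻¹ * (c / a)) ^ mu.card *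
      ∏ s ∈ mu.cells, (-(qtHalf L * (b / c)) * content L s) =
      ∏ s ∈ mu.cells, (-(b / a) * content L s) := by
    rw [YoungDiagram.card, ← prod_const, ← prod_mul_distrib]
    refine prod_congr rfl fun r _ => ?_
    field_simp
  have h3 : ∏ r ∈ la.cells, (-(b / a) * ((qtHalf L)⁻¹ ^ 2 * (content L r)⁻¹)) ≠ 0 :=
    prod_ne_zero_iff.mpr fun r _ => mul_ne_zero (neg_ne_zero.mpr (div_ne_zero hb ha))
      (mul_ne_zero (pow_ne_zero _ (inv_ne_zero hp)) (inv_ne_zero (content_ne_zero _)))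
  have h4 : ∏ s ∈ mu.cells, (-(b / a) * content L s) ≠ 0 :=
    prod_ne_zero_iff.mpr fun r _ => mul_ne_zero (neg_ne_zero.mpr (div_ne_zero hb ha))
      (content_ne_zero _)
  rw [← h1] at h3
  rw [← h2] at h4
  obtain ⟨h5, h6⟩ := mul_ne_zero_iff.mp h3
  obtain ⟨h7, h8⟩ := mul_ne_zero_iff.mp h4
  rw [← h1, ← h2]
  generalize ((qtHalf L)⁻¹ * (b / d)) ^ la.card = A at *
  generalize ((qtHalf L)⁻¹ * (c / a)) ^ mu.card = B at *
  generalize ∏ r ∈ la.cells, (-(qtHalf L * (d / a)) * ((qtHalf L)⁻¹ ^ 2 * (content L r)⁻¹)) = D at *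
  generalize ∏ s ∈ mu.cells, (-(qtHalf L * (b / c)) * content L s) = F at *
  field_simp

/-- The reflection of the contraction within one six point operator, where `τ` is the product of
the two vacuum entries. -/
lemma nekN_reflect_diag (la : YoungDiagram) {a d r τ : L} (ha : a ≠ 0) (hd : d ≠ 0)
    (hτ : τ * nekN la la 1 = ∏ s ∈ la.cells, (r * ((qtHalf L)⁻¹ ^ 2 * (content L s)⁻¹))) :
    τ * nekN la ⊥ (qtHalf L * (a / d)) =
      nekN ⊥ la (qtHalf L * (d / a)) / nekN la la 1 * (-r * ((qtHalf L)⁻¹ * (a / d))) ^ la.card := by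
  have hp := qtHalf_ne_zero L
  have hq : qq L / tt L = qtHalf L ^ 2 := (qtHalf_sq L).symm
  have e1 : qq L / tt L * (qtHalf L * (d / a))⁻¹ = qtHalf L * (a / d) := by
    rw [hq]; field_simp
  rw [nekN_flip ⊥ la (mul_ne_zero hp (div_ne_zero hd ha)), e1, tt_div_qq,
    eq_div_of_mul_eq (nekN_self_ne_zero la) hτ]
  simp only [YoungDiagram.cells_bot, prod_empty, one_mul]
  have h1 : ∏ s ∈ la.cells, (r * ((qtHalf L)⁻¹ ^ 2 * (content L s)⁻¹)) =
      (∏ s ∈ la.cells, (-(qtHalf L * (d / a)) * ((qtHalf L)⁻¹ ^ 2 * (content L s)⁻¹))) *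
      (-r * ((qtHalf L)⁻¹ * (a / d))) ^ la.card := by
    rw [YoungDiagram.card, ← prod_const, ← prod_mul_distrib]
    refine prod_congr rfl fun r _ => ?_
    field_simp
  rw [h1]
  ring

lemma prod_Iio_comm {M : Type*} [CommMonoid M] {N : ℕ} (f : Fin N → Fin N → M) :
    ∏ j, ∏ i ∈ Iio j, f i j = ∏ i, ∏ j ∈ Ioi i, f i j :=
  prod_comm' fun i j => by simp

lemma prod_eq_mul_Iio_mul_Ioi {M : Type*} [CommMonoid M] {N : ℕ} (f : Fin N → M) (i : Fin N) :
    ∏ j, f j = f i * ((∏ j ∈ Iio i, f j) * ∏ j ∈ Ioi i, f j) := by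
  rw [← prod_union (disjoint_left.mpr fun j hj hj' => lt_asymm (mem_Iio.mp hj) (mem_Ioi.mp hj'))]
  have : Iio i ∪ Ioi i = univ.erase i := by ext j; simp [lt_or_lt_iff_ne]
  rw [this, mul_prod_erase univ f (mem_univ i)]

lemma prod_prod_eq_diag {M : Type*} [CommMonoid M] {N : ℕ} (f : Fin N → Fin N → M) :
    ∏ i, ∏ j, f i j = (∏ k, f k k) * ∏ k, ∏ i ∈ Iio k, (f i k * f k i) := by
  rw [prod_congr rfl fun i _ => prod_eq_mul_Iio_mul_Ioi (f i) i, prod_mul_distrib,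
    prod_mul_distrib, ← prod_Iio_comm f,
    mul_comm (∏ i, ∏ j ∈ Iio i, f i j)]
  simp only [prod_mul_distrib]

/-- The contributions of the contractions to the chain of the six point operators combine to
the perturbative factor and the summand of the instanton partition function. -/
theorem prod_contractions_eq {N : ℕ} {G : L → L} {W X Y r τ : Fin N → L}
    (hW : ∀ k, W k ≠ 0) (hX : ∀ k, X k ≠ 0) (hY : ∀ k, Y k ≠ 0) (μ : Fin N → YoungDiagram)
    (hτ : ∀ k, τ k * nekN (μ k) (μ k) 1 =
      ∏ s ∈ (μ k).cells, (r k * ((qtHalf L)⁻¹ ^ 2 * (content L s)⁻¹)))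
    {Lam2N : L} (hLam : ∀ k, Lam2N = -r k * ((qtHalf L)⁻¹ * (W k / Y k)) *
      ((∏ j ∈ Ioi k, (qtHalf L)⁻¹ * (W j / Y j)) * ∏ i ∈ Iio k, (qtHalf L)⁻¹ * (X i / W i)))
    {e e' e'' : Fin N → L} (he : ∀ k, e k = W k) (he' : ∀ k, e' k = qtHalf L * Y k)
    (he'' : ∀ k, e'' k = (qtHalf L)⁻¹ * X k) :
    ∏ k, (τ k *
      ((∏ i ∈ Iio k, (G (W i / W k) / nekN (μ i) (μ k) (W i / W k) *
        (nekN ⊥ (μ k) (qtHalf L * (X i / W k)) / G (qtHalf L * (X i / W k))))) *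
      ((∏ i ∈ Iio k, (nekN (μ i) ⊥ (qtHalf L * (W i / X k)) / G (qtHalf L * (W i / X k)) *
        (G (qq L / tt L * (X i / X k)) / nekN ⊥ ⊥ (qq L / tt L * (X i / X k))))) *
        (nekN (μ k) ⊥ (qtHalf L * (W k / X k)) / G (qtHalf L * (W k / X k))))) *
      ((∏ i ∈ Iio k, (G (qq L / tt L * (W i / W k)) /
        nekN (μ i) (μ k) (qq L / tt L * (W i / W k)) *
        (nekN ⊥ (μ k) (qtHalf L * (Y i / W k)) / G (qtHalf L * (Y i / W k))))) *
      ((∏ i ∈ Iio k, (nekN (μ i) ⊥ (qtHalf L * (W i / Y k)) / G (qtHalf L * (W i / Y k)) *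
        (G (Y i / Y k) / nekN ⊥ ⊥ (Y i / Y k)))) *
        (nekN (μ k) ⊥ (qtHalf L * (W k / Y k)) / G (qtHalf L * (W k / Y k)))))) =
    ((∏ k, 1 / (G (e k / e'' k) * G (qq L * (tt L)⁻¹ * (e k / e' k)))) *
      ∏ i, ∏ j ∈ Ioi i,
        (G (e i / e j) * G (qq L * (tt L)⁻¹ * (e i / e j)) *
          G (qq L * (tt L)⁻¹ * (e'' i / e'' j)) * G (e' i / e' j)) /
        (G (e i / e'' j) * G (qq L * (tt L)⁻¹ * (e'' i / e j)) *
          G (qq L * (tt L)⁻¹ * (e i / e' j)) * G (e' i / e j))) *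
      nekrasovTerm e e' e'' Lam2N μ := by
  have hp := qtHalf_ne_zero L
  have hq : qq L / tt L = qtHalf L ^ 2 := (qtHalf_sq L).symm
  have a1 : ∀ i j, e i / e j = W i / W j := fun i j => by rw [he, he]
  have a2 : ∀ i j, e i / e'' j = qtHalf L * (W i / X j) := fun i j => by
    rw [he, he'']; field_simp
  have a3 : ∀ i j, qq L / tt L * (e i / e' j) = qtHalf L * (W i / Y j) := fun i j => by
    rw [he, he', hq]; field_simp
  have a4 : ∀ i j, e'' i / e'' j = X i / X j := fun i j => by
    rw [he'', he'', mul_div_mul_left _ _ (inv_ne_zero hp)]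
  have a5 : ∀ i j, e' i / e' j = Y i / Y j := fun i j => by
    rw [he', he', mul_div_mul_left _ _ hp]
  have a6 : ∀ i j, qq L / tt L * (e'' i / e j) = qtHalf L * (X i / W j) := fun i j => by
    rw [he, he'', hq]; field_simp
  have a7 : ∀ i j, e' i / e j = qtHalf L * (Y i / W j) := fun i j => by
    rw [he, he', mul_div_assoc]
  have hLk : ∏ k, Lam2N ^ (μ k).card =
      (∏ k, (-r k * ((qtHalf L)⁻¹ * (W k / Y k))) ^ (μ k).card) *
      ∏ k, ∏ i ∈ Iio k, (((qtHalf L)⁻¹ * (W k / Y k)) ^ (μ i).card *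
        ((qtHalf L)⁻¹ * (X i / W i)) ^ (μ k).card) := by
    have h1 : ∀ k, Lam2N ^ (μ k).card = (-r k * ((qtHalf L)⁻¹ * (W k / Y k))) ^ (μ k).card *
        ((∏ j ∈ Ioi k, ((qtHalf L)⁻¹ * (W j / Y j)) ^ (μ k).card) *
          ∏ i ∈ Iio k, ((qtHalf L)⁻¹ * (X i / W i)) ^ (μ k).card) := by
      intro k
      rw [prod_pow, prod_pow, ← mul_pow, ← mul_pow, ← hLam k]
    rw [prod_congr rfl fun k _ => h1 k, prod_mul_distrib, prod_mul_distrib,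
      ← prod_Iio_comm fun k j => ((qtHalf L)⁻¹ * (W j / Y j)) ^ (μ k).card]
    simp only [prod_mul_distrib]
  rw [nekrasovTerm, hLk, prod_prod_eq_diag, ← prod_Iio_comm fun i j =>
    (G (e i / e j) * G (qq L * (tt L)⁻¹ * (e i / e j)) *
          G (qq L * (tt L)⁻¹ * (e'' i / e'' j)) * G (e' i / e' j)) /
        (G (e i / e'' j) * G (qq L * (tt L)⁻¹ * (e'' i / e j)) *
          G (qq L * (tt L)⁻¹ * (e i / e' j)) * G (e' i / e j))]
  simp only [← div_eq_mul_inv (qq L), a1, a2, a3, a4, a5, a6, a7, nekN_bot_bot, div_one]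
  have hdiag : ∀ k, τ k * (nekN (μ k) ⊥ (qtHalf L * (W k / X k)) / G (qtHalf L * (W k / X k)) *
      (nekN (μ k) ⊥ (qtHalf L * (W k / Y k)) / G (qtHalf L * (W k / Y k)))) =
      1 / (G (qtHalf L * (W k / X k)) * G (qtHalf L * (W k / Y k))) *
      ((-r k * ((qtHalf L)⁻¹ * (W k / Y k))) ^ (μ k).card *
        (nekN ⊥ (μ k) (qtHalf L * (Y k / W k)) * nekN (μ k) ⊥ (qtHalf L * (W k / X k)) /
          nekN (μ k) (μ k) (W k / W k))) := by
    intro k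
    have h1 := nekN_reflect_diag (μ k) (hW k) (hY k) (hτ k)
    rw [div_self (hW k)]
    calc _ = (τ k * nekN (μ k) ⊥ (qtHalf L * (W k / Y k))) * nekN (μ k) ⊥ (qtHalf L * (W k / X k)) *
        (1 / (G (qtHalf L * (W k / X k)) * G (qtHalf L * (W k / Y k)))) := by
          rw [one_div, mul_inv]; ring
      _ = _ := by rw [h1]; ring
  have hre : ∀ A B C D E F : L, A * B * (C * D * (E * F)) = A * (C * E) * (B * (D * F)) := by
    intros; ring
  rw [hre]
  simp only [← prod_mul_distrib]
  refine prod_congr rfl fun k _ => ?_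
  rw [← hdiag k]
  have hre' : ∀ t I₁ I₂ I₃ I₄ d₁ d₂ : L, t * (I₁ * (I₂ * d₁)) * (I₃ * (I₄ * d₂)) =
      t * (d₁ * d₂) * (I₁ * I₂ * (I₃ * I₄)) := by
    intros; ring
  rw [hre']
  simp only [← prod_mul_distrib]
  congr 1
  refine prod_congr rfl fun i _ => ?_
  have h := nekN_reflect_pair (μ i) (μ k) (hW i) (hW k) (hX i) (hY k)
  have hre'' : ∀ g₁ g₂ g₃ g₄ g₅ g₆ g₇ g₈ n₁ n₂ n₃ m₁ m₂ m₃ l₁ l₂ l₃ p : L,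
      l₁ * l₂ / l₃ = m₁ * m₂ / m₃ * p →
      g₁ / n₃ * (l₂ / g₆) * (n₂ / g₅ * g₃) * (g₂ / l₃ * (n₁ / g₈) * (l₁ / g₇ * g₄)) =
        g₁ * g₂ * g₃ * g₄ / (g₅ * g₆ * g₇ * g₈) *
          (p * (n₁ * n₂ / n₃ * (m₁ * m₂ / m₃))) := by
    intro g₁ g₂ g₃ g₄ g₅ g₆ g₇ g₈ n₁ n₂ n₃ m₁ m₂ m₃ l₁ l₂ l₃ p h
    rw [mul_left_comm p, mul_comm p, ← h]
    simp only [div_eq_mul_inv, mul_inv]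
    ring
  exact hre'' _ _ _ _ _ _ _ _ _ _ _ _ _ _ _ _ _ _ h

end Reflection

/-! ### The chain with fixed partitions -/

section Evaluation

open Finset

variable {Γ : Type*} [AddCommGroup Γ] [LinearOrder Γ] [IsOrderedAddMonoid Γ] {N : ℕ}

section Contractions

lemma qtHalf_mul_single (g : Γ) (c : BaseField) :
    qtHalf (HahnSeries Γ BaseField) * HahnSeries.single g c =
      HahnSeries.single g (qtHalf BaseField * c) := by
  rw [← algebraMap_qtHalf]
  simpa using algebraMap_mul_single_pow (g := g) (c := c) (qtHalf BaseField) 1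

variable {g g' : Γ} (c c' : BaseField) (la mu : YoungDiagram)

lemma hasMass_starC_starB (hg : g' < g) :
    HasMass (fun n => starC (HahnSeries.single g' c') mu n * starB (HahnSeries.single g c) la n)
      (evalG (HahnSeries.single g c / HahnSeries.single g' c') /
        nekN la mu (HahnSeries.single g c / HahnSeries.single g' c')) := by
  simp only [starC_mul_starB]
  rw [HahnSeries.single_div_single]
  exact hasMass_neg_contr (sub_pos.mpr hg) _ la mu

lemma hasMass_phiC_phiB (hg : g' < g) :
    HasMass (fun n => phiC (HahnSeries.single g' c') mu n * phiB (HahnSeries.single g c) la n)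
      (evalG (qq _ / tt _ * (HahnSeries.single g c / HahnSeries.single g' c')) /
        nekN la mu (qq _ / tt _ * (HahnSeries.single g c / HahnSeries.single g' c'))) := by
  have hc : qq (HahnSeries Γ BaseField) / tt _ * HahnSeries.single (g - g') (c / c') =
      HahnSeries.single (g - g') (qq BaseField / tt BaseField * (c / c')) := by
    rw [← algebraMap_qq, ← algebraMap_tt, ← map_div₀]
    simpa using algebraMap_mul_single_pow (g := g - g') (c := c / c') (qq BaseField / tt BaseField) 1
  simp only [phiC_mul_phiB]
  rw [HahnSeries.single_div_single, hc]
  exact hasMass_neg_contr (sub_pos.mpr hg) _ la mu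

lemma hasMass_phiC_starB (hg : g' < g) :
    HasMass (fun n => phiC (HahnSeries.single g' c') mu n * starB (HahnSeries.single g c) la n)
      (nekN la mu (qtHalf _ * (HahnSeries.single g c / HahnSeries.single g' c')) /
        evalG (qtHalf _ * (HahnSeries.single g c / HahnSeries.single g' c'))) := by
  simp only [phiC_mul_starB]
  rw [HahnSeries.single_div_single, qtHalf_mul_single]
  exact hasMass_contr (sub_pos.mpr hg) _ la mu

lemma hasMass_starC_phiB (hg : g' < g) :
    HasMass (fun n => starC (HahnSeries.single g' c') mu n * phiB (HahnSeries.single g c) la n)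
      (nekN la mu (qtHalf _ * (HahnSeries.single g c / HahnSeries.single g' c')) /
        evalG (qtHalf _ * (HahnSeries.single g c / HahnSeries.single g' c'))) := by
  simp only [starC_mul_phiB]
  rw [HahnSeries.single_div_single, qtHalf_mul_single]
  exact hasMass_contr (sub_pos.mpr hg) _ la mu

end Contractions

/-- The parameters of the coherent state before the `k`-th operator of a chain. -/
def shift {M : Type*} [AddCommMonoid M] (b : Fin N → ℕ+ → M) (k : Fin (N + 1)) (n : ℕ+) : M :=
  ∑ i with i.castSucc < k, b i n

lemma shift_zero {M : Type*} [AddCommMonoid M] (b : Fin N → ℕ+ → M) : shift b 0 = fun _ => 0 := by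
  funext n
  simp [shift]

lemma shift_castSucc {M : Type*} [AddCommMonoid M] (b : Fin N → ℕ+ → M) (k : Fin N) (n : ℕ+) :
    shift b k.castSucc n = ∑ i ∈ Iio k, b i n := by
  rw [shift]
  congr 1
  ext i
  simp

lemma shift_succ {M : Type*} [AddCommMonoid M] (b : Fin N → ℕ+ → M) (k : Fin N) (n : ℕ+) :
    shift b k.succ n = shift b k.castSucc n + b k n := by
  rw [shift_castSucc, add_comm, ← sum_insert (f := fun i => b i n) (s := Iio k) (a := k) (by simp), shift]
  congr 1
  ext i
  simp [Fin.castSucc_lt_succ_iff, le_iff_eq_or_lt]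

variable {gw gx gy gus gvs : Fin N → Γ}
  {S₁ S₂ : Fin N → FockIdx × YoungDiagram → FockIdx → HahnSeries Γ BaseField}
  {P₁ P₂ : Fin N → FockIdx → YoungDiagram × FockIdx → HahnSeries Γ BaseField}

section Masses

variable {W X Y : Fin N → HahnSeries Γ BaseField} (μ : Fin N → YoungDiagram) (k : Fin N)

lemma IsNetwork.hasMass_S₁ (h : IsNetwork gw gx gy gus gvs S₁ S₂ P₁ P₂)
    (hW : ∀ k, W k = HahnSeries.single (gw k) (-1))
    (hX : ∀ k, X k = HahnSeries.single (gx k) (-1)) :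
    HasMass (fun n => starC (W k) (μ k) n *
        shift (fun i n => starB (W i) (μ i) n + phiB (X i) ⊥ n) k.castSucc n)
      (∏ i ∈ Iio k, (evalG (W i / W k) / nekN (μ i) (μ k) (W i / W k) *
        (nekN ⊥ (μ k) (qtHalf _ * (X i / W k)) / evalG (qtHalf _ * (X i / W k))))) := by
  simp only [shift_castSucc, mul_sum, mul_add, hW, hX]
  exact HasMass.sum _ fun i hi => (hasMass_starC_starB _ _ _ _ (h.w_lt_w (mem_Iio.mp hi))).add
    (hasMass_starC_phiB _ _ _ _ (h.w_lt_x i k (mem_Iio.mp hi)))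

lemma IsNetwork.hasMass_P₂ (h : IsNetwork gw gx gy gus gvs S₁ S₂ P₁ P₂)
    (hW : ∀ k, W k = HahnSeries.single (gw k) (-1))
    (hX : ∀ k, X k = HahnSeries.single (gx k) (-1)) :
    HasMass (fun n => phiC (X k) ⊥ n *
        (shift (fun i n => starB (W i) (μ i) n + phiB (X i) ⊥ n) k.castSucc n +
          starB (W k) (μ k) n))
      ((∏ i ∈ Iio k, (nekN (μ i) ⊥ (qtHalf _ * (W i / X k)) / evalG (qtHalf _ * (W i / X k)) *
        (evalG (qq _ / tt _ * (X i / X k)) / nekN ⊥ ⊥ (qq _ / tt _ * (X i / X k))))) *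
        (nekN (μ k) ⊥ (qtHalf _ * (W k / X k)) / evalG (qtHalf _ * (W k / X k)))) := by
  simp only [shift_castSucc, mul_sum, mul_add, hW, hX]
  exact (HasMass.sum _ fun i hi => (hasMass_phiC_starB _ _ _ _
    ((h.x_lt_w k).trans (h.w_lt_w (mem_Iio.mp hi)))).add (hasMass_phiC_phiB _ _ _ _
      ((h.x_lt_w k).trans (h.w_lt_x i k (mem_Iio.mp hi))))).add
    (hasMass_phiC_starB _ _ _ _ (h.x_lt_w k))

lemma IsNetwork.hasMass_P₁ (h : IsNetwork gw gx gy gus gvs S₁ S₂ P₁ P₂)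
    (hW : ∀ k, W k = HahnSeries.single (gw k) (-1))
    (hY : ∀ k, Y k = HahnSeries.single (gy k) (-1)) :
    HasMass (fun n => phiC (W k) (μ k) n *
        shift (fun i n => phiB (W i) (μ i) n + starB (Y i) ⊥ n) k.castSucc n)
      (∏ i ∈ Iio k, (evalG (qq _ / tt _ * (W i / W k)) /
        nekN (μ i) (μ k) (qq _ / tt _ * (W i / W k)) *
        (nekN ⊥ (μ k) (qtHalf _ * (Y i / W k)) / evalG (qtHalf _ * (Y i / W k))))) := by
  simp only [shift_castSucc, mul_sum, mul_add, hW, hY]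
  exact HasMass.sum _ fun i hi => (hasMass_phiC_phiB _ _ _ _ (h.w_lt_w (mem_Iio.mp hi))).add
    (hasMass_phiC_starB _ _ _ _ (h.w_lt_y i k (mem_Iio.mp hi)))

lemma IsNetwork.hasMass_S₂ (h : IsNetwork gw gx gy gus gvs S₁ S₂ P₁ P₂)
    (hW : ∀ k, W k = HahnSeries.single (gw k) (-1))
    (hY : ∀ k, Y k = HahnSeries.single (gy k) (-1)) :
    HasMass (fun n => starC (Y k) ⊥ n *
        (shift (fun i n => phiB (W i) (μ i) n + starB (Y i) ⊥ n) k.castSucc n +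
          phiB (W k) (μ k) n))
      ((∏ i ∈ Iio k, (nekN (μ i) ⊥ (qtHalf _ * (W i / Y k)) / evalG (qtHalf _ * (W i / Y k)) *
        (evalG (Y i / Y k) / nekN ⊥ ⊥ (Y i / Y k)))) *
        (nekN (μ k) ⊥ (qtHalf _ * (W k / Y k)) / evalG (qtHalf _ * (W k / Y k)))) := by
  simp only [shift_castSucc, mul_sum, mul_add, hW, hY]
  exact (HasMass.sum _ fun i hi => (hasMass_starC_phiB _ _ _ _
    ((h.y_lt_w k).trans (h.w_lt_w (mem_Iio.mp hi)))).add (hasMass_starC_starB _ _ _ _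
      ((h.y_lt_w k).trans (h.w_lt_y i k (mem_Iio.mp hi))))).add
    (hasMass_starC_phiB _ _ _ _ (h.y_lt_w k))

end Masses

end Evaluation

/-! ### The matrix element of the network -/

section Total

open Finset

variable {Γ : Type*} [AddCommGroup Γ] [LinearOrder Γ] [IsOrderedAddMonoid Γ] {N : ℕ}

variable {gw gx gy gus gvs : Fin N → Γ}
  {S₁ S₂ : Fin N → FockIdx × YoungDiagram → FockIdx → HahnSeries Γ BaseField}
  {P₁ P₂ : Fin N → FockIdx → YoungDiagram × FockIdx → HahnSeries Γ BaseField}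
  {W X Y : Fin N → HahnSeries Γ BaseField}

/-- The factor that arises from the `k`-th six point operator with the partition `μ k` on the
internal vertical edge, when it acts on a product of coherent states. -/
def stepFactor (W X Y τ : Fin N → HahnSeries Γ BaseField) (μ : Fin N → YoungDiagram) (k : Fin N) :
    HahnSeries Γ BaseField :=
  τ k *
    ((∏ i ∈ Iio k, (evalG (W i / W k) / nekN (μ i) (μ k) (W i / W k) *
      (nekN ⊥ (μ k) (qtHalf _ * (X i / W k)) / evalG (qtHalf _ * (X i / W k))))) *
    ((∏ i ∈ Iio k, (nekN (μ i) ⊥ (qtHalf _ * (W i / X k)) / evalG (qtHalf _ * (W i / X k)) *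
      (evalG (qq _ / tt _ * (X i / X k)) / nekN ⊥ ⊥ (qq _ / tt _ * (X i / X k))))) *
      (nekN (μ k) ⊥ (qtHalf _ * (W k / X k)) / evalG (qtHalf _ * (W k / X k))))) *
    ((∏ i ∈ Iio k, (evalG (qq _ / tt _ * (W i / W k)) /
      nekN (μ i) (μ k) (qq _ / tt _ * (W i / W k)) *
      (nekN ⊥ (μ k) (qtHalf _ * (Y i / W k)) / evalG (qtHalf _ * (Y i / W k))))) *
    ((∏ i ∈ Iio k, (nekN (μ i) ⊥ (qtHalf _ * (W i / Y k)) / evalG (qtHalf _ * (W i / Y k)) *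
      (evalG (Y i / Y k) / nekN ⊥ ⊥ (Y i / Y k)))) *
      (nekN (μ k) ⊥ (qtHalf _ * (W k / Y k)) / evalG (qtHalf _ * (W k / Y k)))))

/-- A six point operator maps a product of coherent states to a multiple of a product of
coherent states. -/
lemma IsNetwork.eq_stepFactor_mul (h : IsNetwork gw gx gy gus gvs S₁ S₂ P₁ P₂)
    (hW : ∀ k, W k = HahnSeries.single (gw k) (-1))
    (hX : ∀ k, X k = HahnSeries.single (gx k) (-1))
    (hY : ∀ k, Y k = HahnSeries.single (gy k) (-1)) (μ : Fin N → YoungDiagram) (k : Fin N)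
    (y : FockIdx × FockIdx) {C T : HahnSeries Γ BaseField}
    (hT : HasHahnSum (fun z : (FockIdx × FockIdx) × (FockIdx × FockIdx) =>
      fourPointTerm S₁ S₂ P₁ P₂ k y (z.2.1, μ k, z.2.2) z.1 * (C *
        (coh (shift (fun i n => starB (W i) (μ i) n + phiB (X i) ⊥ n) k.castSucc) z.1.1 *
          coh (shift (fun i n => phiB (W i) (μ i) n + starB (Y i) ⊥ n) k.castSucc) z.1.2))) T) :
    T = C * ( stepFactor W X Y (fun k => P₁ k 0 (μ k, 0) * S₁ k (0, μ k) 0) μ k *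
      (coh (shift (fun i n => starB (W i) (μ i) n + phiB (X i) ⊥ n) k.succ) y.1 *
          coh (shift (fun i n => phiB (W i) (μ i) n + starB (Y i) ⊥ n) k.succ) y.2)) := by
  obtain ⟨a₁, h₁⟩ := h.S₁ k
  obtain ⟨a₂, h₂⟩ := h.P₁ k
  obtain ⟨a₃, b₃, h₃⟩ := h.P₂ k
  obtain ⟨a₄, b₄, h₄⟩ := h.S₂ k
  rw [← hW] at h₁ h₂
  rw [← hX] at h₃
  rw [← hY] at h₄
  have hu := hasHahnSum_two_step (h₁.isVertexOp (μ k)) (h₃.isVertexOp ⊥) (h.hasMass_S₁ μ k hW hX)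
    (h.hasMass_P₂ μ k hW hX) y.1
  have hv := hasHahnSum_two_step (h₂.isVertexOp (μ k)) (h₄.isVertexOp ⊥) (h.hasMass_P₁ μ k hW hY)
    (h.hasMass_S₂ μ k hW hY) y.2
  have h5 := eq_of_hasHahnSum_two_lines (fun c => (hu.1 c).const_mul C) (hu.2.const_mul C) hv.1 hv.2 (T := T) (by
    convert hT using 2 with z
    simp only [fourPointTerm, sixPointTerm]
    ring)
  rw [h5, h₃.2, h₄.2]
  have e1 : shift (fun i n => starB (W i) (μ i) n + phiB (X i) ⊥ n) k.succ =
      fun n => shift (fun i n => starB (W i) (μ i) n + phiB (X i) ⊥ n) k.castSucc n +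
        starB (W k) (μ k) n + phiB (X k) ⊥ n := funext fun n => by rw [shift_succ, add_assoc]
  have e2 : shift (fun i n => phiB (W i) (μ i) n + starB (Y i) ⊥ n) k.succ =
      fun n => shift (fun i n => phiB (W i) (μ i) n + starB (Y i) ⊥ n) k.castSucc n +
        phiB (W k) (μ k) n + starB (Y k) ⊥ n := funext fun n => by rw [shift_succ, add_assoc]
  rw [e1, e2, stepFactor]
  ring

lemma exists_vacuum_eq_single (A : Γ) (x : FockIdx × FockIdx) :
    ∃ c, coh (fun _ => (0 : HahnSeries Γ BaseField)) x.1 *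
        coh (fun _ => (0 : HahnSeries Γ BaseField)) x.2 =
      HahnSeries.single (wt x.1 • (Fin.cons A gx : Fin (N + 1) → Γ) 0 +
        wt x.2 • (Fin.cons A gy : Fin (N + 1) → Γ) 0) c := by
  have h : ∀ m : FockIdx, ∃ c, coh (fun _ => (0 : HahnSeries Γ BaseField)) m =
      HahnSeries.single (wt m • A) c := by
    intro m
    rcases eq_or_ne m 0 with rfl | hm
    · exact ⟨1, by rw [coh_zero_index, wt_zero, zero_smul]; rfl⟩
    · exact ⟨0, by rw [coh_zero_of_ne hm, HahnSeries.single_eq_zero]⟩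
  obtain ⟨c₁, h₁⟩ := h x.1
  obtain ⟨c₂, h₂⟩ := h x.2
  exact ⟨c₁ * c₂, by rw [h₁, h₂, HahnSeries.single_mul_single]; rfl⟩

/-- The network with fixed partitions on its internal vertical edges. -/
lemma IsNetwork.hasHahnSum_of_partitions (h : IsNetwork gw gx gy gus gvs S₁ S₂ P₁ P₂)
    (hW : ∀ k, W k = HahnSeries.single (gw k) (-1))
    (hX : ∀ k, X k = HahnSeries.single (gx k) (-1))
    (hY : ∀ k, Y k = HahnSeries.single (gy k) (-1)) {A : Γ} (hA : ∀ k, gw k < A)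
    (μ : Fin N → YoungDiagram) :
    HasHahnSum (chainFamily (fun k y (s : FockIdx × FockIdx) x =>
        fourPointTerm S₁ S₂ P₁ P₂ k y (s.1, μ k, s.2) x)
        (fun x => coh (fun _ => 0) x.1 * coh (fun _ => 0) x.2) (0, 0))
      (∏ k, stepFactor W X Y (fun k => P₁ k 0 (μ k, 0) * S₁ k (0, μ k) 0) μ k) := by
  have hchain := (h.isGradedChain hA).comp
    (f := fun k (s : FockIdx × FockIdx) => (s.1, μ k, s.2)) fun k s s' hs => by
      simpa [Prod.ext_iff] using hs
  have key := hchain.hasHahnSum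
    (ψ := fun k x => coh (shift (fun i n => starB (W i) (μ i) n + phiB (X i) ⊥ n) k) x.1 *
      coh (shift (fun i n => phiB (W i) (μ i) n + starB (Y i) ⊥ n) k) x.2)
    (fun x => by simpa only [shift_zero] using exists_vacuum_eq_single A x)
    (fun k y _ _ hT => h.eq_stepFactor_mul hW hX hY μ k y hT) (0, 0)
  simpa only [shift_zero, coh_zero_index, mul_one] using key

/-- The sum over the internal states of each of the operators may be carried out first. -/
lemma hasHahnSum_chainTerm
    {S : Fin N → FockIdx × FockIdx × YoungDiagram → YoungDiagram × FockIdx × FockIdx →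
      HahnSeries Γ BaseField}
    (hS : ∀ k o i, HasHahnSum (sixPointTerm (S₁ k) (P₁ k) (P₂ k) (S₂ k) o i) (S k o i))
    {ψ : FockIdx × FockIdx → HahnSeries Γ BaseField} (hψ : ψ (0, 0) = 1)
    (hψ' : ∀ x, x ≠ (0, 0) → ψ x = 0) {T : HahnSeries Γ BaseField}
    (hT : HasHahnSum (chainFamily (fourPointTerm S₁ S₂ P₁ P₂) ψ (0, 0)) T) :
    HasHahnSum (chainTerm fun k => fourPoint (S k)) T := by
  have h0 : ∀ (k : Fin N) (y x : FockIdx × FockIdx),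
      HasHahnSum (fun s => fourPointTerm S₁ S₂ P₁ P₂ k y s x) (fourPoint (S k) y x) :=
    fun k y x => hS k _ _
  have h1 : ∀ p : Fin N → FockIdx × FockIdx, HasHahnSum
      (fun s : Fin N → FockIdx × YoungDiagram × FockIdx =>
        ψ (Fin.snoc (α := fun _ => FockIdx × FockIdx) p (0, 0) 0) *
        ∏ k, fourPointTerm S₁ S₂ P₁ P₂ k
          (Fin.snoc (α := fun _ => FockIdx × FockIdx) p (0, 0) k.succ) (s k) (p k))
      (ψ (Fin.snoc (α := fun _ => FockIdx × FockIdx) p (0, 0) 0) *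
        ∏ k, fourPoint (S k) (Fin.snoc (α := fun _ => FockIdx × FockIdx) p (0, 0) k.succ)
          (p k)) := by
    intro p
    have h2 := HasHahnSum.prod_fin fun k => h0 k
      (Fin.snoc (α := fun _ => FockIdx × FockIdx) p (0, 0) k.succ) (p k)
    exact h2.const_mul _
  have h2 := hT.sigma h1
  let e : VacuumPath N → Fin N → FockIdx × FockIdx := fun q k => q.1 k.castSucc
  have hsnoc : ∀ q : VacuumPath N,
      Fin.snoc (α := fun _ => FockIdx × FockIdx) (e q) (0, 0) = q.1 := fun q => by
    refine funext fun j => ?_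
    induction j using Fin.lastCases with
    | last => rw [Fin.snoc_last, q.2.2]
    | cast j => rw [Fin.snoc_castSucc]
  have he : Function.Injective e := fun q q' hq => Subtype.ext (by rw [← hsnoc, hq, hsnoc])
  have h3 := (hasHahnSum_comp_injective he fun p hp => ?_).mpr h2
  · have heq : (chainTerm fun k => fourPoint (S k)) = fun q : VacuumPath N =>
        ψ (Fin.snoc (α := fun _ => FockIdx × FockIdx) (e q) (0, 0) 0) * ∏ k, fourPoint (S k)
          (Fin.snoc (α := fun _ => FockIdx × FockIdx) (e q) (0, 0) k.succ) (e q k) := by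
      refine funext fun q => ?_
      rw [hsnoc, q.2.1, hψ, one_mul]
      rfl
    rw [heq]
    exact h3
  · have hne : Fin.snoc (α := fun _ => FockIdx × FockIdx) p (0, 0) 0 ≠ (0, 0) := fun h0 =>
      hp ⟨⟨Fin.snoc (α := fun _ => FockIdx × FockIdx) p (0, 0), h0, Fin.snoc_last _ _⟩,
        funext fun k => Fin.snoc_castSucc (α := fun _ => FockIdx × FockIdx) (0, 0) p k⟩
    rw [hψ' _ hne, zero_mul]

/-- The sums over the partitions may be carried out last. -/
lemma HasHahnSum.of_partitions {ψ : FockIdx × FockIdx → HahnSeries Γ BaseField}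
    {T : HahnSeries Γ BaseField} {C : (Fin N → YoungDiagram) → HahnSeries Γ BaseField}
    (hT : HasHahnSum (chainFamily (fourPointTerm S₁ S₂ P₁ P₂) ψ (0, 0)) T)
    (hC : ∀ μ : Fin N → YoungDiagram, HasHahnSum
      (chainFamily (fun k y (s : FockIdx × FockIdx) x =>
        fourPointTerm S₁ S₂ P₁ P₂ k y (s.1, μ k, s.2) x) ψ (0, 0)) (C μ)) :
    HasHahnSum C T := by
  let E : (Fin N → YoungDiagram) × ((Fin N → FockIdx × FockIdx) × (Fin N → FockIdx × FockIdx)) ≃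
      (Fin N → FockIdx × FockIdx) × (Fin N → FockIdx × YoungDiagram × FockIdx) :=
    { toFun := fun z => (z.2.1, fun k => ((z.2.2 k).1, z.1 k, (z.2.2 k).2))
      invFun := fun z => (fun k => (z.2 k).2.1, z.1, fun k => ((z.2 k).1, (z.2 k).2.2))
      left_inv := fun _ => rfl
      right_inv := fun _ => rfl }
  have h1 := (hasHahnSum_comp_equiv E).mpr hT
  exact h1.sigma hC

/-- The vacuum matrix element of the network is the sum over the partitions on the internal
vertical edges of the products of the contractions. -/
theorem IsNetwork.exists_hasHahnSum (h : IsNetwork gw gx gy gus gvs S₁ S₂ P₁ P₂)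
    (hW : ∀ k, W k = HahnSeries.single (gw k) (-1))
    (hX : ∀ k, X k = HahnSeries.single (gx k) (-1))
    (hY : ∀ k, Y k = HahnSeries.single (gy k) (-1))
    {S : Fin N → FockIdx × FockIdx × YoungDiagram → YoungDiagram × FockIdx × FockIdx →
      HahnSeries Γ BaseField}
    (hS : ∀ k o i, HasHahnSum (sixPointTerm (S₁ k) (P₁ k) (P₂ k) (S₂ k) o i) (S k o i)) :
    ∃ T, HasHahnSum (chainTerm fun k => fourPoint (S k)) T ∧
      HasHahnSum (fun μ : Fin N → YoungDiagram =>
        ∏ k, stepFactor W X Y (fun k => P₁ k 0 (μ k, 0) * S₁ k (0, μ k) 0) μ k) T := by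
  obtain ⟨A, hA⟩ : ∃ A, ∀ k, gw k < A := by
    cases N with
    | zero => exact ⟨0, fun k => k.elim0⟩
    | succ n =>
      obtain ⟨B, hB⟩ := Finite.exists_le gw
      exact ⟨B + (gvs 0 - gus 0), fun k => (hB k).trans_lt
        (lt_add_of_pos_right _ (sub_pos.mpr (h.u_lt_v 0)))⟩
  obtain ⟨T, hT⟩ := (h.isGradedChain hA).exists_hasHahnSum
    (ψ := fun x => coh (fun _ => 0) x.1 * coh (fun _ => 0) x.2)
    (exists_vacuum_eq_single A) (0, 0)
  refine ⟨T, hasHahnSum_chainTerm hS (by simp only [coh_zero_index, one_mul]) (fun x hx => ?_) hT,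
    HasHahnSum.of_partitions hT fun μ => h.hasHahnSum_of_partitions hW hX hY hA μ⟩
  by_cases h1 : x.1 = 0
  · rw [coh_zero_of_ne fun h2 => hx (Prod.ext h1 h2), mul_zero]
  · rw [coh_zero_of_ne h1, zero_mul]

/-- The product of the vacuum entries of the two intertwining operators with the partition `la`
on the common edge. -/
lemma IsNetwork.vacuum_mul_vacuum (h : IsNetwork gw gx gy gus gvs S₁ S₂ P₁ P₂)
    (k : Fin N) (la : YoungDiagram) :
    P₁ k 0 (la, 0) * S₁ k (0, la) 0 * nekN la la 1 = ∏ s ∈ la.cells,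
      (-(HahnSeries.single (gvs k) 1 / HahnSeries.single (gus k) 1) *
        ((qtHalf (HahnSeries Γ BaseField))⁻¹ ^ 2 * (content _ s)⁻¹)) := by
  obtain ⟨a₁, h₁⟩ := h.S₁ k
  obtain ⟨a₂, h₂⟩ := h.P₁ k
  have hone : (-1 : BaseField) ≠ 0 := neg_ne_zero.mpr one_ne_zero
  rw [TopVertex.vacuum_mul_vacuum h₂ h₁ (HahnSeries.single_ne_zero hone)
    (HahnSeries.single_ne_zero one_ne_zero)]
  refine prod_congr rfl fun s _ => ?_
  rw [HahnSeries.single_mul_single, HahnSeries.single_div_single, HahnSeries.single_div_single,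
    ← HahnSeries.single_neg, one_mul, div_one, add_sub_add_right_eq_sub, div_neg, div_one]

end Total

/-! ### The parameters -/

section Parameters

open Finset

/-- The expansion directions order all the parameters: `w_k` has a smaller exponent than every `x_i` with
`i < k`. -/
lemma lt_of_interlacing {Γ : Type*} [Preorder Γ] {N : ℕ} {gw gx : Fin N → Γ}
    (hxw : ∀ k, gx k < gw k) (hwx : ∀ k l : Fin N, k.val + 1 = l.val → gw l < gx k)
    (i k : Fin N) (hik : i < k) : gw k < gx i := by
  obtain ⟨k, hk⟩ := k
  induction k with
  | zero => exact absurd hik (Nat.not_lt_zero _)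
  | succ k ih =>
    rcases (Nat.lt_succ_iff_lt_or_eq.mp hik) with hlt | heq
    · exact (hwx ⟨k, by omega⟩ ⟨k + 1, hk⟩ rfl).trans ((hxw _).trans (ih (by omega) hlt))
    · exact hwx i ⟨k + 1, hk⟩ (by simp [heq])

/-- The factor `v_k / u_k` that the vacuum entries of the `k`-th operator contribute, and the factors
from the reflections, combine to `Λ^{2N}` for every `k`. -/
lemma instantonParameter_eq {L : Type*} [Field L] [Algebra BaseField L] {N : ℕ} {u v : L}
    {w x y : Fin N → L} (hx : ∀ k, x k ≠ 0) (hw : ∀ k, w k ≠ 0) (k : Fin N) :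
    qtHalf L ^ (-(N : ℤ)) * (v / u) * ∏ i, w i / y i =
      paramSeq v w y k / paramSeq u x w k * ((qtHalf L)⁻¹ * (w k / y k)) *
        ((∏ j ∈ Ioi k, (qtHalf L)⁻¹ * (w j / y j)) * ∏ i ∈ Iio k, (qtHalf L)⁻¹ * (x i / w i)) := by
  have h1 : qtHalf L ^ (-(N : ℤ)) * (v / u) * ∏ i, w i / y i =
      v / u * ∏ i, (qtHalf L)⁻¹ * (w i / y i) := by
    rw [prod_mul_distrib, prod_const, card_univ, Fintype.card_fin, zpow_neg, zpow_natCast, inv_pow]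
    ring
  have h2 : (∏ i, (qtHalf L)⁻¹ * (w i / y i)) = (qtHalf L)⁻¹ * (w k / y k) *
      ((∏ i ∈ Iio k, (qtHalf L)⁻¹ * (w i / y i)) * ∏ j ∈ Ioi k, (qtHalf L)⁻¹ * (w j / y j)) :=
    prod_eq_mul_Iio_mul_Ioi _ k
  have h3 : ∏ i ∈ Iio k, (qtHalf L)⁻¹ * (w i / y i) =
      (∏ i ∈ Iio k, w i / y i) / (∏ i ∈ Iio k, x i / w i) *
        ∏ i ∈ Iio k, (qtHalf L)⁻¹ * (x i / w i) := by
    rw [← prod_div_distrib, ← prod_mul_distrib]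
    refine prod_congr rfl fun i _ => ?_
    have := hx i
    have := hw i
    field_simp
  rw [h1, h2, h3, paramSeq, paramSeq]
  ring

variable {Γ : Type*} [AddCommGroup Γ] [LinearOrder Γ] [IsOrderedAddMonoid Γ] {N : ℕ}

lemma paramSeq_single {K : Type*} [Field K] (g : Γ) {gb gc : Fin N → Γ}
    {b c : Fin N → HahnSeries Γ K}
    (hb : ∀ k, b k = HahnSeries.single (gb k) 1) (hc : ∀ k, c k = HahnSeries.single (gc k) 1)
    (k : Fin N) :
    paramSeq (HahnSeries.single g 1) b c k =
      HahnSeries.single (g + ∑ i ∈ Iio k, (gb i - gc i)) 1 := by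
  simp only [paramSeq, hb, hc, HahnSeries.single_div_single, div_one, prod_single, prod_const_one,
    HahnSeries.single_mul_single, one_mul]

lemma single_neg_one_div (g g' : Γ) :
    HahnSeries.single g (-1 : BaseField) / HahnSeries.single g' (-1 : BaseField) =
      HahnSeries.single g 1 / HahnSeries.single g' 1 := by
  have h : (-1 : BaseField) / -1 = 1 / 1 := by norm_num
  rw [HahnSeries.single_div_single, HahnSeries.single_div_single, h]

lemma neg_qtHalf_mul_single (g : Γ) :
    -(qtHalf (HahnSeries Γ BaseField) * HahnSeries.single g 1) =
      qtHalf (HahnSeries Γ BaseField) * HahnSeries.single g (-1) := by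
  have h : -(qtHalf BaseField * 1) = qtHalf BaseField * -1 := by ring
  rw [qtHalf_mul_single, qtHalf_mul_single, ← HahnSeries.single_neg, h]

lemma neg_inv_qtHalf_mul_single (g : Γ) :
    -((qtHalf (HahnSeries Γ BaseField))⁻¹ * HahnSeries.single g 1) =
      (qtHalf (HahnSeries Γ BaseField))⁻¹ * HahnSeries.single g (-1) := by
  have h : -((qtHalf BaseField)⁻¹ * 1) = (qtHalf BaseField)⁻¹ * -1 := by ring
  have h' : ∀ c : BaseField, (qtHalf (HahnSeries Γ BaseField))⁻¹ * HahnSeries.single g c =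
      HahnSeries.single g ((qtHalf BaseField)⁻¹ * c) := fun c => by
    rw [← algebraMap_qtHalf, ← map_inv₀]
    simpa using algebraMap_mul_single_pow (g := g) (c := c) (qtHalf BaseField)⁻¹ 1
  rw [h', h', ← HahnSeries.single_neg, h]

lemma perturbativeFactor_ne_zero (e e' e'' : Fin N → HahnSeries Γ BaseField) :
    perturbativeFactor e e' e'' ≠ 0 := by
  have h := fun z : HahnSeries Γ BaseField => evalG_ne_zero z
  refine mul_ne_zero (prod_ne_zero_iff.mpr fun k _ => ?_)
    (prod_ne_zero_iff.mpr fun i _ => prod_ne_zero_iff.mpr fun j _ => ?_)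
  · exact div_ne_zero one_ne_zero (mul_ne_zero (h _) (h _))
  · exact div_ne_zero (mul_ne_zero (mul_ne_zero (mul_ne_zero (h _) (h _)) (h _)) (h _))
      (mul_ne_zero (mul_ne_zero (mul_ne_zero (h _) (h _)) (h _)) (h _))

end Parameters

end TopVertex

end

theorem proposition5
    {Γ : Type*} [AddCommGroup Γ] [LinearOrder Γ] [IsOrderedAddMonoid Γ] (N : ℕ)
    -- the indeterminates, with their exponents
    (gu gv : Γ) (gw gx gy : Fin N → Γ)
    (u v : HahnSeries Γ TopVertex.BaseField) (w x y : Fin N → HahnSeries Γ TopVertex.BaseField)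
    (hu : u = HahnSeries.single gu 1) (hv : v = HahnSeries.single gv 1)
    (hw : ∀ k, w k = HahnSeries.single (gw k) 1) (hx : ∀ k, x k = HahnSeries.single (gx k) 1)
    (hy : ∀ k, y k = HahnSeries.single (gy k) 1)
    -- the direction of expansion: series in v/u, w_k/x_k, w_k/y_k, x_k/w_{k+1}, y_k/w_{k+1}
    (huv : gu < gv) (hxw : ∀ k, gx k < gw k) (hyw : ∀ k, gy k < gw k)
    (hwx : ∀ k l : Fin N, k.val + 1 = l.val → gw l < gx k)
    (hwy : ∀ k l : Fin N, k.val + 1 = l.val → gw l < gy k)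
    -- the spectral parameters u_k, v_k
    (us vs : Fin N → HahnSeries Γ TopVertex.BaseField)
    (hus : us = TopVertex.paramSeq u x w) (hvs : vs = TopVertex.paramSeq v w y)
    -- the trivalent intertwining operators of the k-th six point operator
    (S₁ S₂ : Fin N → TopVertex.FockIdx × YoungDiagram → TopVertex.FockIdx →
      HahnSeries Γ TopVertex.BaseField)
    (P₁ P₂ : Fin N → TopVertex.FockIdx → YoungDiagram × TopVertex.FockIdx →
      HahnSeries Γ TopVertex.BaseField)
    (hS₁ : ∀ k, TopVertex.IsPhiStar (-1) (us k / w k) (-w k) (us k) (S₁ k))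
    (hP₁ : ∀ k, TopVertex.IsPhi 0 (-w k) (vs k) (vs k * w k) (P₁ k))
    (hP₂ : ∀ k, TopVertex.IsPhi (-1) (-x k) (us k / w k) (us k * x k / w k) (P₂ k))
    (hS₂ : ∀ k, TopVertex.IsPhiStar 0 (vs k * w k / y k) (-y k) (vs k * w k) (S₂ k))
    -- the parameters of the partition function
    (e e' e'' : Fin N → HahnSeries Γ TopVertex.BaseField) (Lam2N : HahnSeries Γ TopVertex.BaseField)
    (he : ∀ k, e k = -w k)
    (he' : ∀ k, e' k = -(TopVertex.qtHalf (HahnSeries Γ TopVertex.BaseField) * y k))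
    (he'' : ∀ k, e'' k = -((TopVertex.qtHalf (HahnSeries Γ TopVertex.BaseField))⁻¹ * x k))
    (hLam : Lam2N = TopVertex.qtHalf (HahnSeries Γ TopVertex.BaseField) ^ (-(N : ℤ)) * (v / u) *
      ∏ k, w k / y k) :
    -- the six point operators are well defined
    ∃ S : Fin N → TopVertex.FockIdx × TopVertex.FockIdx × YoungDiagram →
        YoungDiagram × TopVertex.FockIdx × TopVertex.FockIdx → HahnSeries Γ TopVertex.BaseField,
      (∀ k o i, TopVertex.HasHahnSum
        (TopVertex.sixPointTerm (S₁ k) (P₁ k) (P₂ k) (S₂ k) o i) (S k o i)) ∧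
      -- the instanton sum is well defined
      ∃ Z : HahnSeries Γ TopVertex.BaseField,
        TopVertex.HasHahnSum (TopVertex.nekrasovTerm e e' e'' Lam2N) Z ∧
        -- the vacuum matrix element of the chain of the restricted operators
        TopVertex.HasHahnSum (TopVertex.chainTerm fun k => TopVertex.fourPoint (S k))
          (TopVertex.perturbativeFactor e e' e'' * Z) := by

  have hus' : ∀ k, us k = HahnSeries.single (gu + ∑ i ∈ Finset.Iio k, (gx i - gw i)) 1 :=
    fun k => by rw [hus, hu, TopVertex.paramSeq_single gu hx hw]
  have hvs' : ∀ k, vs k = HahnSeries.single (gv + ∑ i ∈ Finset.Iio k, (gw i - gy i)) 1 :=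
    fun k => by rw [hvs, hv, TopVertex.paramSeq_single gv hw hy]
  have hW : ∀ k, -w k = HahnSeries.single (gw k) (-1) := fun k => by
    rw [hw, HahnSeries.single_neg]
  have hX : ∀ k, -x k = HahnSeries.single (gx k) (-1) := fun k => by
    rw [hx, HahnSeries.single_neg]
  have hY : ∀ k, -y k = HahnSeries.single (gy k) (-1) := fun k => by
    rw [hy, HahnSeries.single_neg]
  have h : TopVertex.IsNetwork gw gx gy (fun k => gu + ∑ i ∈ Finset.Iio k, (gx i - gw i))
      (fun k => gv + ∑ i ∈ Finset.Iio k, (gw i - gy i)) S₁ S₂ P₁ P₂ :=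
    { S₁ := fun k => ⟨_, by rw [← hW, ← hus' k]; exact hS₁ k⟩
      P₁ := fun k => ⟨_, by
        have := hP₁ k
        rwa [hW, hvs' k, hw, HahnSeries.single_mul_single, one_mul] at this⟩
      P₂ := fun k => ⟨_, _, by rw [← hX]; exact hP₂ k⟩
      S₂ := fun k => ⟨_, _, by rw [← hY]; exact hS₂ k⟩
      x_lt_w := hxw
      y_lt_w := hyw
      w_lt_x := TopVertex.lt_of_interlacing hxw hwx
      w_lt_y := TopVertex.lt_of_interlacing hyw hwy
      u_lt_v := fun k => add_lt_add_of_lt_of_le huv (Finset.sum_le_sum fun i _ =>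
        (sub_neg.mpr (hxw i)).le.trans (sub_pos.mpr (hyw i)).le) }
  choose S hS using h.exists_hasHahnSum_sixPointTerm
  obtain ⟨T, hT, hT'⟩ := h.exists_hasHahnSum (W := fun k => HahnSeries.single (gw k) (-1))
    (X := fun k => HahnSeries.single (gx k) (-1)) (Y := fun k => HahnSeries.single (gy k) (-1))
    (fun _ => rfl) (fun _ => rfl) (fun _ => rfl) hS
  have hw0 : ∀ k, w k ≠ 0 := fun k => hw k ▸ HahnSeries.single_ne_zero one_ne_zero
  have hx0 : ∀ k, x k ≠ 0 := fun k => hx k ▸ HahnSeries.single_ne_zero one_ne_zero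
  have hone : (-1 : TopVertex.BaseField) ≠ 0 := neg_ne_zero.mpr one_ne_zero
  have hterm : ∀ μ : Fin N → YoungDiagram,
      ∏ k, TopVertex.stepFactor (fun k => HahnSeries.single (gw k) (-1))
        (fun k => HahnSeries.single (gx k) (-1)) (fun k => HahnSeries.single (gy k) (-1))
        (fun k => P₁ k 0 (μ k, 0) * S₁ k (0, μ k) 0) μ k =
      TopVertex.perturbativeFactor e e' e'' * TopVertex.nekrasovTerm e e' e'' Lam2N μ := by
    intro μ
    refine TopVertex.prod_contractions_eq (G := TopVertex.evalG)
      (fun k => HahnSeries.single_ne_zero hone) (fun k => HahnSeries.single_ne_zero hone)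
      (fun k => HahnSeries.single_ne_zero hone) μ (fun k => h.vacuum_mul_vacuum k (μ k))
      (fun k => ?_) (fun k => by rw [he, hW])
      (fun k => by rw [he', hy, TopVertex.neg_qtHalf_mul_single])
      (fun k => by rw [he'', hx, TopVertex.neg_inv_qtHalf_mul_single])
    simp only [TopVertex.single_neg_one_div, ← hw, ← hx, ← hy, ← hus', ← hvs']
    rw [hLam, hus, hvs, neg_neg]
    exact TopVertex.instantonParameter_eq hx0 hw0 k
  have hpert := TopVertex.perturbativeFactor_ne_zero e e' e''
  refine ⟨S, hS, (TopVertex.perturbativeFactor e e' e'')⁻¹ * T, ?_, ?_⟩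
  · have h1 := hT'.const_mul (TopVertex.perturbativeFactor e e' e'')⁻¹
    simpa only [hterm, inv_mul_cancel_left₀ hpert] using h1
  · rwa [mul_inv_cancel_left₀ hpert]
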